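/- Let $k$ be a field and let $H$ be a Hopf algebra over $k$ with comultiplication $\Delta$, counit $\varepsilon$ and bijective antipode. Let $A\subseteq H$ be a right coideal subalgebra, that is, a subalgebra with $\Delta(A)\subseteq A\otimes H$. Put $A^+=A\cap\operatorname{Ker}\varepsilon$ and $C=H/HA^+$; since $HA^+$ is a left ideal and a coideal of $H$, $C$ is a coalgebra and a left $H$-module. Suppose that $H$ is faithfully flat over $A$ both as a left and as a right $A$-module. Suppose further that at least one of the following holds: (a) $A$ has finite weak global dimension, i.e. there is an $n$ such that every $A$-module has a flat resolution of length at most $n$; (b) $C$ has finite global dimension, i.e. there is an $n$ such that every $C$-comodule has an injective resolution of length at most $n$. (These dimensions are the same whether computed with left or with right modules, respectively comodules.) Then all four of the following properties hold: (0.1) every object of $\mathcal M_A^H$ is projective as a right $A$-module; (0.2) every object of ${}_H^{\,C}\mathcal M$ is injective in the category ${}^C\mathcal M$ of left $C$-comodules; (0.3) every object of ${}_A\mathcal M^H$ is projective as a left $A$-module; (0.4) every object of ${}_H\mathcal M^C$ is injective in the category $\mathcal M^C$ of right $C$-comodules. Here an object of $\mathcal M_A^H$ (respectively ${}_A\mathcal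 M^H$) is a right (respectively left) $A$-module $M$ with a right $H$-comodule structure such that the action $M\otimes A\to M$ (respectively $A\otimes M\to M$) is $H$-colinear. An object of ${}_H^{\,C}\mathcal M$ (respectively ${}_H\mathcal M^C$) is a left $H$-module $M$ with a left (respectively right) $C$-comodule structure such that the action $H\otimes M\to M$ is $C$-colinear. Tensor products are over $k$ and carry the tensor product comodule structures: $A$ coacted on by $H$ via $\Delta$ in the first two cases, and the coaction of $C$ on $H\otimes M$ induced by $\Delta$ and the action $H\otimes C\to C$ in the last two. -/

import Mathlib

open scoped TensorProduct
open Coalgebra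

universe u

noncomputable section

/-! ### Tensor products and flatness over a ring that need not be commutative

Right `R`-modules are modules over `Rᵐᵒᵖ`. -/

section Flatness

variable (R : Type u) [Ring R]

/-- The relations `n r ⊗ m = n ⊗ r m` that cut out `N ⊗_R M` from `N ⊗_ℤ M`. -/
def balancedRel (N M : Type u) [AddCommGroup N] [Module Rᵐᵒᵖ N] [AddCommGroup M] [Module R M] :
    AddSubgroup (N ⊗[ℤ] M) :=
  AddSubgroup.closure
    {t | ∃ (n : N) (r : R) (m : M), t = (MulOpposite.op r • n) ⊗ₜ[ℤ] m - n ⊗ₜ[ℤ] (r • m)}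

/-- The tensor product `N ⊗_R M` of a right `R`-module `N` and a left `R`-module `M`
(an abelian group). -/
abbrev BalancedTensor (N M : Type u) [AddCommGroup N] [Module Rᵐᵒᵖ N]
    [AddCommGroup M] [Module R M] : Type u :=
  (N ⊗[ℤ] M) ⧸ balancedRel R N M

/-- The map `f ⊗_R id : N ⊗_R M → N' ⊗_R M` induced by a map `f : N → N'` of right modules. -/
def BalancedTensor.mapLeft {N N' : Type u} (M : Type u) [AddCommGroup N] [Module Rᵐᵒᵖ N]
    [AddCommGroup N'] [Module Rᵐᵒᵖ N'] [AddCommGroup M] [Module R M] (f : N →ₗ[Rᵐᵒᵖ] N') :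
    BalancedTensor R N M →+ BalancedTensor R N' M :=
  QuotientAddGroup.map _ _ (f.toAddMonoidHom.toIntLinearMap.rTensor M).toAddMonoidHom (by
    refine (AddSubgroup.closure_le _).mpr ?_
    rintro _ ⟨n, r, m, rfl⟩
    refine AddSubgroup.subset_closure ⟨f n, r, m, ?_⟩
    rw [map_sub, ← map_smul]
    rfl)

/-- The map `id ⊗_R f : N ⊗_R M → N ⊗_R M'` induced by a map `f : M → M'` of left modules. -/
def BalancedTensor.mapRight (N : Type u) {M M' : Type u} [AddCommGroup N] [Module Rᵐᵒᵖ N]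
    [AddCommGroup M] [Module R M] [AddCommGroup M'] [Module R M'] (f : M →ₗ[R] M') :
    BalancedTensor R N M →+ BalancedTensor R N M' :=
  QuotientAddGroup.map _ _ (f.toAddMonoidHom.toIntLinearMap.lTensor N).toAddMonoidHom (by
    refine (AddSubgroup.closure_le _).mpr ?_
    rintro _ ⟨n, r, m, rfl⟩
    refine AddSubgroup.subset_closure ⟨n, r, f m, ?_⟩
    rw [map_sub, ← map_smul]
    rfl)

/-- A left `R`-module `M` is flat: the functor `? ⊗_R M` on right modules preserves
monomorphisms. -/
def LeftFlat (M : Type u) [AddCommGroup M] [Module R M] : Prop :=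
  ∀ (N N' : Type u) [AddCommGroup N] [Module Rᵐᵒᵖ N] [AddCommGroup N'] [Module Rᵐᵒᵖ N']
    (f : N →ₗ[Rᵐᵒᵖ] N'), Function.Injective f →
      Function.Injective (BalancedTensor.mapLeft R M f)

/-- A right `R`-module `N` is flat: the functor `N ⊗_R ?` on left modules preserves
monomorphisms. -/
def RightFlat (N : Type u) [AddCommGroup N] [Module Rᵐᵒᵖ N] : Prop :=
  ∀ (M M' : Type u) [AddCommGroup M] [Module R M] [AddCommGroup M'] [Module R M']
    (f : M →ₗ[R] M'), Function.Injective f →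
      Function.Injective (BalancedTensor.mapRight R N f)

/-- A left `R`-module `M` is faithfully flat: it is flat and `N ⊗_R M = 0` only if `N = 0`. -/
def LeftFaithfullyFlat (M : Type u) [AddCommGroup M] [Module R M] : Prop :=
  LeftFlat R M ∧ ∀ (N : Type u) [AddCommGroup N] [Module Rᵐᵒᵖ N],
    Subsingleton (BalancedTensor R N M) → Subsingleton N

/-- A right `R`-module `N` is faithfully flat: it is flat and `N ⊗_R M = 0` only if `M = 0`. -/
def RightFaithfullyFlat (N : Type u) [AddCommGroup N] [Module Rᵐᵒᵖ N] : Prop :=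
  RightFlat R N ∧ ∀ (M : Type u) [AddCommGroup M] [Module R M],
    Subsingleton (BalancedTensor R N M) → Subsingleton M

/-- The left `R`-module `M` has a flat resolution `0 → F_n → ⋯ → F_1 → F_0 → M → 0`,
spliced from short exact sequences `0 → K → F_0 → M → 0`. -/
def HasFlatResolution : ℕ → ∀ (M : Type u) [AddCommGroup M] [Module R M], Prop
  | 0, M, _, _ => LeftFlat R M
  | n + 1, M, _, _ => ∃ (K F : Type u) (_ : AddCommGroup K) (_ : Module R K)
      (_ : AddCommGroup F) (_ : Module R F) (i : K →ₗ[R] F) (p : F →ₗ[R] M),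
      Function.Injective i ∧ Function.Exact i p ∧ Function.Surjective p ∧
        LeftFlat R F ∧ HasFlatResolution n K

/-- `R` has finite weak global dimension: for some `n`, each (left) module has a flat resolution
of length at most `n`. -/
def HasFiniteWeakGlobalDimension : Prop :=
  ∃ n : ℕ, ∀ (M : Type u) [AddCommGroup M] [Module R M], HasFlatResolution R n M

end Flatness

/-! ### Comodules over a coalgebra -/

section Comodules

variable (k : Type u) [Field k] (C : Type u) [AddCommGroup C] [Module k C] [Coalgebra k C]

/-- A right `C`-comodule structure on the vector space `V`. -/
structure RightComodule (V : Type u) [AddCommGroup V] [Module k V] where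
  /-- the coaction -/
  coact : V →ₗ[k] V ⊗[k] C
  coassoc : (TensorProduct.assoc k V C C).toLinearMap ∘ₗ coact.rTensor C ∘ₗ coact =
    (comul (R := k) (A := C)).lTensor V ∘ₗ coact
  counit_coact : (counit (R := k) (A := C)).lTensor V ∘ₗ coact = (TensorProduct.mk k V k).flip 1

/-- A left `C`-comodule structure on the vector space `V`. -/
structure LeftComodule (V : Type u) [AddCommGroup V] [Module k V] where
  /-- the coaction -/
  coact : V →ₗ[k] C ⊗[k] V
  coassoc : (TensorProduct.assoc k C C V).toLinearMap ∘ₗ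
      (comul (R := k) (A := C)).rTensor V ∘ₗ coact = coact.lTensor C ∘ₗ coact
  counit_coact : (counit (R := k) (A := C)).rTensor V ∘ₗ coact = TensorProduct.mk k k V 1

variable {k C}
variable {V W : Type u} [AddCommGroup V] [Module k V] [AddCommGroup W] [Module k W]

/-- The linear map `f` is a morphism of right comodules. -/
def RightComodule.IsHom (ρ : RightComodule k C V) (σ : RightComodule k C W) (f : V →ₗ[k] W) :
    Prop :=
  f.rTensor C ∘ₗ ρ.coact = σ.coact ∘ₗ f

/-- The linear map `f` is a morphism of left comodules. -/
def LeftComodule.IsHom (ρ : LeftComodule k C V) (σ : LeftComodule k C W) (f : V →ₗ[k] W) :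
    Prop :=
  f.lTensor C ∘ₗ ρ.coact = σ.coact ∘ₗ f

/-- The right comodule `V` is injective in the category `𝓜^C` of right comodules: each morphism
`X → V` extends along each injective morphism `X → Y`. -/
def RightComodule.IsInjective (ρ : RightComodule k C V) : Prop :=
  ∀ (X Y : Type u) [AddCommGroup X] [Module k X] [AddCommGroup Y] [Module k Y]
    (σ : RightComodule k C X) (τ : RightComodule k C Y) (i : X →ₗ[k] Y) (g : X →ₗ[k] V),
    σ.IsHom τ i → Function.Injective i → σ.IsHom ρ g →
      ∃ h : Y →ₗ[k] V, τ.IsHom ρ h ∧ h ∘ₗ i = g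

/-- The left comodule `V` is injective in the category `^C𝓜` of left comodules. -/
def LeftComodule.IsInjective (ρ : LeftComodule k C V) : Prop :=
  ∀ (X Y : Type u) [AddCommGroup X] [Module k X] [AddCommGroup Y] [Module k Y]
    (σ : LeftComodule k C X) (τ : LeftComodule k C Y) (i : X →ₗ[k] Y) (g : X →ₗ[k] V),
    σ.IsHom τ i → Function.Injective i → σ.IsHom ρ g →
      ∃ h : Y →ₗ[k] V, τ.IsHom ρ h ∧ h ∘ₗ i = g

/-- The right comodule `V` has an injective resolution `0 → V → Q_0 → Q_1 → ⋯ → Q_n → 0`,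
spliced from short exact sequences `0 → V → Q_0 → K → 0`. -/
def RightComodule.HasInjectiveResolution :
    ℕ → ∀ {V : Type u} [AddCommGroup V] [Module k V] (_ : RightComodule k C V), Prop
  | 0, _, _, _, ρ => ρ.IsInjective
  | n + 1, V, _, _, ρ => ∃ (Q K : Type u) (_ : AddCommGroup Q) (_ : Module k Q)
      (_ : AddCommGroup K) (_ : Module k K) (σ : RightComodule k C Q) (τ : RightComodule k C K)
      (i : V →ₗ[k] Q) (p : Q →ₗ[k] K), ρ.IsHom σ i ∧ σ.IsHom τ p ∧
      Function.Injective i ∧ Function.Exact i p ∧ Function.Surjective p ∧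
        σ.IsInjective ∧ HasInjectiveResolution n τ

variable (k C) in
/-- The coalgebra `C` has finite global dimension: for some `n`, each (right) comodule has
injective dimension at most `n`. -/
def HasFiniteCoalgebraGlobalDimension : Prop :=
  ∃ n : ℕ, ∀ (V : Type u) [AddCommGroup V] [Module k V] (ρ : RightComodule k C V),
    ρ.HasInjectiveResolution n

end Comodules

/-! ### Actions as linear maps -/

section Actions

variable (k : Type u) [Field k] (R : Type u) [Ring R] [Algebra k R]
variable (M : Type u) [AddCommGroup M] [Module k M]

/-- The action map `R ⊗ M → M`, `r ⊗ m ↦ r m`, of a left module. -/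
def leftAct [Module R M] [IsScalarTower k R M] : R ⊗[k] M →ₗ[k] M :=
  TensorProduct.lift (Algebra.lsmul k k M : R →ₐ[k] Module.End k M).toLinearMap

/-- The action map `M ⊗ R → M`, `m ⊗ r ↦ m r`, of a right module. -/
def rightAct [Module Rᵐᵒᵖ M] [IsScalarTower k Rᵐᵒᵖ M] : M ⊗[k] R →ₗ[k] M :=
  TensorProduct.lift ((Algebra.lsmul k k M : Rᵐᵒᵖ →ₐ[k] Module.End k M).toLinearMap ∘ₗ
    (MulOpposite.opLinearEquiv k : R ≃ₗ[k] Rᵐᵒᵖ).toLinearMap).flip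

end Actions

/-! ### Right coideal subalgebras and their factor coalgebras -/

section Coideal

variable {k : Type u} [Field k] {H : Type u} [Ring H] [HopfAlgebra k H] (A : Subalgebra k H)

/-- The subalgebra `A` is a right coideal of `H`: `Δ(A) ⊆ A ⊗ H`. -/
class IsRightCoideal : Prop where
  comul_mem : ∀ a ∈ A, comul (R := k) a ∈ LinearMap.range (A.val.toLinearMap.rTensor H)

/-- `H` as a right module over its subalgebra `A`, by right multiplication. -/
instance subalgebraRightModule : Module (A)ᵐᵒᵖ H :=
  Module.compHom H (RingHom.op (A.val : A →ₐ[k] H).toRingHom)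

theorem rTensor_val_injective :
    Function.Injective (A.val.toLinearMap.rTensor H) :=
  Module.Flat.rTensor_preserves_injective_linearMap _ Subtype.val_injective

/-- The right coaction `A → A ⊗ H`, the restriction of the comultiplication of `H`. -/
def coidealCoact [IsRightCoideal A] : A →ₗ[k] A ⊗[k] H :=
  (LinearEquiv.ofInjective _ (rTensor_val_injective A)).symm.toLinearMap ∘ₗ
    LinearMap.codRestrict (LinearMap.range (A.val.toLinearMap.rTensor H))
      (comul (R := k) ∘ₗ A.val.toLinearMap) (fun a => IsRightCoideal.comul_mem _ a.2)

theorem rTensor_coidealCoact [IsRightCoideal A] (a : A) :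
    A.val.toLinearMap.rTensor H (coidealCoact A a) = comul (R := k) (a : H) :=
  congrArg Subtype.val ((LinearEquiv.ofInjective _ (rTensor_val_injective A)).apply_symm_apply _)

/-- The left ideal `H A⁺` of `H` generated by the augmentation ideal `A⁺ = A ∩ Ker ε`. -/
def augmentationLeftIdeal : Ideal H :=
  Ideal.span {a : H | a ∈ A ∧ counit (R := k) a = 0}

instance augmentationLeftIdeal_isCoideal [IsRightCoideal A] :
    ((augmentationLeftIdeal A).restrictScalars k).IsCoideal where
  counit_eq_zero x hx := by
    have hx' : x ∈ augmentationLeftIdeal A := hx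
    have hle : augmentationLeftIdeal A ≤ RingHom.ker (Bialgebra.counitAlgHom k H) := by
      refine Ideal.span_le.mpr ?_
      rintro a ⟨-, ha⟩
      exact ha
    exact hle hx'
  map_mkQ_comul_eq_zero x hx := by
    have hx' : x ∈ augmentationLeftIdeal A := hx
    clear hx
    set I := (augmentationLeftIdeal A).restrictScalars k with hI
    have hmul : ∀ (t s : H ⊗[k] H), TensorProduct.map I.mkQ I.mkQ s = 0 →
        TensorProduct.map I.mkQ I.mkQ (t * s) = 0 := by
      intro t s hs
      induction t with
      | zero => simp
      | add t₁ t₂ h₁ h₂ => rw [add_mul, map_add, h₁, h₂, add_zero]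
      | tmul u v =>
        let L : H → (H ⧸ I) →ₗ[k] (H ⧸ I) := fun w =>
          I.mapQ I (LinearMap.mulLeft k w) fun y hy =>
            (augmentationLeftIdeal A).mul_mem_left w hy
        have key : TensorProduct.map I.mkQ I.mkQ ∘ₗ LinearMap.mulLeft k (u ⊗ₜ[k] v) =
            TensorProduct.map (L u) (L v) ∘ₗ TensorProduct.map I.mkQ I.mkQ := by
          refine TensorProduct.ext' fun a b => ?_
          simp only [LinearMap.comp_apply, LinearMap.mulLeft_apply,
            Algebra.TensorProduct.tmul_mul_tmul, TensorProduct.map_tmul]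
          rfl
        have := LinearMap.congr_fun key s
        simp only [LinearMap.comp_apply, LinearMap.mulLeft_apply] at this
        rw [this, hs, map_zero]
    have hgen : ∀ a ∈ A, counit (R := k) a = 0 →
        TensorProduct.map I.mkQ I.mkQ (comul (R := k) a) = 0 := by
      intro a ha ha0
      have h1 : I.mkQ ∘ₗ A.val.toLinearMap =
          (LinearMap.toSpanSingleton k (H ⧸ I) (I.mkQ 1) ∘ₗ counit) ∘ₗ A.val.toLinearMap := by
        ext b
        simp only [LinearMap.comp_apply, LinearMap.toSpanSingleton_apply]
        rw [← map_smul, ← sub_eq_zero, ← map_sub, Submodule.mkQ_apply,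
          Submodule.Quotient.mk_eq_zero]
        refine Ideal.subset_span ⟨?_, ?_⟩
        · exact A.sub_mem b.2 (A.smul_mem A.one_mem _)
        · simp
      obtain ⟨t, ht⟩ := IsRightCoideal.comul_mem a ha
      have h2 : TensorProduct.map I.mkQ I.mkQ (comul (R := k) a) =
          TensorProduct.map (LinearMap.toSpanSingleton k (H ⧸ I) (I.mkQ 1)) I.mkQ
            ((counit (R := k) (A := H)).rTensor H (comul (R := k) a)) := by
        rw [← ht]
        simp only [← LinearMap.comp_apply, LinearMap.rTensor, ← TensorProduct.map_comp]
        rw [h1]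
        simp only [LinearMap.comp_id]
        rfl
      rw [h2, rTensor_counit_comul, TensorProduct.map_tmul, Submodule.mkQ_apply I a,
        (Submodule.Quotient.mk_eq_zero I).mpr (Ideal.subset_span ⟨ha, ha0⟩),
        TensorProduct.tmul_zero]
    induction hx' using Submodule.span_induction with
    | mem x h => exact hgen x h.1 h.2
    | zero => simp
    | add x y hx hy h₁ h₂ => rw [map_add, map_add, h₁, h₂, add_zero]
    | smul h x hx h₁ =>
      rw [smul_eq_mul, Bialgebra.comul_mul]
      exact hmul _ _ h₁

/-- The factor coalgebra `C = H / H A⁺` (with the quotient coalgebra structure). -/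
abbrev FactorCoalgebra : Type u := H ⧸ (augmentationLeftIdeal A).restrictScalars k

/-- The left `H`-module structure of `C = H / H A⁺`. -/
instance factorCoalgebraModule : Module H (FactorCoalgebra A) :=
  inferInstanceAs (Module H (H ⧸ augmentationLeftIdeal A))

theorem smul_factorCoalgebra_mk (h x : H) :
    h • (Submodule.Quotient.mk x : FactorCoalgebra A) = Submodule.Quotient.mk (h * x) := rfl

instance factorCoalgebra_isScalarTower : IsScalarTower k H (FactorCoalgebra A) :=
  inferInstanceAs (IsScalarTower k H (H ⧸ augmentationLeftIdeal A))

end Coideal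

/-! ### Hopf modules -/

section HopfModules

variable {k : Type u} [Field k] {H : Type u} [Ring H] [HopfAlgebra k H]
variable (A : Subalgebra k H) [IsRightCoideal A]
variable {M : Type u} [AddCommGroup M] [Module k M]

/-- `M` is an object of `𝓜_A^H`: the action `M ⊗ A → M` is `H`-colinear,
i.e. `ρ(m a) = m₍₀₎ a₍₁₎ ⊗ m₍₁₎ a₍₂₎`. -/
def IsHopfModuleRightRight [Module (A)ᵐᵒᵖ M] [IsScalarTower k (A)ᵐᵒᵖ M]
    (ρ : RightComodule k H M) : Prop :=
  ∀ (m : M) (a : A), ρ.coact (MulOpposite.op a • m) =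
    TensorProduct.map (rightAct k A M) (LinearMap.mul' k H)
      (TensorProduct.tensorTensorTensorComm k M H A H (ρ.coact m ⊗ₜ[k] coidealCoact A a))

/-- `M` is an object of `_A𝓜^H`: the action `A ⊗ M → M` is `H`-colinear,
i.e. `ρ(a m) = a₍₁₎ m₍₀₎ ⊗ a₍₂₎ m₍₁₎`. -/
def IsHopfModuleLeftRight [Module A M] [IsScalarTower k A M]
    (ρ : RightComodule k H M) : Prop :=
  ∀ (a : A) (m : M), ρ.coact (a • m) =
    TensorProduct.map (leftAct k A M) (LinearMap.mul' k H)
      (TensorProduct.tensorTensorTensorComm k A H M H (coidealCoact A a ⊗ₜ[k] ρ.coact m))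

variable (C : Type u) [AddCommGroup C] [Module k C] [Coalgebra k C] [Module H C]
  [IsScalarTower k H C] [Module H M] [IsScalarTower k H M]

/-- `M` is an object of `_H^C𝓜`: the action `H ⊗ M → M` is `C`-colinear,
i.e. `ρ(h m) = h₍₁₎ m₍₋₁₎ ⊗ h₍₂₎ m₍₀₎`. -/
def IsHopfModuleLeftLeft (ρ : LeftComodule k C M) : Prop :=
  ∀ (h : H) (m : M), ρ.coact (h • m) =
    TensorProduct.map (leftAct k H C) (leftAct k H M)
      (TensorProduct.tensorTensorTensorComm k H H C M (comul (R := k) h ⊗ₜ[k] ρ.coact m))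

/-- `M` is an object of `_H𝓜^C`: the action `H ⊗ M → M` is `C`-colinear,
i.e. `ρ(h m) = h₍₁₎ m₍₀₎ ⊗ h₍₂₎ m₍₁₎`. -/
def IsHopfModuleLeftRightQuot (ρ : RightComodule k C M) : Prop :=
  ∀ (h : H) (m : M), ρ.coact (h • m) =
    TensorProduct.map (leftAct k H M) (leftAct k H C)
      (TensorProduct.tensorTensorTensorComm k H H M C (comul (R := k) h ⊗ₜ[k] ρ.coact m))

end HopfModules

end

/-!
Write `C = H / H A⁺`. Faithful flatness makes the canonical map `H ⊗_A H → C ⊗ H`,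
`x ⊗ h ↦ x₍₁₎ ⊗ x₍₂₎ h`, bijective (`CoidealDatum.can_bijective`), and a right `C`-comodule `V` can be
recovered from the right `A`-module `V □_C H` through `(V □_C H) ⊗_A H ≅ V ⊗ H`
(`CoidealDatum.cotMul_injective`, `CoidealDatum.cotMul_surjective`). Here `H`, and hence `Y ⊗_A H` for
a right `A`-module `Y`, is a right `C`-comodule by means of the inverse `T` of the antipode, with
`x ↦ x₍₂₎ ⊗ T(x₍₁₎)`. If `N` is a Hopf module in `_H𝓜^C`, then `n ⊗ x ↦ T(x) n` makes `N` a retract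
of the comodule `(N □_C H) ⊗_A H` (`CoidealDatum.IsHopf.isInjective`). So it suffices to prove that
comodules `Y ⊗_A H` are injective. This is true if `Y` is a flat module, because then `Y ⊗_A H` is
coflat and coflat comodules are injective (`RightComodule.IsCoflat.isInjective`); it passes from `K`
and `F` to `Y` in an exact sequence `0 → K → F → Y → 0`, and so holds if `Y` has finite flat
dimension. This settles one of the injectivity properties under hypothesis (a). Under hypothesis (b)
each Hopf module `N` is the quotient of an injective comodule `(N □_C H) ⊗ H` by another Hopf module,
and a bound for the injective dimensions of Hopf modules can be lowered step by step to zero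
(`CoidealDatum.allInjective_of_hasInjectiveResolution`).

The properties then imply one another. If the objects of `_H𝓜^C` are injective, then `M ⊗ H → M ⊗_A H`
splits colinearly for each right `A`-module `M`, its kernel being a Hopf module; if `M` is an object
of `𝓜_A^H`, the splitting `s` yields the `A`-linear section `m ↦ s(m₍₀₎ ⊗ S(m₍₁₎)) m₍₂₎` of the action
`M ⊗ A → M`, so that `M` is projective (`CoidealDatum.AllInjective.allProjective`). If the objects of
`𝓜_A^H` are projective, then for a right `C`-comodule `V` the image of the map
`V ⊗ H → V ⊗ C ⊗ H` with kernel `V □_C H` is a direct summand, the cokernel being an object of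
`𝓜_A^H`; hence cotensor products with `H` commute with `? ⊗_A Y` for all left modules `Y`, the
comodules `H ⊗_A Y` are coflat, and the objects of `_H^C𝓜` are injective
(`CoidealDatum.allInjective_of_mirror`).

Each of these arguments is needed with left and right interchanged as well. They are therefore carried
out for a structure `CoidealDatum` in which products and actions are explicit linear maps. Reversing
the products of `H` and `A`, interchanging the antipode with its inverse and replacing `C` by its
co-opposite gives the datum `CoidealDatum.mirror`, for which the classes `_H^C𝓜` and `_A𝓜^H` take the
places of `_H𝓜^C` and `𝓜_A^H`.
-/

noncomputable section

/-! ### Balanced tensor products of spaces with operators -/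

section Balanced

variable {k L : Type u} [Field k] [AddCommGroup L] [Module k L]
variable {N N' N'' M M' X V : Type u} [AddCommGroup N] [Module k N] [AddCommGroup N'] [Module k N']
  [AddCommGroup N''] [Module k N''] [AddCommGroup M] [Module k M] [AddCommGroup M'] [Module k M']
  [AddCommGroup X] [Module k X] [AddCommGroup V] [Module k V]

/-- The relations `n r ⊗ m = n ⊗ r m` in `N ⊗ M`, for a family of operators `α r` on `N` (written
on the right) and `β r` on `M` (written on the left), indexed linearly by `r : L`. -/
def balSub (α : L →ₗ[k] Module.End k N) (β : L →ₗ[k] Module.End k M) : Submodule k (N ⊗[k] M) :=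
  Submodule.span k {t | ∃ (n : N) (r : L) (m : M), t = α r n ⊗ₜ[k] m - n ⊗ₜ[k] β r m}

/-- The balanced tensor product `N ⊗_L M`. The actions of `L` are carried by explicit linear maps
into the endomorphism spaces, so that left and right actions can be interchanged freely. -/
abbrev Bal (α : L →ₗ[k] Module.End k N) (β : L →ₗ[k] Module.End k M) : Type u :=
  (N ⊗[k] M) ⧸ balSub α β

/-- The linear map `f` intertwines two families of operators. -/
def Intertwines (α : L →ₗ[k] Module.End k N) (α' : L →ₗ[k] Module.End k N') (f : N →ₗ[k] N') :
    Prop :=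
  ∀ r n, f (α r n) = α' r (f n)

theorem Intertwines.id (α : L →ₗ[k] Module.End k N) : Intertwines α α LinearMap.id :=
  fun _ _ => rfl

variable {α : L →ₗ[k] Module.End k N} {α' : L →ₗ[k] Module.End k N'}
  {α'' : L →ₗ[k] Module.End k N''} {β : L →ₗ[k] Module.End k M} {β' : L →ₗ[k] Module.End k M'}

namespace Bal

variable (α β) in
/-- The projection `N ⊗ M → N ⊗_L M`. -/
def mk : N ⊗[k] M →ₗ[k] Bal α β := (balSub α β).mkQ

theorem mk_surjective : Function.Surjective (mk α β) := Submodule.mkQ_surjective _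

theorem mk_eq_zero {t : N ⊗[k] M} : mk α β t = 0 ↔ t ∈ balSub α β :=
  Submodule.Quotient.mk_eq_zero _

theorem mk_act (n : N) (r : L) (m : M) :
    mk α β (α r n ⊗ₜ[k] m) = mk α β (n ⊗ₜ[k] β r m) := by
  rw [← sub_eq_zero, ← map_sub, mk_eq_zero]
  exact Submodule.subset_span ⟨n, r, m, rfl⟩

/-- The linear map out of `N ⊗_L M` given by a balanced map. -/
def lift (f : N ⊗[k] M →ₗ[k] X) (h : ∀ n r m, f (α r n ⊗ₜ[k] m) = f (n ⊗ₜ[k] β r m)) :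
    Bal α β →ₗ[k] X :=
  (balSub α β).liftQ f (by
    refine Submodule.span_le.mpr ?_
    rintro _ ⟨n, r, m, rfl⟩
    simp [h])

@[simp] theorem lift_mk (f : N ⊗[k] M →ₗ[k] X) (h) (t : N ⊗[k] M) :
    lift (α := α) (β := β) f h (mk α β t) = f t := rfl

theorem hom_ext {f g : Bal α β →ₗ[k] X}
    (h : ∀ n m, f (mk α β (n ⊗ₜ[k] m)) = g (mk α β (n ⊗ₜ[k] m))) : f = g := by
  refine Submodule.linearMap_qext _ (TensorProduct.ext' fun n m => h n m)

/-- The map `f ⊗_L g` induced by intertwining maps `f` and `g`. -/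
def map (f : N →ₗ[k] N') (g : M →ₗ[k] M') (hf : Intertwines α α' f) (hg : Intertwines β β' g) :
    Bal α β →ₗ[k] Bal α' β' :=
  lift (mk α' β' ∘ₗ TensorProduct.map f g) (fun n r m => by
    simp only [LinearMap.comp_apply, TensorProduct.map_tmul]
    rw [hf, hg, mk_act])

@[simp] theorem map_mk (f : N →ₗ[k] N') (g : M →ₗ[k] M') (hf : Intertwines α α' f)
    (hg : Intertwines β β' g) (t : N ⊗[k] M) :
    map f g hf hg (mk α β t) = mk α' β' (TensorProduct.map f g t) := rfl

theorem map_map {M'' : Type u} [AddCommGroup M''] [Module k M''] {β'' : L →ₗ[k] Module.End k M''}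
    {f : N →ₗ[k] N'} {g : M →ₗ[k] M'} {f' : N' →ₗ[k] N''} {g' : M' →ₗ[k] M''}
    (hf : Intertwines α α' f) (hg : Intertwines β β' g) (hf' : Intertwines α' α'' f')
    (hg' : Intertwines β' β'' g') (h₁ : Intertwines α α'' (f' ∘ₗ f))
    (h₂ : Intertwines β β'' (g' ∘ₗ g)) (z : Bal α β) :
    map f' g' hf' hg' (map f g hf hg z) = map (f' ∘ₗ f) (g' ∘ₗ g) h₁ h₂ z := by
  obtain ⟨t, rfl⟩ := mk_surjective z
  simp only [map_mk, TensorProduct.map_comp, LinearMap.comp_apply]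

variable (α β) in
/-- The symmetry `N ⊗_L M ≃ M ⊗_L N`. -/
def comm : Bal α β ≃ₗ[k] Bal β α :=
  LinearEquiv.ofLinearMap
    (lift (mk β α ∘ₗ (TensorProduct.comm k N M).toLinearMap) fun n r m => by simp [mk_act])
    (lift (mk α β ∘ₗ (TensorProduct.comm k M N).toLinearMap) fun n r m => by simp [mk_act])
    (hom_ext fun n m => rfl) (hom_ext fun n m => rfl)

@[simp] theorem comm_mk (n : N) (m : M) :
    comm α β (mk α β (n ⊗ₜ[k] m)) = mk β α (m ⊗ₜ[k] n) := rfl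

end Bal

variable (V) in
/-- The operators `id ⊗ α r` on `V ⊗ N`. -/
def ampAct (α : L →ₗ[k] Module.End k N) : L →ₗ[k] Module.End k (V ⊗[k] N) :=
  LinearMap.lTensorHom V ∘ₗ α

@[simp] theorem ampAct_tmul (r : L) (v : V) (n : N) :
    ampAct V α r (v ⊗ₜ[k] n) = v ⊗ₜ[k] α r n := rfl

theorem ampAct_apply (r : L) : ampAct V α r = (α r).lTensor V := rfl

variable (V) in
theorem Intertwines.lTensor {f : N →ₗ[k] N'} (hf : Intertwines α α' f) :
    Intertwines (ampAct V α) (ampAct V α') (f.lTensor V) := by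
  intro r t
  induction t with
  | zero => simp
  | add x y hx hy => simp only [map_add, hx, hy]
  | tmul v n => simp [hf r n]

variable (α) in
theorem Intertwines.rTensor {V' : Type u} [AddCommGroup V'] [Module k V'] (f : V →ₗ[k] V') :
    Intertwines (ampAct V α) (ampAct V' α) (f.rTensor N) := by
  intro r t
  induction t with
  | zero => simp
  | add x y hx hy => simp only [map_add, hx, hy]
  | tmul v n => simp

theorem Intertwines.comp {f : N →ₗ[k] N'} {g : N' →ₗ[k] N''} (hg : Intertwines α' α'' g)
    (hf : Intertwines α α' f) : Intertwines α α'' (g ∘ₗ f) := fun r n => by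
  simp [hf r n, hg r (f n)]

theorem Intertwines.sub {f g : N →ₗ[k] N'} (hf : Intertwines α α' f)
    (hg : Intertwines α α' g) : Intertwines α α' (f - g) := fun r n => by
  simp [hf r n, hg r n]

/-- The restriction of a family of operators to a stable subspace. -/
def restrictAct (α : L →ₗ[k] Module.End k N) (E : Submodule k N) (hE : ∀ r, ∀ x ∈ E, α r x ∈ E) :
    L →ₗ[k] Module.End k E where
  toFun r := (α r).restrict (hE r)
  map_add' r s := by ext; simp
  map_smul' c r := by ext; simp

theorem Intertwines.subtype (E : Submodule k N) (hE : ∀ r, ∀ x ∈ E, α r x ∈ E) :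
    Intertwines (restrictAct α E hE) α E.subtype := fun _ _ => rfl

/-- The family of operators induced on the quotient by a stable subspace. -/
def quotAct (α : L →ₗ[k] Module.End k N) (E : Submodule k N) (hE : ∀ r, ∀ x ∈ E, α r x ∈ E) :
    L →ₗ[k] Module.End k (N ⧸ E) where
  toFun r := E.mapQ E (α r) (hE r)
  map_add' r s := by ext; simp
  map_smul' c r := by ext; simp

theorem Intertwines.mkQ (E : Submodule k N) (hE : ∀ r, ∀ x ∈ E, α r x ∈ E) :
    Intertwines α (quotAct α E hE) E.mkQ := fun _ _ => rfl

theorem Intertwines.mem_ker {f : N →ₗ[k] N'} (hf : Intertwines α α' f) :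
    ∀ r, ∀ x ∈ LinearMap.ker f, α r x ∈ LinearMap.ker f := fun r x hx => by
  rw [LinearMap.mem_ker] at hx ⊢
  rw [hf, hx, map_zero]

theorem Intertwines.mem_range {f : N →ₗ[k] N'} (hf : Intertwines α α' f) :
    ∀ r, ∀ x ∈ LinearMap.range f, α' r x ∈ LinearMap.range f := by
  rintro r _ ⟨n, rfl⟩
  exact ⟨α r n, hf r n⟩

/-- Right exactness of the balanced tensor product. -/
theorem Bal.exists_ker_of_map_eq_zero_of_surjective {f : N →ₗ[k] N'} (hf : Intertwines α α' f)
    (hs : Function.Surjective f) (z : Bal α β)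
    (hz : Bal.map f LinearMap.id hf (Intertwines.id β) z = 0) :
    ∃ z₀ : Bal (restrictAct α _ hf.mem_ker) β,
      Bal.map (LinearMap.ker f).subtype LinearMap.id (Intertwines.subtype _ _) (Intertwines.id β) z₀
        = z := by
  obtain ⟨t, rfl⟩ := Bal.mk_surjective z
  rw [Bal.map_mk, Bal.mk_eq_zero] at hz
  have hle : balSub α' β ≤ (balSub α β).map (f.rTensor M) := by
    refine Submodule.span_le.mpr ?_
    rintro _ ⟨n, r, m, rfl⟩
    obtain ⟨n, rfl⟩ := hs n
    refine ⟨α r n ⊗ₜ m - n ⊗ₜ β r m, Submodule.subset_span ⟨n, r, m, rfl⟩, ?_⟩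
    simp [hf r n]
  obtain ⟨s, hs1, hs2⟩ := hle hz
  have hex : Function.Exact ((LinearMap.ker f).subtype.rTensor M) (f.rTensor M) :=
    rTensor_exact M (fun x => by simp) hs
  obtain ⟨w, hw⟩ := (hex (t - s)).1 (by
    rw [map_sub, hs2]
    exact sub_self _)
  refine ⟨Bal.mk _ _ w, ?_⟩
  rw [Bal.map_mk]
  have h2 : TensorProduct.map (LinearMap.ker f).subtype LinearMap.id w = t - s := hw
  rw [h2, map_sub, Bal.mk_eq_zero.2 hs1, sub_zero]

/-- If the inclusion of the range of `d` stays injective after tensoring with `M`, then tensoring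
with `M` preserves the kernel of `d`. -/
theorem Bal.exists_ker_of_map_eq_zero {d : N →ₗ[k] N'} (hd : Intertwines α α' d)
    (hinj : Function.Injective (Bal.map (α := restrictAct α' _ hd.mem_range) (β := β)
      (LinearMap.range d).subtype LinearMap.id (Intertwines.subtype _ _) (Intertwines.id β)))
    (z : Bal α β) (hz : Bal.map d LinearMap.id hd (Intertwines.id β) z = 0) :
    ∃ z₀ : Bal (restrictAct α _ hd.mem_ker) β,
      Bal.map (LinearMap.ker d).subtype LinearMap.id (Intertwines.subtype _ _) (Intertwines.id β) z₀
        = z := by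
  have hd' : Intertwines α (restrictAct α' _ hd.mem_range) d.rangeRestrict :=
    fun r n => Subtype.ext (hd r n)
  obtain ⟨z₀, rfl⟩ := Bal.exists_ker_of_map_eq_zero_of_surjective (β := β) hd'
    d.surjective_rangeRestrict z (hinj (by
      rw [map_zero, ← hz]
      exact Bal.map_map _ _ _ _ hd (Intertwines.id β) z))
  have hk : ∀ x : LinearMap.ker d.rangeRestrict, (x : N) ∈ LinearMap.ker d := fun x =>
    (LinearMap.ker_rangeRestrict d).le x.2
  refine ⟨Bal.map ((LinearMap.ker d.rangeRestrict).subtype.codRestrict _ hk) LinearMap.id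
    (fun r x => rfl) (Intertwines.id β) z₀, ?_⟩
  exact Bal.map_map _ _ _ _ (Intertwines.subtype _ _) (Intertwines.id β) z₀

variable (V α β) in
/-- The isomorphism `V ⊗ (N ⊗_L M) ≃ (V ⊗ N) ⊗_L M` for a vector space `V`. -/
def Bal.ampEquiv : V ⊗[k] Bal α β ≃ₗ[k] Bal (ampAct V α) β :=
  LinearEquiv.ofLinearMap
    (TensorProduct.lift (LinearMap.flip (Bal.lift (LinearMap.flip
        (LinearMap.compr₂ (TensorProduct.mk k V (N ⊗[k] M))
          (Bal.mk (ampAct V α) β ∘ₗ (TensorProduct.assoc k V N M).symm.toLinearMap)))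
        (fun n r m => by
          ext v
          simp only [LinearMap.flip_apply, LinearMap.compr₂_apply, TensorProduct.mk_apply,
            LinearMap.comp_apply, LinearEquiv.coe_coe, TensorProduct.assoc_symm_tmul]
          rw [← Bal.mk_act, ampAct_tmul]))))
    (Bal.lift ((Bal.mk α β).lTensor V ∘ₗ (TensorProduct.assoc k V N M).toLinearMap)
      (fun t r m => by
        induction t with
        | zero => simp
        | add x y hx hy => simp only [map_add, TensorProduct.add_tmul, hx, hy]
        | tmul v n => simp [Bal.mk_act]))
    (Bal.hom_ext fun t m => by
      induction t with
      | zero => simp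
      | add x y hx hy => simp only [map_add, TensorProduct.add_tmul, hx, hy]
      | tmul v n => simp)
    (TensorProduct.ext' fun v t => by
      obtain ⟨t, rfl⟩ := Bal.mk_surjective t
      induction t with
      | zero => simp
      | add x y hx hy => simp only [map_add, TensorProduct.tmul_add, hx, hy]
      | tmul n m => simp)

@[simp] theorem Bal.ampEquiv_tmul (v : V) (n : N) (m : M) :
    Bal.ampEquiv V α β (v ⊗ₜ Bal.mk α β (n ⊗ₜ m)) = Bal.mk _ _ ((v ⊗ₜ n) ⊗ₜ m) := by
  simp [Bal.ampEquiv]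

@[simp] theorem Bal.ampEquiv_symm_mk (v : V) (n : N) (m : M) :
    (Bal.ampEquiv V α β).symm (Bal.mk _ _ ((v ⊗ₜ n) ⊗ₜ m)) = v ⊗ₜ Bal.mk α β (n ⊗ₜ m) := by
  simp [Bal.ampEquiv]

end Balanced

/-- The operators `α r` form a right action of the algebra `L` with product `mul` and unit `one`.
Left actions are right actions for the opposite product `mul.flip`. -/
structure IsRightAct {k L N : Type u} [Field k] [AddCommGroup L] [Module k L] [AddCommGroup N]
    [Module k N] (mul : L →ₗ[k] L →ₗ[k] L) (one : L) (α : L →ₗ[k] Module.End k N) : Prop where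
  one_act : ∀ n, α one n = n
  mul_act : ∀ a b n, α (mul a b) n = α b (α a n)

section Actions

variable {k L N N' V X Z M : Type u} [Field k] [AddCommGroup L] [Module k L] [AddCommGroup N]
  [Module k N] [AddCommGroup N'] [Module k N'] [AddCommGroup V] [Module k V] [AddCommGroup X]
  [Module k X] [AddCommGroup Z] [Module k Z] [AddCommGroup M] [Module k M]
  {mul : L →ₗ[k] L →ₗ[k] L} {one : L} {α : L →ₗ[k] Module.End k N}

theorem IsRightAct.restrict (h : IsRightAct mul one α) (E : Submodule k N)
    (hE : ∀ r, ∀ x ∈ E, α r x ∈ E) : IsRightAct mul one (restrictAct α E hE) where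
  one_act n := Subtype.ext (h.one_act n)
  mul_act a b n := Subtype.ext (h.mul_act a b n)

theorem IsRightAct.quot (h : IsRightAct mul one α) (E : Submodule k N)
    (hE : ∀ r, ∀ x ∈ E, α r x ∈ E) : IsRightAct mul one (quotAct α E hE) where
  one_act n := by
    obtain ⟨n, rfl⟩ := E.mkQ_surjective n
    exact congrArg E.mkQ (h.one_act n)
  mul_act a b n := by
    obtain ⟨n, rfl⟩ := E.mkQ_surjective n
    exact congrArg E.mkQ (h.mul_act a b n)

variable (V) in
theorem IsRightAct.amp (h : IsRightAct mul one α) : IsRightAct mul one (ampAct V α) where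
  one_act n := by
    have : α one = LinearMap.id := LinearMap.ext h.one_act
    rw [ampAct_apply, this, LinearMap.lTensor_id, LinearMap.id_apply]
  mul_act a b n := by
    have : α (mul a b) = α b ∘ₗ α a := LinearMap.ext (h.mul_act a b)
    rw [ampAct_apply, this, LinearMap.lTensor_comp_apply]
    rfl

/-- The operators `f x ⊗ g z` on `M ⊗ N`. -/
def actMap (f : X →ₗ[k] Module.End k M) (g : Z →ₗ[k] Module.End k N) :
    X ⊗[k] Z →ₗ[k] Module.End k (M ⊗[k] N) :=
  TensorProduct.homTensorHomMap (.id k) M N M N ∘ₗ TensorProduct.map f g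

@[simp] theorem actMap_tmul (f : X →ₗ[k] Module.End k M) (g : Z →ₗ[k] Module.End k N) (x : X)
    (z : Z) (m : M) (n : N) : actMap f g (x ⊗ₜ z) (m ⊗ₜ n) = f x m ⊗ₜ g z n := rfl

theorem actMap_flip (f : X →ₗ[k] Module.End k X) (g : Z →ₗ[k] Module.End k Z)
    (s t : X ⊗[k] Z) : actMap f.flip g.flip s t = actMap f g t s := by
  induction s with
  | zero => simp
  | add x y hx hy => simp only [map_add, LinearMap.add_apply, hx, hy]
  | tmul a b =>
    induction t with
    | zero => simp
    | add x y hx hy => simp only [map_add, LinearMap.add_apply, hx, hy]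
    | tmul c d => simp

end Actions

/-! ### Subcomodules, quotients, sums and cofree comodules -/

section KernelTensor

variable {k V W C : Type u} [Field k] [AddCommGroup V] [Module k V] [AddCommGroup W] [Module k W]
  [AddCommGroup C] [Module k C]

theorem rTensor_subtype_injective (K : Submodule k V)
    (C : Type u) [AddCommGroup C] [Module k C] :
    Function.Injective (K.subtype.rTensor C) :=
  Module.Flat.rTensor_preserves_injective_linearMap _ K.injective_subtype

theorem mem_range_rTensor_subtype_ker (f : V →ₗ[k] W) (t : V ⊗[k] C) (ht : f.rTensor C t = 0) :
    t ∈ LinearMap.range ((LinearMap.ker f).subtype.rTensor C) :=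
  (Module.Flat.rTensor_exact C (f := (LinearMap.ker f).subtype) (g := f)
    (fun x => by simp) t).1 ht

theorem mem_range_lTensor_subtype_ker (f : V →ₗ[k] W) (t : C ⊗[k] V) (ht : f.lTensor C t = 0) :
    t ∈ LinearMap.range ((LinearMap.ker f).subtype.lTensor C) :=
  (Module.Flat.lTensor_exact C (f := (LinearMap.ker f).subtype) (g := f)
    (fun x => by simp) t).1 ht

end KernelTensor

section ComoduleConstructions

variable {k : Type u} [Field k] {C : Type u} [AddCommGroup C] [Module k C] [Coalgebra k C]
variable {V W X : Type u} [AddCommGroup V] [Module k V] [AddCommGroup W] [Module k W]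
  [AddCommGroup X] [Module k X]

namespace RightComodule

theorem coassoc_apply (ρ : RightComodule k C V) (v : V) :
    TensorProduct.assoc k V C C (ρ.coact.rTensor C (ρ.coact v)) =
      (comul (R := k) (A := C)).lTensor V (ρ.coact v) :=
  LinearMap.congr_fun ρ.coassoc v

theorem counit_apply (ρ : RightComodule k C V) (v : V) :
    (counit (R := k) (A := C)).lTensor V (ρ.coact v) = v ⊗ₜ[k] 1 :=
  LinearMap.congr_fun ρ.counit_coact v

theorem IsHom.apply {ρ : RightComodule k C V} {σ : RightComodule k C W} {f : V →ₗ[k] W}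
    (h : ρ.IsHom σ f) (v : V) : f.rTensor C (ρ.coact v) = σ.coact (f v) :=
  LinearMap.congr_fun h v

theorem isHom_id (ρ : RightComodule k C V) : ρ.IsHom ρ LinearMap.id := by
  simp [IsHom]

theorem IsHom.comp {ρ : RightComodule k C V} {σ : RightComodule k C W} {τ : RightComodule k C X}
    {g : W →ₗ[k] X} {f : V →ₗ[k] W} (hg : σ.IsHom τ g) (hf : ρ.IsHom σ f) :
    ρ.IsHom τ (g ∘ₗ f) := by
  refine LinearMap.ext fun v => ?_
  simp only [LinearMap.comp_apply, LinearMap.rTensor_comp]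
  rw [hf.apply, hg.apply]

theorem IsHom.add {ρ : RightComodule k C V} {σ : RightComodule k C W}
    {f g : V →ₗ[k] W} (hf : ρ.IsHom σ f) (hg : ρ.IsHom σ g) : ρ.IsHom σ (f + g) := by
  refine LinearMap.ext fun v => ?_
  simp only [LinearMap.comp_apply, LinearMap.rTensor_add, LinearMap.add_apply, map_add]
  rw [hf.apply, hg.apply]

theorem IsHom.sub {ρ : RightComodule k C V} {σ : RightComodule k C W}
    {f g : V →ₗ[k] W} (hf : ρ.IsHom σ f) (hg : ρ.IsHom σ g) : ρ.IsHom σ (f - g) := by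
  refine LinearMap.ext fun v => ?_
  simp only [LinearMap.comp_apply, LinearMap.rTensor_sub, LinearMap.sub_apply, map_sub]
  rw [hf.apply, hg.apply]

/-- A coaction on `V` transported along an injective map `f : V → W` that intertwines it with a
map which satisfies the comodule axioms on `W`. -/
def ofInjective (σ : RightComodule k C W) (f : V →ₗ[k] W) (hf : Function.Injective f)
    (c : V →ₗ[k] V ⊗[k] C) (hc : ∀ v, f.rTensor C (c v) = σ.coact (f v)) :
    RightComodule k C V where
  coact := c
  coassoc := by
    refine LinearMap.ext fun v => ?_
    have hinj : Function.Injective (f.rTensor (C ⊗[k] C)) :=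
      Module.Flat.rTensor_preserves_injective_linearMap _ hf
    apply hinj
    have h1 : f.rTensor (C ⊗[k] C) ∘ₗ (TensorProduct.assoc k V C C).toLinearMap ∘ₗ
        c.rTensor C = (TensorProduct.assoc k W C C).toLinearMap ∘ₗ
          σ.coact.rTensor C ∘ₗ f.rTensor C := by
      refine TensorProduct.ext' fun v x => ?_
      simp only [LinearMap.comp_apply, LinearMap.rTensor_tmul, ← hc]
      generalize c v = t
      induction t with
      | zero => simp
      | add x y hx hy => simp only [map_add, TensorProduct.add_tmul, hx, hy]
      | tmul v n => simp
    have h2 : f.rTensor (C ⊗[k] C) ∘ₗ (comul (R := k) (A := C)).lTensor V =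
        (comul (R := k) (A := C)).lTensor W ∘ₗ f.rTensor C := by
      refine TensorProduct.ext' fun v x => by simp
    have e1 := LinearMap.congr_fun h1 (c v)
    have e2 := LinearMap.congr_fun h2 (c v)
    simp only [LinearMap.comp_apply, hc] at e1 e2 ⊢
    rw [e1, e2]
    exact σ.coassoc_apply (f v)
  counit_coact := by
    refine LinearMap.ext fun v => ?_
    have hinj : Function.Injective (f.rTensor k) :=
      Module.Flat.rTensor_preserves_injective_linearMap _ hf
    apply hinj
    have h2 : f.rTensor k ∘ₗ (counit (R := k) (A := C)).lTensor V =
        (counit (R := k) (A := C)).lTensor W ∘ₗ f.rTensor C := by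
      refine TensorProduct.ext' fun v x => by simp
    have e2 := LinearMap.congr_fun h2 (c v)
    simp only [LinearMap.comp_apply, hc] at e2 ⊢
    rw [e2, σ.counit_apply]
    simp

/-- A coaction on `W` obtained from a comodule `V` along a surjective map `f : V → W`. -/
def ofSurjective (σ : RightComodule k C V) (f : V →ₗ[k] W) (hf : Function.Surjective f)
    (c : W →ₗ[k] W ⊗[k] C) (hc : ∀ v, f.rTensor C (σ.coact v) = c (f v)) :
    RightComodule k C W where
  coact := c
  coassoc := by
    refine LinearMap.ext fun w => ?_
    obtain ⟨v, rfl⟩ := hf w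
    have h1 : f.rTensor (C ⊗[k] C) ∘ₗ (TensorProduct.assoc k V C C).toLinearMap ∘ₗ
        σ.coact.rTensor C = (TensorProduct.assoc k W C C).toLinearMap ∘ₗ
          c.rTensor C ∘ₗ f.rTensor C := by
      refine TensorProduct.ext' fun v x => ?_
      simp only [LinearMap.comp_apply, LinearMap.rTensor_tmul, ← hc]
      generalize σ.coact v = t
      induction t with
      | zero => simp
      | add x y hx hy => simp only [map_add, TensorProduct.add_tmul, hx, hy]
      | tmul v n => simp
    have h2 : f.rTensor (C ⊗[k] C) ∘ₗ (comul (R := k) (A := C)).lTensor V =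
        (comul (R := k) (A := C)).lTensor W ∘ₗ f.rTensor C := by
      refine TensorProduct.ext' fun v x => by simp
    have e1 := LinearMap.congr_fun h1 (σ.coact v)
    have e2 := LinearMap.congr_fun h2 (σ.coact v)
    simp only [LinearMap.comp_apply, hc] at e1 e2 ⊢
    rw [← e1, ← e2]
    exact congrArg _ (σ.coassoc_apply v)
  counit_coact := by
    refine LinearMap.ext fun w => ?_
    obtain ⟨v, rfl⟩ := hf w
    have h2 : f.rTensor k ∘ₗ (counit (R := k) (A := C)).lTensor V =
        (counit (R := k) (A := C)).lTensor W ∘ₗ f.rTensor C := by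
      refine TensorProduct.ext' fun v x => by simp
    have e2 := LinearMap.congr_fun h2 (σ.coact v)
    simp only [LinearMap.comp_apply, hc] at e2 ⊢
    rw [← e2, σ.counit_apply]
    simp

/-- The subspace `K` is a subcomodule. -/
def IsSub (ρ : RightComodule k C V) (K : Submodule k V) : Prop :=
  ∀ x ∈ K, ρ.coact x ∈ LinearMap.range (K.subtype.rTensor C)

/-- The comodule structure of a subcomodule. -/
def restrict (ρ : RightComodule k C V) (K : Submodule k V) (hK : ρ.IsSub K) :
    RightComodule k C K :=
  ofInjective ρ K.subtype K.injective_subtype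
    ((LinearEquiv.ofInjective _ (rTensor_subtype_injective K C)).symm.toLinearMap ∘ₗ
      LinearMap.codRestrict (LinearMap.range (K.subtype.rTensor C))
        (ρ.coact ∘ₗ K.subtype) (fun x => hK x x.2))
    (fun _ => congrArg Subtype.val
      ((LinearEquiv.ofInjective _ (rTensor_subtype_injective K C)).apply_symm_apply _))

theorem restrict_isHom (ρ : RightComodule k C V) (K : Submodule k V) (hK : ρ.IsSub K) :
    (ρ.restrict K hK).IsHom ρ K.subtype :=
  LinearMap.ext fun _ => congrArg Subtype.val
      ((LinearEquiv.ofInjective _ (rTensor_subtype_injective K C)).apply_symm_apply _)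

theorem isHom_restrict_of_comp {ρ : RightComodule k C V} {K : Submodule k V} (hK : ρ.IsSub K)
    {σ : RightComodule k C W} {f : W →ₗ[k] K} (h : σ.IsHom ρ (K.subtype ∘ₗ f)) :
    σ.IsHom (ρ.restrict K hK) f := by
  refine LinearMap.ext fun w => rTensor_subtype_injective K C ?_
  have h1 := h.apply w
  rw [LinearMap.rTensor_comp] at h1
  exact h1.trans ((ρ.restrict_isHom K hK).apply (f w)).symm

theorem IsHom.isSub_ker {ρ : RightComodule k C V} {σ : RightComodule k C W} {f : V →ₗ[k] W}
    (h : ρ.IsHom σ f) : ρ.IsSub (LinearMap.ker f) := fun x hx =>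
  mem_range_rTensor_subtype_ker f _ (by rw [h.apply, LinearMap.mem_ker.1 hx, map_zero])

theorem IsHom.isSub_range {ρ : RightComodule k C V} {σ : RightComodule k C W} {f : V →ₗ[k] W}
    (h : ρ.IsHom σ f) : σ.IsSub (LinearMap.range f) := by
  rintro _ ⟨v, rfl⟩
  rw [← h.apply]
  refine ⟨f.rangeRestrict.rTensor C (ρ.coact v), ?_⟩
  rw [← LinearMap.rTensor_comp_apply]
  rfl

/-- The quotient comodule by a subcomodule. -/
def quot (ρ : RightComodule k C V) (K : Submodule k V) (hK : ρ.IsSub K) :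
    RightComodule k C (V ⧸ K) :=
  ofSurjective ρ K.mkQ K.mkQ_surjective
    (K.liftQ (K.mkQ.rTensor C ∘ₗ ρ.coact) (fun x hx => by
      obtain ⟨t, ht⟩ := hK x hx
      rw [LinearMap.mem_ker, LinearMap.comp_apply, ← ht, ← LinearMap.rTensor_comp_apply]
      have : K.mkQ ∘ₗ K.subtype = 0 := by ext; simp
      rw [this]; simp))
    (fun _ => rfl)

theorem quot_isHom (ρ : RightComodule k C V) (K : Submodule k V) (hK : ρ.IsSub K) :
    ρ.IsHom (ρ.quot K hK) K.mkQ := rfl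

/-- The direct sum of two comodules. -/
def prod (ρ : RightComodule k C V) (σ : RightComodule k C W) : RightComodule k C (V × W) where
  coact := LinearMap.coprod ((LinearMap.inl k V W).rTensor C ∘ₗ ρ.coact)
    ((LinearMap.inr k V W).rTensor C ∘ₗ σ.coact)
  coassoc := by
    set c := LinearMap.coprod ((LinearMap.inl k V W).rTensor C ∘ₗ ρ.coact)
      ((LinearMap.inr k V W).rTensor C ∘ₗ σ.coact) with hc
    have key : ∀ {Z : Type u} [AddCommGroup Z] [Module k Z] (τ : RightComodule k C Z)
        (f : Z →ₗ[k] V × W) (_ : c ∘ₗ f = f.rTensor C ∘ₗ τ.coact),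
        ((TensorProduct.assoc k (V × W) C C).toLinearMap ∘ₗ c.rTensor C ∘ₗ c) ∘ₗ f =
          ((comul (R := k) (A := C)).lTensor (V × W) ∘ₗ c) ∘ₗ f := by
      intro Z _ _ τ f hf
      have h1 : c.rTensor C ∘ₗ f.rTensor C = (f.rTensor C).rTensor C ∘ₗ τ.coact.rTensor C := by
        rw [← LinearMap.rTensor_comp, hf, LinearMap.rTensor_comp]
      have h2 : (TensorProduct.assoc k (V × W) C C).toLinearMap ∘ₗ (f.rTensor C).rTensor C =
          f.rTensor (C ⊗[k] C) ∘ₗ (TensorProduct.assoc k Z C C).toLinearMap := by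
        refine TensorProduct.ext_threefold fun x y z => by simp
      have h3 : f.rTensor (C ⊗[k] C) ∘ₗ (comul (R := k) (A := C)).lTensor Z =
          (comul (R := k) (A := C)).lTensor (V × W) ∘ₗ f.rTensor C := by
        refine TensorProduct.ext' fun v x => by simp
      rw [LinearMap.comp_assoc, LinearMap.comp_assoc, LinearMap.comp_assoc, hf,
        ← LinearMap.comp_assoc τ.coact, h1, LinearMap.comp_assoc, ← LinearMap.comp_assoc _ _ _, h2,
        LinearMap.comp_assoc, τ.coassoc, ← LinearMap.comp_assoc, h3, LinearMap.comp_assoc]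
    refine LinearMap.prod_ext (key ρ _ ?_) (key σ _ ?_)
    · simp [hc]
    · simp [hc]
  counit_coact := by
    refine LinearMap.prod_ext (LinearMap.ext fun v => ?_) (LinearMap.ext fun v => ?_)
    · have h2 : (counit (R := k) (A := C)).lTensor (V × W) ∘ₗ (LinearMap.inl k V W).rTensor C =
          (LinearMap.inl k V W).rTensor k ∘ₗ (counit (R := k) (A := C)).lTensor V := by
        refine TensorProduct.ext' fun v x => by simp
      have e2 := LinearMap.congr_fun h2 (ρ.coact v)
      simp only [LinearMap.comp_apply] at e2
      simp only [LinearMap.comp_apply, LinearMap.coprod_apply, LinearMap.inl_apply, map_zero,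
        add_zero]
      rw [e2, ρ.counit_apply]
      simp
    · have h2 : (counit (R := k) (A := C)).lTensor (V × W) ∘ₗ (LinearMap.inr k V W).rTensor C =
          (LinearMap.inr k V W).rTensor k ∘ₗ (counit (R := k) (A := C)).lTensor W := by
        refine TensorProduct.ext' fun v x => by simp
      have e2 := LinearMap.congr_fun h2 (σ.coact v)
      simp only [LinearMap.comp_apply] at e2
      simp only [LinearMap.comp_apply, LinearMap.coprod_apply, LinearMap.inr_apply, map_zero,
        zero_add]
      rw [e2, σ.counit_apply]
      simp

theorem prod_isHom_inl (ρ : RightComodule k C V) (σ : RightComodule k C W) :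
    ρ.IsHom (ρ.prod σ) (LinearMap.inl k V W) :=
  LinearMap.ext fun v => by simp [prod]

theorem prod_isHom_inr (ρ : RightComodule k C V) (σ : RightComodule k C W) :
    σ.IsHom (ρ.prod σ) (LinearMap.inr k V W) :=
  LinearMap.ext fun v => by simp [prod]

theorem isHom_of_prod {ρ : RightComodule k C V} {σ : RightComodule k C W}
    {τ : RightComodule k C X} {f : V × W →ₗ[k] X}
    (h₁ : ρ.IsHom τ (f ∘ₗ LinearMap.inl k V W)) (h₂ : σ.IsHom τ (f ∘ₗ LinearMap.inr k V W)) :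
    (ρ.prod σ).IsHom τ f := by
  refine LinearMap.prod_ext ?_ ?_
  · rw [LinearMap.comp_assoc, ← (prod_isHom_inl ρ σ), ← LinearMap.comp_assoc,
      ← LinearMap.rTensor_comp]
    exact h₁
  · rw [LinearMap.comp_assoc, ← (prod_isHom_inr ρ σ), ← LinearMap.comp_assoc,
      ← LinearMap.rTensor_comp]
    exact h₂

theorem prod_isHom_fst (ρ : RightComodule k C V) (σ : RightComodule k C W) :
    (ρ.prod σ).IsHom ρ (LinearMap.fst k V W) :=
  isHom_of_prod (by simpa using ρ.isHom_id) (by simp [IsHom])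

theorem prod_isHom_snd (ρ : RightComodule k C V) (σ : RightComodule k C W) :
    (ρ.prod σ).IsHom σ (LinearMap.snd k V W) :=
  isHom_of_prod (by simp [IsHom]) (by simpa using σ.isHom_id)

theorem IsHom.prod_map {ρ : RightComodule k C V} {σ : RightComodule k C W}
    {τ : RightComodule k C X} {f : X →ₗ[k] V} {g : X →ₗ[k] W} (hf : τ.IsHom ρ f)
    (hg : τ.IsHom σ g) : τ.IsHom (ρ.prod σ) (f.prod g) := by
  have h := ((prod_isHom_inl ρ σ).comp hf).add ((prod_isHom_inr ρ σ).comp hg)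
  convert h using 1
  ext x <;> simp

variable (V C) in
/-- The cofree comodule `V ⊗ C`. -/
def cofree : RightComodule k C (V ⊗[k] C) where
  coact := (TensorProduct.assoc k V C C).symm.toLinearMap ∘ₗ
    (comul (R := k) (A := C)).lTensor V
  coassoc := by
    refine TensorProduct.ext' fun v c => ?_
    have h := Coalgebra.coassoc_apply (R := k) c
    have key : ∀ (f : C →ₗ[k] C ⊗[k] C) (g : C →ₗ[k] C ⊗[k] C) (t : C ⊗[k] C),
        TensorProduct.assoc k (V ⊗[k] C) C C
          (((TensorProduct.assoc k V C C).symm.toLinearMap ∘ₗ f.lTensor V).rTensor C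
            ((TensorProduct.assoc k V C C).symm (v ⊗ₜ t))) =
        (TensorProduct.assoc k V C (C ⊗[k] C)).symm (v ⊗ₜ
          TensorProduct.assoc k C C C (f.rTensor C t)) := by
      intro f g t
      induction t with
      | zero => simp
      | add x y hx hy => simp only [map_add, TensorProduct.tmul_add, hx, hy]
      | tmul x y =>
        simp only [TensorProduct.assoc_symm_tmul, LinearMap.rTensor_tmul, LinearMap.comp_apply,
          LinearMap.lTensor_tmul, LinearEquiv.coe_coe]
        generalize f x = s
        induction s with
        | zero => simp
        | add x y hx hy => simp only [map_add, TensorProduct.tmul_add, TensorProduct.add_tmul,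
            hx, hy]
        | tmul x y => simp
    have key2 : ∀ (t : C ⊗[k] C),
        (comul (R := k) (A := C)).lTensor (V ⊗[k] C)
            ((TensorProduct.assoc k V C C).symm (v ⊗ₜ t)) =
        (TensorProduct.assoc k V C (C ⊗[k] C)).symm (v ⊗ₜ (comul (R := k) (A := C)).lTensor C t) := by
      intro t
      induction t with
      | zero => simp
      | add x y hx hy => simp only [map_add, TensorProduct.tmul_add, hx, hy]
      | tmul x y => simp
    simp only [LinearMap.comp_apply, LinearMap.lTensor_tmul, LinearEquiv.coe_coe]
    rw [key _ (comul (R := k)), h, key2]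
  counit_coact := by
    refine TensorProduct.ext' fun v c => ?_
    have key2 : ∀ (t : C ⊗[k] C),
        (counit (R := k) (A := C)).lTensor (V ⊗[k] C)
            ((TensorProduct.assoc k V C C).symm (v ⊗ₜ t)) =
        (TensorProduct.assoc k V C k).symm (v ⊗ₜ (counit (R := k) (A := C)).lTensor C t) := by
      intro t
      induction t with
      | zero => simp
      | add x y hx hy => simp only [map_add, TensorProduct.tmul_add, hx, hy]
      | tmul x y => simp
    simp only [LinearMap.comp_apply, LinearMap.lTensor_tmul, LinearEquiv.coe_coe]
    rw [key2]
    simp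

theorem isHom_coact (ρ : RightComodule k C V) : ρ.IsHom (cofree C V) ρ.coact := by
  refine LinearMap.ext fun v => ?_
  simp only [cofree, LinearMap.comp_apply, LinearEquiv.coe_coe]
  rw [LinearEquiv.eq_symm_apply]
  exact ρ.coassoc_apply v

theorem coact_injective (ρ : RightComodule k C V) : Function.Injective ρ.coact := by
  intro x y h
  have := congrArg (fun t => TensorProduct.rid k V ((counit (R := k) (A := C)).lTensor V t)) h
  simpa [ρ.counit_apply] using this

theorem cofree_isInjective : (cofree (k := k) C V).IsInjective := by
  intro X Y _ _ _ _ σ τ i g hi hinj hg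
  obtain ⟨l, hl⟩ := LinearMap.exists_leftInverse_of_injective i (LinearMap.ker_eq_bot.2 hinj)
  let e : V ⊗[k] C →ₗ[k] V :=
    (TensorProduct.rid k V).toLinearMap ∘ₗ (counit (R := k) (A := C)).lTensor V
  have he : e.rTensor C ∘ₗ (cofree (k := k) C V).coact = LinearMap.id := by
    refine TensorProduct.ext' fun v c => ?_
    have : ∀ t : C ⊗[k] C, e.rTensor C ((TensorProduct.assoc k V C C).symm (v ⊗ₜ t)) =
        v ⊗ₜ (TensorProduct.lid k C ((counit (R := k) (A := C)).rTensor C t)) := by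
      intro t
      induction t with
      | zero => simp
      | add x y hx hy => simp only [map_add, TensorProduct.tmul_add, hx, hy]
      | tmul x y => simp [e, TensorProduct.smul_tmul]
    simp [cofree, this]
  refine ⟨(e ∘ₗ g ∘ₗ l).rTensor C ∘ₗ τ.coact, ?_, ?_⟩
  · refine LinearMap.ext fun y => ?_
    simp only [cofree, LinearMap.comp_apply, LinearEquiv.coe_coe]
    rw [LinearEquiv.eq_symm_apply]
    have h2 : ∀ (f : Y →ₗ[k] V), (comul (R := k) (A := C)).lTensor V ∘ₗ f.rTensor C =
        f.rTensor (C ⊗[k] C) ∘ₗ (comul (R := k) (A := C)).lTensor Y := fun f =>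
      TensorProduct.ext' fun v x => by simp
    have h3 : ∀ (f : Y →ₗ[k] V), (TensorProduct.assoc k V C C).toLinearMap ∘ₗ
        (f.rTensor C).rTensor C = f.rTensor (C ⊗[k] C) ∘ₗ
          (TensorProduct.assoc k Y C C).toLinearMap := fun f =>
      TensorProduct.ext_threefold fun x y z => by simp
    have e2 := LinearMap.congr_fun (h2 (e ∘ₗ g ∘ₗ l)) (τ.coact y)
    have e3 := LinearMap.congr_fun (h3 (e ∘ₗ g ∘ₗ l)) (τ.coact.rTensor C (τ.coact y))
    simp only [LinearMap.comp_apply, LinearEquiv.coe_coe] at e2 e3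
    rw [e2, ← τ.coassoc_apply, ← e3, LinearMap.rTensor_comp_apply C _ τ.coact]
  · refine LinearMap.ext fun x => ?_
    simp only [LinearMap.comp_apply]
    rw [← hi.apply, ← LinearMap.rTensor_comp_apply]
    have h4 : (e ∘ₗ g ∘ₗ l) ∘ₗ i = e ∘ₗ g :=
      LinearMap.ext fun x => congrArg (fun y => e (g y)) (LinearMap.congr_fun hl x)
    rw [h4, LinearMap.rTensor_comp_apply, hg.apply]
    exact LinearMap.congr_fun he (g x)

theorem IsInjective.of_retract {ρ : RightComodule k C V} {σ : RightComodule k C W}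
    (hσ : σ.IsInjective) (s : V →ₗ[k] W) (r : W →ₗ[k] V) (hs : ρ.IsHom σ s) (hr : σ.IsHom ρ r)
    (hrs : r ∘ₗ s = LinearMap.id) : ρ.IsInjective := by
  intro X Y _ _ _ _ σ τ i g hi hinj hg
  obtain ⟨h, hh, he⟩ := hσ X Y _ _ i (s ∘ₗ g) hi hinj (hs.comp hg)
  exact ⟨r ∘ₗ h, hr.comp hh, by rw [LinearMap.comp_assoc, he, ← LinearMap.comp_assoc, hrs,
    LinearMap.id_comp]⟩

theorem IsInjective.prod {ρ : RightComodule k C V} {σ : RightComodule k C W}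
    (hρ : ρ.IsInjective) (hσ : σ.IsInjective) : (ρ.prod σ).IsInjective := by
  intro X Y _ _ _ _ _ _ i g hi hinj hg
  obtain ⟨h₁, hh₁, he₁⟩ := hρ X Y _ _ i _ hi hinj ((prod_isHom_fst ρ σ).comp hg)
  obtain ⟨h₂, hh₂, he₂⟩ := hσ X Y _ _ i _ hi hinj ((prod_isHom_snd ρ σ).comp hg)
  refine ⟨h₁.prod h₂, hh₁.prod_map hh₂, ?_⟩
  refine LinearMap.ext fun x => Prod.ext ?_ ?_
  · exact LinearMap.congr_fun he₁ x
  · exact LinearMap.congr_fun he₂ x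

/-- A surjective morphism whose kernel is an injective comodule splits. -/
theorem exists_section_of_isInjective_ker {ρ : RightComodule k C V} {σ : RightComodule k C W}
    {f : V →ₗ[k] W} (hf : ρ.IsHom σ f) (hs : Function.Surjective f)
    (hK : (ρ.restrict _ hf.isSub_ker).IsInjective) :
    ∃ s : W →ₗ[k] V, σ.IsHom ρ s ∧ f ∘ₗ s = LinearMap.id := by
  obtain ⟨r, hr, hrid⟩ := hK _ _ _ ρ (LinearMap.ker f).subtype LinearMap.id
    (ρ.restrict_isHom _ hf.isSub_ker) (Submodule.injective_subtype _) (isHom_id _)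
  let r' : V →ₗ[k] V := LinearMap.id - (LinearMap.ker f).subtype ∘ₗ r
  have hr' : ρ.IsHom ρ r' := ρ.isHom_id.sub ((ρ.restrict_isHom _ hf.isSub_ker).comp hr)
  have hker : LinearMap.ker f ≤ LinearMap.ker r' := fun x hx => by
    have := LinearMap.congr_fun hrid ⟨x, hx⟩
    simp only [LinearMap.comp_apply, Submodule.subtype_apply, LinearMap.id_apply] at this
    simp [r', this]
  obtain ⟨g, hg⟩ := LinearMap.exists_rightInverse_of_surjective f (LinearMap.range_eq_top.2 hs)
  have hgf : (r' ∘ₗ g) ∘ₗ f = r' := by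
    refine LinearMap.ext fun x => ?_
    have : g (f x) - x ∈ LinearMap.ker f := by
      have := LinearMap.congr_fun hg (f x)
      simp only [LinearMap.comp_apply, LinearMap.id_apply] at this
      simp [this]
    have := hker this
    rw [LinearMap.mem_ker, map_sub, sub_eq_zero] at this
    exact this
  refine ⟨r' ∘ₗ g, ?_, ?_⟩
  · refine LinearMap.ext fun w => ?_
    obtain ⟨v, rfl⟩ := hs w
    rw [LinearMap.comp_apply, ← hf.apply, ← LinearMap.rTensor_comp_apply, hgf, hr'.apply]
    exact congrArg _ (LinearMap.congr_fun hgf v).symm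
  · refine LinearMap.ext fun w => ?_
    have := LinearMap.congr_fun hg w
    simp only [LinearMap.comp_apply, LinearMap.id_apply] at this
    simp [r', this]

end RightComodule

end ComoduleConstructions

/-! ### Local finiteness and a criterion for injectivity of comodules -/

section LocalFiniteness

variable {k : Type u} [Field k] {C : Type u} [AddCommGroup C] [Module k C]
variable {V : Type u} [AddCommGroup V] [Module k V]

/-- The contraction of tensors in `V ⊗ C` with functionals on `C`. -/
def tensorContract : V ⊗[k] C →ₗ[k] Module.Dual k C →ₗ[k] V :=
  TensorProduct.lift (LinearMap.mk₂ k
    (fun v c => (LinearMap.toSpanSingleton k V v) ∘ₗ Module.Dual.eval k C c)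
    (fun _ _ _ => by ext; simp) (fun c v x => LinearMap.ext fun φ => smul_comm (φ x) c v)
    (fun _ _ _ => by ext; simp [add_smul]) (fun _ _ _ => by ext; simp [mul_smul]))

@[simp] theorem tensorContract_tmul (φ : Module.Dual k C) (v : V) (c : C) :
    tensorContract (v ⊗ₜ c) φ = φ c • v := by simp [tensorContract]

theorem eq_zero_of_tensorContract (t : V ⊗[k] C)
    (h : ∀ φ : Module.Dual k C, tensorContract t φ = 0) : t = 0 := by
  classical
  let b := Module.Basis.ofVectorSpace k C
  apply (TensorProduct.equivFinsuppOfBasisRight (M := V) b).injective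
  rw [map_zero]
  ext i
  have : ∀ s : V ⊗[k] C, TensorProduct.equivFinsuppOfBasisRight (M := V) b s i =
      tensorContract s (b.coord i) := by
    intro s
    induction s with
    | zero => simp
    | add x y hx hy => simp only [map_add, Finsupp.add_apply, hx, hy, LinearMap.add_apply]
    | tmul x y => simp
  rw [this, h, Finsupp.zero_apply]

theorem mem_range_rTensor_of_tensorContract (U : Submodule k V) (t : V ⊗[k] C)
    (h : ∀ φ : Module.Dual k C, tensorContract t φ ∈ U) :
    t ∈ LinearMap.range (U.subtype.rTensor C) := by
  have h0 : U.mkQ.rTensor C t = 0 := by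
    refine eq_zero_of_tensorContract _ fun φ => ?_
    have : ∀ s : V ⊗[k] C, tensorContract (U.mkQ.rTensor C s) φ = U.mkQ (tensorContract s φ) := by
      intro s
      induction s with
      | zero => simp
      | add x y hx hy => simp only [map_add, hx, hy, LinearMap.add_apply]
      | tmul x y => simp
    rw [this]
    simpa using h φ
  obtain ⟨s, hs⟩ := mem_range_rTensor_subtype_ker U.mkQ t h0
  have hle : LinearMap.ker U.mkQ ≤ U := by simp
  refine ⟨(Submodule.inclusion hle).rTensor C s, ?_⟩
  rw [← LinearMap.rTensor_comp_apply, ← hs]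
  rfl

theorem finite_range_tensorContract (t : V ⊗[k] C) :
    Module.Finite k (LinearMap.range (tensorContract t)) := by
  suffices h : ∃ U : Submodule k V, Module.Finite k U ∧ ∀ φ, tensorContract t φ ∈ U by
    obtain ⟨U, hU, hle⟩ := h
    exact Submodule.finiteDimensional_of_le (S₂ := U) (by rintro _ ⟨φ, rfl⟩; exact hle φ)
  induction t with
  | zero => exact ⟨⊥, inferInstance, by simp⟩
  | add x y hx hy =>
    obtain ⟨U, hU, hU'⟩ := hx
    obtain ⟨W, hW, hW'⟩ := hy
    refine ⟨U ⊔ W, inferInstance, fun φ => ?_⟩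
    rw [map_add]
    exact Submodule.add_mem_sup (hU' φ) (hW' φ)
  | tmul v c =>
    refine ⟨Submodule.span k {v}, inferInstance, fun φ => ?_⟩
    rw [tensorContract_tmul]
    exact Submodule.smul_mem _ _ (Submodule.mem_span_singleton_self v)

namespace RightComodule

variable [Coalgebra k C]

/-- Each element of a comodule lies in a finite-dimensional subcomodule, spanned by its
coefficients. -/
theorem exists_finite_isSub (ρ : RightComodule k C V) (v : V) :
    ∃ U : Submodule k V, Module.Finite k U ∧ v ∈ U ∧ ρ.IsSub U := by
  refine ⟨LinearMap.range (tensorContract (ρ.coact v)), finite_range_tensorContract _,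
    ⟨counit, ?_⟩, ?_⟩
  · have : ∀ s : V ⊗[k] C, tensorContract s (counit (R := k)) =
        TensorProduct.rid k V ((counit (R := k) (A := C)).lTensor V s) := by
      intro s
      induction s with
      | zero => simp
      | add x y hx hy => simp only [map_add, hx, hy, LinearMap.add_apply]
      | tmul x y => simp
    rw [this, ρ.counit_apply]
    simp
  · rintro _ ⟨φ, rfl⟩
    refine mem_range_rTensor_of_tensorContract _ _ fun ψ => ?_
    -- Coassociativity rewrites a coefficient of a coefficient as a coefficient of `v`, for the
    -- convolution of the two functionals.
    refine ⟨LinearMap.mul' k k ∘ₗ TensorProduct.map ψ φ ∘ₗ comul, ?_⟩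
    have h1 : ∀ s : V ⊗[k] C, tensorContract (ρ.coact (tensorContract s φ)) ψ =
        tensorContract (TensorProduct.assoc k V C C (ρ.coact.rTensor C s))
          (LinearMap.mul' k k ∘ₗ TensorProduct.map ψ φ) := by
      intro s
      induction s with
      | zero => simp
      | add x y hx hy => simp only [map_add, hx, hy, LinearMap.add_apply]
      | tmul x y =>
        simp only [tensorContract_tmul, map_smul, LinearMap.smul_apply, LinearMap.rTensor_tmul]
        generalize ρ.coact x = w
        induction w with
        | zero => simp
        | add x y hx hy => simp only [map_add, LinearMap.add_apply, TensorProduct.add_tmul,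
            smul_add, hx, hy]
        | tmul a b => simp [mul_smul, smul_comm (φ y)]
    have h2 : ∀ s : V ⊗[k] C, tensorContract ((comul (R := k) (A := C)).lTensor V s)
          (LinearMap.mul' k k ∘ₗ TensorProduct.map ψ φ) =
        tensorContract s (LinearMap.mul' k k ∘ₗ TensorProduct.map ψ φ ∘ₗ comul) := by
      intro s
      induction s with
      | zero => simp
      | add x y hx hy => simp only [map_add, hx, hy, LinearMap.add_apply]
      | tmul x y => simp
    rw [h1, ρ.coassoc_apply, h2]

/-- Injectivity tested on inclusions of finite-dimensional comodules. -/
def IsFinitelyInjective (ρ : RightComodule k C V) : Prop :=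
  ∀ (X Y : Type u) [AddCommGroup X] [Module k X] [AddCommGroup Y] [Module k Y]
    [Module.Finite k X] [Module.Finite k Y]
    (σ : RightComodule k C X) (τ : RightComodule k C Y) (i : X →ₗ[k] Y) (g : X →ₗ[k] V),
    σ.IsHom τ i → Function.Injective i → σ.IsHom ρ g →
      ∃ h : Y →ₗ[k] V, τ.IsHom ρ h ∧ h ∘ₗ i = g

/-- The partially defined map `f` is defined and colinear at `y`. -/
def ColinearAt {Y : Type u} [AddCommGroup Y] [Module k Y] (τ : RightComodule k C Y)
    (ρ : RightComodule k C V) (f : Y →ₗ.[k] V) (y : Y) : Prop :=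
  ∃ (hy : y ∈ f.domain) (t : f.domain ⊗[k] C),
    f.domain.subtype.rTensor C t = τ.coact y ∧ f.toFun.rTensor C t = ρ.coact (f ⟨y, hy⟩)

section ColinearAt

variable {Y : Type u} [AddCommGroup Y] [Module k Y] {τ : RightComodule k C Y}
  {ρ : RightComodule k C V} {f f' : Y →ₗ.[k] V}

theorem ColinearAt.mono {y : Y} (h : ColinearAt τ ρ f y) (hf : f ≤ f') : ColinearAt τ ρ f' y := by
  obtain ⟨hy, t, h1, h2⟩ := h
  refine ⟨hf.1 hy, (Submodule.inclusion hf.1).rTensor C t, ?_, ?_⟩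
  · rw [← LinearMap.rTensor_comp_apply, ← h1]
    rfl
  · rw [← LinearMap.rTensor_comp_apply]
    have h3 : f'.toFun ∘ₗ Submodule.inclusion hf.1 = f.toFun :=
      LinearMap.ext fun x => (hf.2 (x := x) (y := Submodule.inclusion hf.1 x) rfl).symm
    rw [h3, h2]
    exact congrArg _ (hf.2 rfl)

theorem ColinearAt.add {y z : Y} (hy : ColinearAt τ ρ f y) (hz : ColinearAt τ ρ f z) :
    ColinearAt τ ρ f (y + z) := by
  obtain ⟨hy, t, h1, h2⟩ := hy
  obtain ⟨hz, s, h3, h4⟩ := hz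
  refine ⟨add_mem hy hz, t + s, by rw [map_add, map_add, h1, h3], ?_⟩
  rw [map_add, h2, h4, ← map_add, ← LinearPMap.map_add]
  rfl

theorem colinearAt_of_isHom {K : Submodule k Y} (hK : τ.IsSub K) {g : K →ₗ[k] V}
    (hg : (τ.restrict K hK).IsHom ρ g) (y : Y) (hy : y ∈ K) : ColinearAt τ ρ ⟨K, g⟩ y :=
  ⟨hy, (τ.restrict K hK).coact ⟨y, hy⟩, (τ.restrict_isHom K hK).apply ⟨y, hy⟩, hg.apply ⟨y, hy⟩⟩

end ColinearAt

/-- The analogue of Baer's criterion: by local finiteness of comodules, injectivity can be tested on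
finite-dimensional comodules. -/
theorem IsFinitelyInjective.isInjective {ρ : RightComodule k C V} (hρ : ρ.IsFinitelyInjective) :
    ρ.IsInjective := by
  intro X Y _ _ _ _ σ τ i g hi hinj hg
  let e := LinearEquiv.ofInjective i hinj
  let f₀ : Y →ₗ.[k] V := ⟨LinearMap.range i, g ∘ₗ e.symm.toLinearMap⟩
  have hf₀ : ∀ y ∈ f₀.domain, ColinearAt τ ρ f₀ y := by
    refine colinearAt_of_isHom hi.isSub_range ?_
    refine hg.comp (LinearMap.ext fun y => ?_)
    obtain ⟨x, rfl⟩ := e.surjective y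
    have h1 : σ.IsHom (τ.restrict _ hi.isSub_range) e.toLinearMap :=
      isHom_restrict_of_comp _ hi
    have h2 := h1.apply x
    simp only [LinearMap.comp_apply, LinearEquiv.coe_coe] at h2 ⊢
    rw [← h2, ← LinearMap.rTensor_comp_apply]
    simp
  let S : Set (Y →ₗ.[k] V) := {f | f₀ ≤ f ∧ ∀ y ∈ f.domain, ColinearAt τ ρ f y}
  obtain ⟨f, -, hf⟩ := zorn_le_nonempty₀ S (fun c hcS hc y hy => by
    have hd : DirectedOn (· ≤ ·) c := hc.directedOn
    refine ⟨LinearPMap.sSup c hd, ⟨?_, ?_⟩, fun z hz => LinearPMap.le_sSup hd hz⟩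
    · exact (hcS hy).1.trans (LinearPMap.le_sSup hd hy)
    · intro z hz
      obtain ⟨f, hf, hzf⟩ := (LinearPMap.mem_domain_sSup_iff ⟨y, hy⟩ hd).1 hz
      exact ((hcS hf).2 z hzf).mono (LinearPMap.le_sSup hd hf)) f₀ ⟨le_refl _, hf₀⟩
  have hmax := hf.2
  obtain ⟨hf1, hf2⟩ := hf.1
  have hsub : τ.IsSub f.domain := fun y hy => by
    obtain ⟨-, t, h1, -⟩ := hf2 y hy
    exact ⟨t, h1⟩
  have hfhom : (τ.restrict _ hsub).IsHom ρ f.toFun := by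
    refine LinearMap.ext fun y => ?_
    obtain ⟨_, t, h1, h2⟩ := hf2 y y.2
    have : (τ.restrict _ hsub).coact y = t :=
      rTensor_subtype_injective _ _ (((τ.restrict_isHom _ hsub).apply y).trans h1.symm)
    rw [LinearMap.comp_apply, this, h2]
    rfl
  -- The finite-dimensional subcomodule `U` generated by `y` meets the domain of the maximal partial
  -- extension `f` in the kernel of `U → Y / dom f`; extending `f` from this kernel to `U` gives an
  -- extension that is defined at `y`.
  have htop : f.domain = ⊤ := by
    rw [eq_top_iff]
    rintro y -
    obtain ⟨U, hU, hyU, hUsub⟩ := τ.exists_finite_isSub y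
    let q : U →ₗ[k] Y ⧸ f.domain := f.domain.mkQ ∘ₗ U.subtype
    have hq : (τ.restrict U hUsub).IsHom (τ.quot _ hsub) q :=
      (τ.quot_isHom _ hsub).comp (τ.restrict_isHom U hUsub)
    have hmem : ∀ x : LinearMap.ker q, (x : U).1 ∈ f.domain := fun x =>
      (Submodule.Quotient.mk_eq_zero _).1 x.2
    let j : LinearMap.ker q →ₗ[k] f.domain :=
      LinearMap.codRestrict f.domain (U.subtype ∘ₗ (LinearMap.ker q).subtype) hmem
    have hj : ((τ.restrict U hUsub).restrict _ hq.isSub_ker).IsHom (τ.restrict _ hsub) j :=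
      isHom_restrict_of_comp _
        ((τ.restrict_isHom U hUsub).comp (restrict_isHom _ _ hq.isSub_ker))
    obtain ⟨h, hh, hhe⟩ := hρ _ _ _ _ (LinearMap.ker q).subtype (f.toFun ∘ₗ j)
      (restrict_isHom _ _ hq.isSub_ker) (Submodule.injective_subtype _) (hfhom.comp hj)
    have hagree : ∀ (a : f.domain) (b : (⟨U, h⟩ : Y →ₗ.[k] V).domain), (a : Y) = b →
        f a = (⟨U, h⟩ : Y →ₗ.[k] V) b := by
      intro a b hab
      have hb : b ∈ LinearMap.ker q := by
        change f.domain.mkQ (b : Y) = 0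
        rw [← hab]
        simp
      have h1 := LinearMap.congr_fun hhe ⟨b, hb⟩
      have h2 : j ⟨b, hb⟩ = a := Subtype.ext hab.symm
      simp only [LinearMap.comp_apply, h2] at h1
      exact h1.symm
    have hle := LinearPMap.left_le_sup f ⟨U, h⟩ hagree
    have hle' := LinearPMap.right_le_sup f ⟨U, h⟩ hagree
    have hS : f.sup ⟨U, h⟩ hagree ∈ S := by
      refine ⟨hf1.trans hle, fun z hz => ?_⟩
      rw [LinearPMap.domain_sup] at hz
      obtain ⟨a, ha, b, hb, rfl⟩ := Submodule.mem_sup.1 hz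
      exact ((hf2 a ha).mono hle).add ((colinearAt_of_isHom hUsub hh b hb).mono hle')
    exact (hmax hS hle).1 (hle'.1 hyU)
  refine ⟨f.toFun ∘ₗ (LinearEquiv.ofTop _ htop).symm.toLinearMap, ?_, ?_⟩
  · refine hfhom.comp (isHom_restrict_of_comp _ ?_)
    exact τ.isHom_id
  · refine LinearMap.ext fun x => ?_
    have h1 : f₀ ⟨i x, ⟨x, rfl⟩⟩ = g x := by
      change g (e.symm _) = g x
      congr 1
      rw [LinearEquiv.symm_apply_eq]
      rfl
    rw [← h1]
    exact (hf1.2 rfl).symm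

end RightComodule

end LocalFiniteness

/-! ### The co-opposite coalgebra, cotensor products and coflatness -/

/-- The coalgebra `C` with the flipped comultiplication. -/
def Cop (C : Type u) : Type u := C

section Cop

variable {k : Type u} [Field k] {C : Type u} [AddCommGroup C]

instance : AddCommGroup (Cop C) := inferInstanceAs (AddCommGroup C)

variable [Module k C]

instance : Module k (Cop C) := inferInstanceAs (Module k C)

theorem comm_coassoc_aux (f : C →ₗ[k] C ⊗[k] C) (t : C ⊗[k] C) :
    TensorProduct.assoc k C C C (((TensorProduct.comm k C C).toLinearMap ∘ₗ f).rTensor C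
      (TensorProduct.comm k C C t)) =
    TensorProduct.assoc k C C C ((TensorProduct.comm k C C).toLinearMap.rTensor C
      (TensorProduct.comm k C (C ⊗[k] C) (f.lTensor C t))) ∧
    ((TensorProduct.comm k C C).toLinearMap ∘ₗ f).lTensor C (TensorProduct.comm k C C t) =
    TensorProduct.assoc k C C C ((TensorProduct.comm k C C).toLinearMap.rTensor C
      (TensorProduct.comm k C (C ⊗[k] C) (TensorProduct.assoc k C C C (f.rTensor C t)))) := by
  induction t with
  | zero => simp
  | add x y hx hy =>
    constructor
    · simp only [map_add, hx.1, hy.1]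
    · simp only [map_add, hx.2, hy.2]
  | tmul x y =>
    constructor
    · simp
    · simp only [TensorProduct.comm_tmul, LinearMap.lTensor_tmul, LinearMap.rTensor_tmul,
        LinearMap.comp_apply, LinearEquiv.coe_coe]
      generalize f x = s
      induction s with
      | zero => simp
      | add x y hx hy => simp only [map_add, TensorProduct.add_tmul, TensorProduct.tmul_add,
          hx, hy]
      | tmul a b => simp

variable (k C) in
/-- The identity map from `C` to its co-opposite. -/
def toCop : C ≃ₗ[k] Cop C := LinearEquiv.refl k C

variable (k C) in
/-- The transport of tensors in `C ⊗ C` to the co-opposite coalgebra. -/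
def toCop₂ : C ⊗[k] C →ₗ[k] Cop C ⊗[k] Cop C :=
  TensorProduct.map (toCop k C).toLinearMap (toCop k C).toLinearMap

instance [Coalgebra k C] : Coalgebra k (Cop C) where
  comul := toCop₂ k C ∘ₗ (TensorProduct.comm k C C).toLinearMap ∘ₗ comul (R := k) (A := C) ∘ₗ
    (toCop k C).symm.toLinearMap
  counit := counit (R := k) (A := C) ∘ₗ (toCop k C).symm.toLinearMap
  coassoc := by
    refine LinearMap.ext fun d => ?_
    obtain ⟨c, rfl⟩ := (toCop k C).surjective d
    have h := comm_coassoc_aux (comul (R := k) (A := C)) (comul (R := k) c)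
    rw [Coalgebra.coassoc_apply] at h
    have h' := h.1.trans h.2.symm
    set f := (TensorProduct.comm k C C).toLinearMap ∘ₗ comul (R := k) (A := C)
    have h1 : ∀ t : C ⊗[k] C, TensorProduct.assoc k _ _ _
        ((toCop₂ k C ∘ₗ f ∘ₗ (toCop k C).symm.toLinearMap).rTensor (Cop C) (toCop₂ k C t)) =
        TensorProduct.map (toCop k C).toLinearMap (toCop₂ k C)
          (TensorProduct.assoc k C C C (f.rTensor C t)) := fun t => by
      induction t with
      | zero => simp
      | add x y hx hy => simp only [map_add, hx, hy]
      | tmul a b =>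
        simp only [toCop₂, TensorProduct.map_tmul, LinearMap.rTensor_tmul, LinearMap.comp_apply,
          LinearEquiv.coe_coe, LinearEquiv.symm_apply_apply]
        generalize f a = s
        induction s with
        | zero => simp
        | add x y hx hy => simp only [map_add, TensorProduct.add_tmul, hx, hy]
        | tmul a b => simp
    have h2 : ∀ t : C ⊗[k] C,
        (toCop₂ k C ∘ₗ f ∘ₗ (toCop k C).symm.toLinearMap).lTensor (Cop C) (toCop₂ k C t) =
        TensorProduct.map (toCop k C).toLinearMap (toCop₂ k C) (f.lTensor C t) := fun t => by
      induction t with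
      | zero => simp
      | add x y hx hy => simp only [map_add, hx, hy]
      | tmul a b => simp [toCop₂]
    have h3 := (h1 (f c)).trans ((congrArg _ h').trans (h2 (f c)).symm)
    exact h3
  rTensor_counit_comp_comul := by
    refine LinearMap.ext fun d => ?_
    obtain ⟨c, rfl⟩ := (toCop k C).surjective d
    have h : ∀ t : C ⊗[k] C, (counit (R := k) (A := C) ∘ₗ (toCop k C).symm.toLinearMap).rTensor _
        (toCop₂ k C (TensorProduct.comm k C C t)) =
        (toCop k C).toLinearMap.lTensor k (TensorProduct.comm k C k
          ((counit (R := k) (A := C)).lTensor C t)) := fun t => by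
      induction t with
      | zero => simp
      | add x y hx hy => simp only [map_add, hx, hy]
      | tmul x y => simp [toCop₂]
    refine (h (comul (R := k) c)).trans ?_
    rw [Coalgebra.lTensor_counit_comul]
    simp
  lTensor_counit_comp_comul := by
    refine LinearMap.ext fun d => ?_
    obtain ⟨c, rfl⟩ := (toCop k C).surjective d
    have h : ∀ t : C ⊗[k] C, (counit (R := k) (A := C) ∘ₗ (toCop k C).symm.toLinearMap).lTensor _
        (toCop₂ k C (TensorProduct.comm k C C t)) =
        (toCop k C).toLinearMap.rTensor k (TensorProduct.comm k k C
          ((counit (R := k) (A := C)).rTensor C t)) := fun t => by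
      induction t with
      | zero => simp
      | add x y hx hy => simp only [map_add, hx, hy]
      | tmul x y => simp [toCop₂]
    refine (h (comul (R := k) c)).trans ?_
    rw [Coalgebra.rTensor_counit_comul]
    simp

theorem comul_toCop [Coalgebra k C] (c : C) : comul (R := k) (toCop k C c) =
    toCop₂ k C (TensorProduct.comm k C C (comul (R := k) c)) := rfl

theorem counit_toCop [Coalgebra k C] (c : C) : counit (R := k) (toCop k C c) =
    counit (R := k) c := rfl

end Cop

section Cotensor

variable {k : Type u} [Field k] {C : Type u} [AddCommGroup C] [Module k C] [Coalgebra k C]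
variable {V W N : Type u} [AddCommGroup V] [Module k V] [AddCommGroup W] [Module k W]
  [AddCommGroup N] [Module k N]

/-- The difference `ρ ⊗ id - id ⊗ μ : V ⊗ N → V ⊗ (C ⊗ N)` of the two coactions, whose kernel is
the cotensor product `V □_C N`. -/
def cotensorDiff (ρ : RightComodule k C V) (μ : N →ₗ[k] C ⊗[k] N) :
    V ⊗[k] N →ₗ[k] V ⊗[k] (C ⊗[k] N) :=
  (TensorProduct.assoc k V C N).toLinearMap ∘ₗ ρ.coact.rTensor N - μ.lTensor V

theorem mem_ker_cotensorDiff {ρ : RightComodule k C V} {μ : N →ₗ[k] C ⊗[k] N} {t : V ⊗[k] N} :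
    t ∈ LinearMap.ker (cotensorDiff ρ μ) ↔
      TensorProduct.assoc k V C N (ρ.coact.rTensor N t) = μ.lTensor V t := by
  rw [LinearMap.mem_ker, cotensorDiff, LinearMap.sub_apply, sub_eq_zero]
  rfl

theorem cotensorDiff_natural {ρ : RightComodule k C V} {σ : RightComodule k C W} {f : V →ₗ[k] W}
    (hf : ρ.IsHom σ f) (μ : N →ₗ[k] C ⊗[k] N) (t : V ⊗[k] N) :
    cotensorDiff σ μ (f.rTensor N t) = f.rTensor (C ⊗[k] N) (cotensorDiff ρ μ t) := by
  induction t with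
  | zero => simp
  | add x y hx hy => simp only [map_add, hx, hy]
  | tmul v n =>
    simp only [cotensorDiff, LinearMap.sub_apply, LinearMap.comp_apply, LinearMap.rTensor_tmul,
      LinearMap.lTensor_tmul, LinearEquiv.coe_coe, map_sub, ← hf.apply]
    congr 1
    generalize ρ.coact v = s
    induction s with
    | zero => simp
    | add x y hx hy => simp only [map_add, TensorProduct.add_tmul, hx, hy]
    | tmul a b => simp

/-- The coaction of a right comodule, regarded as a left coaction of the co-opposite coalgebra. -/
def RightComodule.leftCoact (ρ : RightComodule k C V) : V →ₗ[k] Cop C ⊗[k] V :=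
  (toCop k C).toLinearMap.rTensor V ∘ₗ (TensorProduct.comm k V C).toLinearMap ∘ₗ ρ.coact

/-- The right comodule `V` is coflat: the functor `? □ V` (written here on right comodules over
the co-opposite coalgebra) preserves surjections. -/
def RightComodule.IsCoflat (ρ : RightComodule k C V) : Prop :=
  ∀ (X Y : Type u) [AddCommGroup X] [Module k X] [AddCommGroup Y] [Module k Y]
    (σ : RightComodule k (Cop C) X) (τ : RightComodule k (Cop C) Y) (f : X →ₗ[k] Y),
    σ.IsHom τ f → Function.Surjective f →
      ∀ t ∈ LinearMap.ker (cotensorDiff τ ρ.leftCoact),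
        ∃ s ∈ LinearMap.ker (cotensorDiff σ ρ.leftCoact), f.rTensor V s = t

section Dual

theorem dualTensorHom_lTensor {Z : Type u} [AddCommGroup Z] [Module k Z] (f : N →ₗ[k] Z)
    (s : Module.Dual k V ⊗[k] N) (v : V) :
    dualTensorHom k V Z (f.lTensor _ s) v = f (dualTensorHom k V N s v) := by
  induction s with
  | zero => simp
  | add x y hx hy => simp only [map_add, LinearMap.add_apply, hx, hy]
  | tmul a b => simp

variable [Module.Finite k V]

theorem dualTensorHom_injective : Function.Injective (dualTensorHom k V N) :=
  (dualTensorHomEquiv k V N).injective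

/-- The coaction on the dual of a finite-dimensional right comodule, with
`⟨w₍₀₎, v⟩ w₍₁₎ = ⟨w, v₍₀₎⟩ v₍₁₎`. -/
def dualCoact (ρ : RightComodule k C V) : Module.Dual k V →ₗ[k] Module.Dual k V ⊗[k] C :=
  (dualTensorHomEquiv k V C).symm.toLinearMap ∘ₗ
    { toFun := fun w => (TensorProduct.lid k C).toLinearMap ∘ₗ w.rTensor C ∘ₗ ρ.coact
      map_add' := fun v w => by
        ext; simp [LinearMap.rTensor_add]
      map_smul' := fun c w => by
        refine LinearMap.ext fun v => ?_
        rw [LinearMap.rTensor_smul]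
        simp only [LinearMap.comp_apply, LinearMap.smul_apply, map_smul, RingHom.id_apply] }

theorem dualTensorHom_dualCoact (ρ : RightComodule k C V) (w : Module.Dual k V) (v : V) :
    dualTensorHom k V C (dualCoact ρ w) v = TensorProduct.lid k C (w.rTensor C (ρ.coact v)) :=
  LinearMap.congr_fun ((dualTensorHomEquiv k V C).apply_symm_apply _) v

theorem dualTensorHom_assoc_dualCoact (ρ : RightComodule k C V) (t : Module.Dual k V ⊗[k] N)
    (v : V) :
    dualTensorHom k V (C ⊗[k] N) (TensorProduct.assoc k _ C N ((dualCoact ρ).rTensor N t)) v =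
      TensorProduct.comm k N C ((dualTensorHom k V N t).rTensor C (ρ.coact v)) := by
  induction t with
  | zero => simp
  | add x y hx hy =>
    simp only [map_add, LinearMap.add_apply, hx, hy, LinearMap.rTensor_add]
  | tmul w n =>
    have h1 : ∀ s : Module.Dual k V ⊗[k] C,
        dualTensorHom k V (C ⊗[k] N) (TensorProduct.assoc k _ C N (s ⊗ₜ n)) v =
          dualTensorHom k V C s v ⊗ₜ n := fun s => by
      induction s with
      | zero => simp
      | add x y hx hy => simp only [map_add, LinearMap.add_apply, TensorProduct.add_tmul, hx, hy]
      | tmul a b => simp [TensorProduct.smul_tmul']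
    rw [LinearMap.rTensor_tmul, h1, dualTensorHom_dualCoact]
    generalize ρ.coact v = s
    induction s with
    | zero => simp
    | add x y hx hy => simp only [map_add, TensorProduct.add_tmul, hx, hy]
    | tmul a b => simp [TensorProduct.smul_tmul]

theorem dualCoact_coassoc (ρ : RightComodule k C V) (w : Module.Dual k V) :
    TensorProduct.assoc k _ C C ((dualCoact ρ).rTensor C (dualCoact ρ w)) =
      ((TensorProduct.comm k C C).toLinearMap ∘ₗ comul (R := k) (A := C)).lTensor _
        (dualCoact ρ w) := by
  apply dualTensorHom_injective (V := V) (N := C ⊗[k] C)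
  refine LinearMap.ext fun v => ?_
  rw [dualTensorHom_assoc_dualCoact (N := C) ρ (dualCoact ρ w) v, dualTensorHom_lTensor,
    dualTensorHom_dualCoact, LinearMap.comp_apply]
  refine congrArg (TensorProduct.comm k C C) ?_
  have h2 : dualTensorHom k V C (dualCoact ρ w) =
      (TensorProduct.lid k C).toLinearMap ∘ₗ w.rTensor C ∘ₗ ρ.coact :=
    LinearMap.ext (dualTensorHom_dualCoact ρ w)
  rw [h2]
  have h3 : ∀ s : (V ⊗[k] C) ⊗[k] C, ((TensorProduct.lid k C).toLinearMap ∘ₗ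
      w.rTensor C).rTensor C s = TensorProduct.lid k (C ⊗[k] C)
        (w.rTensor (C ⊗[k] C) (TensorProduct.assoc k V C C s)) := fun s => by
    induction s with
    | zero => simp
    | add x y hx hy => simp only [map_add, hx, hy]
    | tmul a b =>
      induction a with
      | zero => simp
      | add x y hx hy => simp only [map_add, TensorProduct.add_tmul, hx, hy]
      | tmul a b => simp [TensorProduct.smul_tmul']
  have h4 : ∀ s : V ⊗[k] C, TensorProduct.lid k (C ⊗[k] C)
        (w.rTensor (C ⊗[k] C) ((comul (R := k) (A := C)).lTensor V s)) =
      comul (R := k) (TensorProduct.lid k C (w.rTensor C s)) := fun s => by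
    induction s with
    | zero => simp
    | add x y hx hy => simp only [map_add, hx, hy]
    | tmul a b => simp
  rw [← LinearMap.comp_assoc, LinearMap.rTensor_comp_apply, h3, ρ.coassoc_apply, h4]

theorem dualCoact_counit (ρ : RightComodule k C V) (w : Module.Dual k V) :
    (counit (R := k) (A := C)).lTensor _ (dualCoact ρ w) = w ⊗ₜ 1 := by
  apply dualTensorHom_injective (V := V) (N := k)
  refine LinearMap.ext fun v => ?_
  rw [dualTensorHom_lTensor, dualTensorHom_dualCoact]
  have h4 : ∀ s : V ⊗[k] C, counit (R := k) (TensorProduct.lid k C (w.rTensor C s)) =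
      w (TensorProduct.rid k V ((counit (R := k) (A := C)).lTensor V s)) := fun s => by
    induction s with
    | zero => simp
    | add x y hx hy => simp only [map_add, hx, hy]
    | tmul a b => simp [mul_comm]
  rw [h4, ρ.counit_apply]
  simp

/-- The dual of a finite-dimensional right `C`-comodule, a left `C`-comodule. -/
def dualComodule (ρ : RightComodule k C V) : RightComodule k (Cop C) (Module.Dual k V) where
  coact := (toCop k C).toLinearMap.lTensor _ ∘ₗ dualCoact ρ
  coassoc := by
    refine LinearMap.ext fun w => ?_
    have h1 : ∀ (f : Module.Dual k V →ₗ[k] Module.Dual k V ⊗[k] C) (t : Module.Dual k V ⊗[k] C),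
        TensorProduct.assoc k _ _ _ (((toCop k C).toLinearMap.lTensor _ ∘ₗ f).rTensor (Cop C)
          ((toCop k C).toLinearMap.lTensor _ t)) =
        (toCop₂ k C).lTensor _ (TensorProduct.assoc k _ _ _ (f.rTensor C t)) := fun f t => by
      induction t with
      | zero => simp
      | add x y hx hy => simp only [map_add, hx, hy]
      | tmul a b =>
        simp only [LinearMap.lTensor_tmul, LinearMap.rTensor_tmul, LinearMap.comp_apply]
        generalize f a = s
        induction s with
        | zero => simp
        | add x y hx hy => simp only [map_add, TensorProduct.add_tmul, hx, hy]
        | tmul a b => simp [toCop₂]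
    have h2 : ∀ (t : Module.Dual k V ⊗[k] C),
        (comul (R := k) (A := Cop C)).lTensor _ ((toCop k C).toLinearMap.lTensor _ t) =
        (toCop₂ k C).lTensor _ (((TensorProduct.comm k C C).toLinearMap ∘ₗ
          comul (R := k) (A := C)).lTensor _ t) := fun t => by
      induction t with
      | zero => simp
      | add x y hx hy => simp only [map_add, hx, hy]
      | tmul a b => simp [comul_toCop]
    simp only [LinearMap.comp_apply, LinearEquiv.coe_coe] at h1 h2 ⊢
    rw [h1, h2, dualCoact_coassoc]
  counit_coact := by
    refine LinearMap.ext fun w => ?_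
    simp only [LinearMap.comp_apply]
    rw [← LinearMap.lTensor_comp_apply]
    exact dualCoact_counit ρ w

end Dual

/-- A coflat comodule is injective: for a finite-dimensional comodule `U`, the space `U* □ V` is the
space of morphisms `U → V`. -/
theorem RightComodule.IsCoflat.isInjective {ρ : RightComodule k C V} (hρ : ρ.IsCoflat) :
    ρ.IsInjective := by
  refine IsFinitelyInjective.isInjective ?_
  intro X Y _ _ _ _ _ _ σ τ i g hi hinj hg
  have hdual : (dualComodule τ).IsHom (dualComodule σ) (Module.Dual.transpose i) := by
    refine LinearMap.ext fun w => ?_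
    have h0 : (Module.Dual.transpose i).rTensor C (dualCoact τ w) =
        dualCoact σ (Module.Dual.transpose (R := k) i w) := by
      apply dualTensorHom_injective (V := X) (N := C)
      refine LinearMap.ext fun x => ?_
      have h1 : ∀ (s : Module.Dual k Y ⊗[k] C),
          dualTensorHom k X C ((Module.Dual.transpose i).rTensor C s) x =
            dualTensorHom k Y C s (i x) := fun s => by
        induction s with
        | zero => simp
        | add x y hx hy => simp only [map_add, LinearMap.add_apply, hx, hy]
        | tmul a b => simp [Module.Dual.transpose_apply]
      rw [h1, dualTensorHom_dualCoact, dualTensorHom_dualCoact, ← hi.apply,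
        ← LinearMap.rTensor_comp_apply]
      rfl
    simp only [dualComodule, LinearMap.comp_apply]
    rw [← h0]
    generalize dualCoact τ w = s
    induction s with
    | zero => simp
    | add x y hx hy => simp only [map_add, hx, hy]
    | tmul a b => simp
  have hsurj : Function.Surjective (Module.Dual.transpose (R := k) i) :=
    LinearMap.dualMap_surjective_of_injective hinj
  -- Elements of the cotensor product with the dual comodule are the colinear maps.
  have hmem : ∀ {U : Type u} [AddCommGroup U] [Module k U] [Module.Finite k U]
      (θ : RightComodule k C U) (t : Module.Dual k U ⊗[k] V),
      t ∈ LinearMap.ker (cotensorDiff (dualComodule θ) ρ.leftCoact) ↔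
        θ.IsHom ρ (dualTensorHom k U V t) := by
    intro U _ _ _ θ t
    rw [mem_ker_cotensorDiff]
    have h1 : TensorProduct.assoc k _ (Cop C) V ((dualComodule θ).coact.rTensor V t) =
        ((toCop k C).toLinearMap.rTensor V).lTensor _
          (TensorProduct.assoc k _ C V ((dualCoact θ).rTensor V t)) := by
      simp only [dualComodule, LinearMap.rTensor_comp_apply]
      generalize (dualCoact θ).rTensor V t = s
      induction s with
      | zero => simp
      | add x y hx hy => simp only [map_add, hx, hy]
      | tmul a b =>
        induction a with
        | zero => simp
        | add x y hx hy => simp only [map_add, TensorProduct.add_tmul, hx, hy]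
        | tmul a c => simp
    have hinj : Function.Injective
        (((toCop k C).toLinearMap.rTensor V).lTensor (Module.Dual k U)) :=
      (((toCop k C).rTensor V).lTensor (Module.Dual k U)).injective
    rw [h1, leftCoact, LinearMap.lTensor_comp_apply, hinj.eq_iff,
      ← (dualTensorHom_injective (k := k) (V := U) (N := C ⊗[k] V)).eq_iff, LinearMap.ext_iff,
      IsHom, LinearMap.ext_iff]
    refine forall_congr' fun u => ?_
    rw [dualTensorHom_assoc_dualCoact, dualTensorHom_lTensor]
    exact (TensorProduct.comm k V C).injective.eq_iff
  obtain ⟨t, ht⟩ := (dualTensorHomEquiv k X V).surjective g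
  have ht' : dualTensorHom k X V t = g := ht
  obtain ⟨s, hs, hst⟩ := hρ _ _ (dualComodule τ) (dualComodule σ) _ hdual hsurj t
    ((hmem σ t).2 (by rwa [ht']))
  refine ⟨dualTensorHom k Y V s, (hmem τ s).1 hs, ?_⟩
  rw [← ht', ← hst]
  refine LinearMap.ext fun x => ?_
  clear hst hs
  induction s with
  | zero => simp
  | add x y hx hy =>
    simp only [map_add, LinearMap.add_apply, LinearMap.comp_apply] at hx hy ⊢
    rw [hx, hy]
  | tmul a b => simp [Module.Dual.transpose_apply]

end Cotensor

/-! ### Dimension shifting for injective resolutions of comodules -/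

section Resolutions

variable {k : Type u} [Field k] {C : Type u} [AddCommGroup C] [Module k C] [Coalgebra k C]
variable {V W X : Type u} [AddCommGroup V] [Module k V] [AddCommGroup W] [Module k W]
  [AddCommGroup X] [Module k X]

namespace RightComodule

variable {ρ : RightComodule k C V} {σ : RightComodule k C W} {τ : RightComodule k C X}

theorem IsHom.exists_factor {q : V →ₗ[k] W} {g : V →ₗ[k] X} (hq : ρ.IsHom σ q)
    (hg : ρ.IsHom τ g) (hs : Function.Surjective q) (hle : LinearMap.ker q ≤ LinearMap.ker g) :
    ∃ f : W →ₗ[k] X, σ.IsHom τ f ∧ f ∘ₗ q = g := by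
  obtain ⟨s, hs'⟩ := LinearMap.exists_rightInverse_of_surjective q (LinearMap.range_eq_top.2 hs)
  have hf : (g ∘ₗ s) ∘ₗ q = g := by
    refine LinearMap.ext fun v => ?_
    have h1 : s (q v) - v ∈ LinearMap.ker g := hle (by
      rw [LinearMap.mem_ker, map_sub, sub_eq_zero]
      exact LinearMap.congr_fun hs' (q v))
    rwa [LinearMap.mem_ker, map_sub, sub_eq_zero] at h1
  refine ⟨g ∘ₗ s, LinearMap.ext fun w => ?_, hf⟩
  obtain ⟨v, rfl⟩ := hs w
  rw [LinearMap.comp_apply, ← hq.apply, ← LinearMap.rTensor_comp_apply, hf, hg.apply]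
  exact congrArg _ (LinearMap.congr_fun hf v).symm

theorem IsHom.symm {e : V ≃ₗ[k] W} (h : ρ.IsHom σ e.toLinearMap) :
    σ.IsHom ρ e.symm.toLinearMap := by
  refine LinearMap.ext fun w => ?_
  obtain ⟨v, rfl⟩ := e.surjective w
  have := h.apply v
  simp only [LinearMap.comp_apply, LinearEquiv.coe_coe, LinearEquiv.symm_apply_apply] at this ⊢
  rw [← this, ← LinearMap.rTensor_comp_apply]
  simp

theorem HasInjectiveResolution.of_equiv {n : ℕ} (h : ρ.HasInjectiveResolution n) (e : V ≃ₗ[k] W)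
    (he : ρ.IsHom σ e.toLinearMap) : σ.HasInjectiveResolution n := by
  cases n with
  | zero =>
    exact IsInjective.of_retract (ρ := σ) (σ := ρ) h e.symm.toLinearMap e.toLinearMap he.symm he
      (by ext; simp)
  | succ n =>
    obtain ⟨Q, K, _, _, _, _, σ', τ', i, p, hi, hp, hinj, hex, hs, hQ, hK⟩ := h
    refine ⟨Q, K, _, _, _, _, σ', τ', i ∘ₗ e.symm.toLinearMap, p, hi.comp he.symm, hp,
      hinj.comp e.symm.injective, fun y => ?_, hs, hQ, hK⟩
    rw [hex y]
    constructor
    · rintro ⟨x, rfl⟩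
      exact ⟨e x, by simp⟩
    · rintro ⟨x, rfl⟩
      exact ⟨e.symm x, rfl⟩

theorem HasInjectiveResolution.prod {n : ℕ} (h : ρ.HasInjectiveResolution n)
    (hσ : σ.IsInjective) : (σ.prod ρ).HasInjectiveResolution n := by
  cases n with
  | zero => exact IsInjective.prod hσ h
  | succ n =>
    obtain ⟨Q, K, _, _, _, _, σ', τ', i, p, hi, hp, hinj, hex, hs, hQ, hK⟩ := h
    refine ⟨W × Q, K, _, _, _, _, σ.prod σ', τ', LinearMap.id.prodMap i, p ∘ₗ LinearMap.snd k W Q,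
      ?_, hp.comp (prod_isHom_snd _ _), ?_, ?_, ?_, hσ.prod hQ, hK⟩
    · have h1 := ((prod_isHom_fst σ ρ)).prod_map (hi.comp (prod_isHom_snd σ ρ))
      exact h1
    · exact Function.injective_id.prodMap hinj
    · rintro ⟨w, y⟩
      refine (hex y).trans ⟨?_, ?_⟩
      · rintro ⟨x, rfl⟩
        exact ⟨(w, x), rfl⟩
      · rintro ⟨⟨w', x⟩, h⟩
        exact ⟨x, (Prod.ext_iff.1 h).2⟩
    · intro z
      obtain ⟨y, rfl⟩ := hs z
      exact ⟨(0, y), rfl⟩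

/-- A form of Schanuel's lemma: if `V` embeds into the injective comodules `J` and `Q` with
cokernels `N` and `K`, then `Q × N` and `J × K` are isomorphic. -/
theorem exists_equiv_of_cokernels {V J N Q K : Type u} [AddCommGroup V] [Module k V]
    [AddCommGroup J] [Module k J] [AddCommGroup N] [Module k N] [AddCommGroup Q] [Module k Q]
    [AddCommGroup K] [Module k K] {ρ : RightComodule k C V} {κ : RightComodule k C J}
    {ν : RightComodule k C N} {σ : RightComodule k C Q} {τ : RightComodule k C K}
    {j : V →ₗ[k] J} {q : J →ₗ[k] N} {i : V →ₗ[k] Q} {p : Q →ₗ[k] K}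
    (hκ : κ.IsInjective) (hσ : σ.IsInjective) (hj : ρ.IsHom κ j) (hq : κ.IsHom ν q)
    (hi : ρ.IsHom σ i) (hp : σ.IsHom τ p) (hjinj : Function.Injective j)
    (hjq : Function.Exact j q) (hqs : Function.Surjective q) (hinj : Function.Injective i)
    (hip : Function.Exact i p) (hps : Function.Surjective p) :
    ∃ e : (J × K) ≃ₗ[k] (Q × N), (κ.prod τ).IsHom (σ.prod ν) e.toLinearMap := by
  obtain ⟨b, hb, hbj⟩ := hσ V J ρ κ j i hj hjinj hi
  obtain ⟨b', hb', hbq⟩ := hq.exists_factor (hp.comp hb) hqs (fun x hx => by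
    obtain ⟨v, rfl⟩ := (hjq x).1 hx
    have := LinearMap.congr_fun hbj v
    simp only [LinearMap.comp_apply] at this
    rw [LinearMap.mem_ker, LinearMap.comp_apply, this]
    exact hip.apply_apply_eq_zero v)
  have hbq' : ∀ x, b' (q x) = p (b x) := LinearMap.congr_fun hbq
  have hbj' : ∀ x, b (j x) = i x := LinearMap.congr_fun hbj
  -- The mapping cone `0 → J → Q × N → K → 0` is exact, and splits because `J` is injective.
  let f : J →ₗ[k] Q × N := b.prod q
  let g : Q × N →ₗ[k] K := p ∘ₗ LinearMap.fst k Q N - b' ∘ₗ LinearMap.snd k Q N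
  have hf : κ.IsHom (σ.prod ν) f := hb.prod_map hq
  have hg : (σ.prod ν).IsHom τ g :=
    (hp.comp (prod_isHom_fst σ ν)).sub (hb'.comp (prod_isHom_snd σ ν))
  have hfg : ∀ y, g y = 0 → ∃ x, f x = y := by
    rintro ⟨y, n⟩ hy
    obtain ⟨x, rfl⟩ := hqs n
    have h1 : p (y - b x) = 0 := by
      rw [map_sub, ← hbq']
      exact hy
    obtain ⟨v, hv⟩ := (hip _).1 h1
    refine ⟨x + j v, Prod.ext ?_ ?_⟩
    · change b (x + j v) = y
      rw [map_add, hbj', hv]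
      abel
    · change q (x + j v) = q x
      rw [map_add, hjq.apply_apply_eq_zero, add_zero]
  have hgf : ∀ x, g (f x) = 0 := fun x => by
    change p (b x) - b' (q x) = 0
    rw [hbq', sub_self]
  have hfinj : Function.Injective f := by
    rw [← LinearMap.ker_eq_bot, LinearMap.ker_eq_bot']
    intro x hx
    have h1 : b x = 0 := (Prod.ext_iff.1 hx).1
    obtain ⟨v, rfl⟩ := (hjq x).1 (Prod.ext_iff.1 hx).2
    rw [hbj'] at h1
    rw [hinj (h1.trans (map_zero i).symm), map_zero]
  obtain ⟨r, hr, hrf⟩ := hκ J (Q × N) κ (σ.prod ν) f LinearMap.id hf hfinj (isHom_id _)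
  have hrf' : ∀ x, r (f x) = x := LinearMap.congr_fun hrf
  have hbij : Function.Bijective (r.prod g) := by
    constructor
    · rw [← LinearMap.ker_eq_bot, LinearMap.ker_eq_bot']
      intro y hy
      obtain ⟨x, rfl⟩ := hfg y (Prod.ext_iff.1 hy).2
      have h1 : r (f x) = 0 := (Prod.ext_iff.1 hy).1
      rw [← hrf' x, h1, map_zero]
    · rintro ⟨x, z⟩
      obtain ⟨y, rfl⟩ := hps z
      refine ⟨(y, 0) + f (x - r (y, 0)), Prod.ext ?_ ?_⟩
      · change r ((y, 0) + f (x - r (y, 0))) = x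
        rw [map_add, hrf']
        abel
      · change g ((y, 0) + f (x - r (y, 0))) = p y
        rw [map_add, hgf, add_zero]
        change p y - b' 0 = p y
        rw [map_zero, sub_zero]
  exact ⟨(LinearEquiv.ofBijective _ hbij).symm,
    IsHom.symm (e := LinearEquiv.ofBijective _ hbij) (hr.prod_map hg)⟩

/-- Dimension shifting: a comodule `N = J / V` with `J` injective has an injective resolution that is
one step shorter than a given one of `V`. -/
theorem HasInjectiveResolution.cokernel (n : ℕ) :
    ∀ {V J N : Type u} [AddCommGroup V] [Module k V] [AddCommGroup J] [Module k J]
      [AddCommGroup N] [Module k N] {ρ : RightComodule k C V} {κ : RightComodule k C J}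
      {ν : RightComodule k C N} {j : V →ₗ[k] J} {q : J →ₗ[k] N},
      ρ.HasInjectiveResolution (n + 1) → κ.IsInjective → ρ.IsHom κ j → κ.IsHom ν q →
      Function.Injective j → Function.Exact j q → Function.Surjective q →
      ν.HasInjectiveResolution n := by
  induction n with
  | zero =>
    intro V J N _ _ _ _ _ _ ρ κ ν j q hρ hκ hj hq hjinj hjq hqs
    obtain ⟨Q, K, _, _, _, _, σ, τ, i, p, hi, hp, hinj, hip, hps, hQ, hK⟩ := hρ
    obtain ⟨e, he⟩ := exists_equiv_of_cokernels hκ hQ hj hq hi hp hjinj hjq hqs hinj hip hps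
    exact IsInjective.of_retract
      ((HasInjectiveResolution.prod (n := 0) hK hκ).of_equiv e he)
      _ _ (prod_isHom_inr σ ν) (prod_isHom_snd σ ν) (by ext; simp)
  | succ n ih =>
    intro V J N _ _ _ _ _ _ ρ κ ν j q hρ hκ hj hq hjinj hjq hqs
    obtain ⟨Q, K, _, _, _, _, σ, τ, i, p, hi, hp, hinj, hip, hps, hQ, hK⟩ := hρ
    obtain ⟨e, he⟩ := exists_equiv_of_cokernels hκ hQ hj hq hi hp hjinj hjq hqs hinj hip hps
    have hQN := (HasInjectiveResolution.prod hK hκ).of_equiv e he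
    have hsub := ν.isHom_coact.isSub_range
    let π := (LinearMap.range ν.coact).mkQ
    have hπ : (cofree C N).IsHom ((cofree C N).quot _ hsub) π := quot_isHom _ _ _
    have hex : Function.Exact ν.coact π := fun y => by
      simp [π, LinearMap.mem_range]
    have hπs : Function.Surjective π := Submodule.mkQ_surjective _
    refine ⟨N ⊗[k] C, _, _, _, _, _, cofree C N, (cofree C N).quot _ hsub, ν.coact, π,
      ν.isHom_coact, hπ, ν.coact_injective, hex, hπs, cofree_isInjective, ?_⟩
    have h1 : (σ.prod ν).IsHom (σ.prod (cofree C N)) (LinearMap.id.prodMap ν.coact) :=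
      (prod_isHom_fst σ ν).prod_map (ν.isHom_coact.comp (prod_isHom_snd σ ν))
    have h2 : (σ.prod (cofree C N)).IsHom ((cofree C N).quot _ hsub)
        (π ∘ₗ LinearMap.snd k Q (N ⊗[k] C)) := hπ.comp (prod_isHom_snd _ _)
    have h3 : Function.Injective (LinearMap.id.prodMap ν.coact : Q × N →ₗ[k] Q × (N ⊗[k] C)) :=
      Function.injective_id.prodMap ν.coact_injective
    have h4 : Function.Exact (LinearMap.id.prodMap ν.coact : Q × N →ₗ[k] Q × (N ⊗[k] C))
        (π ∘ₗ LinearMap.snd k Q (N ⊗[k] C)) := by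
      rintro ⟨w, y⟩
      refine (hex y).trans ⟨?_, ?_⟩
      · rintro ⟨x, rfl⟩
        exact ⟨(w, x), rfl⟩
      · rintro ⟨⟨w', x⟩, h⟩
        exact ⟨x, (Prod.ext_iff.1 h).2⟩
    have h5 : Function.Surjective (π ∘ₗ LinearMap.snd k Q (N ⊗[k] C)) := fun z => by
      obtain ⟨y, rfl⟩ := hπs z
      exact ⟨(0, y), rfl⟩
    exact ih hQN (hQ.prod cofree_isInjective) h1 h2 h3 h4 h5

end RightComodule

end Resolutions

/-! ### Right coideal subalgebras in terms of explicit structure maps -/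

/-- A Hopf algebra `H` with bijective antipode over a field `k`, a right coideal subalgebra
`i : L → H` over which `H` is faithfully flat on both sides, and the factor coalgebra
`π : H → C = H / H L⁺` with its `H`-module structure. The coalgebras are given by instances, but
the products are explicit bilinear maps: replacing them by their flips (and `C` by its co-opposite)
gives the datum `CoidealDatum.mirror`, which interchanges left and right. Faithful flatness is
expressed with `Bal`, for operators that define module structures over `L`. -/
structure CoidealDatum (k H L C : Type u) [Field k] [AddCommGroup H] [Module k H] [Coalgebra k H]
    [AddCommGroup L] [Module k L] [AddCommGroup C] [Module k C] [Coalgebra k C] where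
  /-- the product of `H` -/
  mul : H →ₗ[k] H →ₗ[k] H
  /-- the unit of `H` -/
  one : H
  /-- the antipode -/
  S : H →ₗ[k] H
  /-- the inverse of the antipode -/
  T : H →ₗ[k] H
  /-- the product of `L` -/
  mulL : L →ₗ[k] L →ₗ[k] L
  /-- the unit of `L` -/
  oneL : L
  /-- the inclusion of the subalgebra -/
  i : L →ₗ[k] H
  /-- the coaction of `H` on `L` -/
  δ : L →ₗ[k] L ⊗[k] H
  /-- the projection to the factor coalgebra -/
  π : H →ₗ[k] C
  /-- the action of `H` on `C` -/
  act : H →ₗ[k] Module.End k C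
  mul_assoc : ∀ x y z, mul (mul x y) z = mul x (mul y z)
  one_mul : ∀ x, mul one x = x
  mul_one : ∀ x, mul x one = x
  comul_mul : ∀ x y, comul (R := k) (mul x y) = actMap mul mul (comul (R := k) x) (comul (R := k) y)
  comul_one : comul (R := k) one = one ⊗ₜ one
  counit_one : counit (R := k) one = 1
  counit_mul : ∀ x y, counit (R := k) (mul x y) = counit (R := k) x * counit (R := k) y
  S_T : ∀ x, S (T x) = x
  T_S : ∀ x, T (S x) = x
  S_mul : ∀ x y, S (mul x y) = mul (S y) (S x)
  S_one : S one = one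
  counit_S : ∀ x, counit (R := k) (S x) = counit (R := k) x
  comul_S : ∀ x, comul (R := k) (S x) = TensorProduct.map S S (TensorProduct.comm k H H (comul x))
  S_left : ∀ x, TensorProduct.lift (mul ∘ₗ S) (comul (R := k) x) = counit (R := k) x • one
  S_right : ∀ x, TensorProduct.lift (mul.compl₂ S) (comul (R := k) x) = counit (R := k) x • one
  i_injective : Function.Injective i
  i_mul : ∀ a b, i (mulL a b) = mul (i a) (i b)
  i_one : i oneL = one
  mulL_assoc : ∀ x y z, mulL (mulL x y) z = mulL x (mulL y z)
  mulL_one : ∀ x, mulL x oneL = x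
  oneL_mul : ∀ x, mulL oneL x = x
  comul_i : ∀ a, comul (R := k) (i a) = i.rTensor H (δ a)
  π_surjective : Function.Surjective π
  comul_π : ∀ x, comul (R := k) (π x) = TensorProduct.map π π (comul (R := k) x)
  counit_π : ∀ x, counit (R := k) (π x) = counit (R := k) x
  act_π : ∀ h x, act h (π x) = π (mul h x)
  π_mul_i : ∀ h a, π (mul h (i a)) = counit (R := k) (i a) • π h
  mem_span_of_π : ∀ x, π x = 0 →
    x ∈ Submodule.span k {y | ∃ h a, counit (R := k) (i a) = 0 ∧ y = mul h (i a)}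
  left_flat : ∀ {N N' : Type u} [AddCommGroup N] [Module k N] [AddCommGroup N'] [Module k N']
    {α : L →ₗ[k] Module.End k N} {α' : L →ₗ[k] Module.End k N'} (_ : IsRightAct mulL oneL α)
    (_ : IsRightAct mulL oneL α') (f : N →ₗ[k] N') (hf : Intertwines α α' f),
    Function.Injective f →
      Function.Injective (Bal.map f LinearMap.id hf (Intertwines.id (mul ∘ₗ i)))
  left_faithful : ∀ {N : Type u} [AddCommGroup N] [Module k N] {α : L →ₗ[k] Module.End k N},
    IsRightAct mulL oneL α → Subsingleton (Bal α (mul ∘ₗ i)) → Subsingleton N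
  right_flat : ∀ {N N' : Type u} [AddCommGroup N] [Module k N] [AddCommGroup N'] [Module k N']
    {α : L →ₗ[k] Module.End k N} {α' : L →ₗ[k] Module.End k N'} (_ : IsRightAct mulL.flip oneL α)
    (_ : IsRightAct mulL.flip oneL α') (f : N →ₗ[k] N') (hf : Intertwines α α' f),
    Function.Injective f →
      Function.Injective (Bal.map f LinearMap.id hf (Intertwines.id (mul.flip ∘ₗ i)))
  right_faithful : ∀ {N : Type u} [AddCommGroup N] [Module k N] {α : L →ₗ[k] Module.End k N},
    IsRightAct mulL.flip oneL α → Subsingleton (Bal α (mul.flip ∘ₗ i)) → Subsingleton N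

namespace CoidealDatum

variable {k H L C : Type u} [Field k] [AddCommGroup H] [Module k H] [Coalgebra k H]
    [AddCommGroup L] [Module k L] [AddCommGroup C] [Module k C] [Coalgebra k C]
variable (D : CoidealDatum k H L C)

theorem T_mul (x y : H) : D.T (D.mul x y) = D.mul (D.T y) (D.T x) := by
  rw [← D.T_S (D.mul (D.T y) (D.T x)), D.S_mul, D.S_T, D.S_T]

theorem T_one : D.T D.one = D.one := by
  conv_lhs => rw [← D.S_one]
  exact D.T_S _

theorem counit_T (x : H) : counit (R := k) (D.T x) = counit (R := k) x := by
  rw [← D.counit_S, D.S_T]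

theorem comul_T (x : H) : comul (R := k) (D.T x) =
    TensorProduct.map D.T D.T (TensorProduct.comm k H H (comul x)) := by
  have h := D.comul_S (D.T x)
  rw [D.S_T] at h
  rw [h]
  generalize comul (R := k) (D.T x) = t
  induction t with
  | zero => simp
  | add x y hx hy => simp only [map_add, ← hx, ← hy]
  | tmul a b => simp [D.T_S]

/-- `T(x₍₂₎) x₍₁₎ = ε(x)`. -/
theorem T_left (x : H) :
    TensorProduct.lift (D.mul.flip.compl₂ D.T) (comul (R := k) x) = counit (R := k) x • D.one := by
  have h : ∀ t : H ⊗[k] H, D.S (TensorProduct.lift (D.mul.flip.compl₂ D.T) t) =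
      TensorProduct.lift (D.mul ∘ₗ D.S) t := fun t => by
    induction t with
    | zero => simp
    | add x y hx hy => simp only [map_add, hx, hy]
    | tmul a b => simp [D.S_mul, D.S_T]
  rw [← D.T_S (TensorProduct.lift _ _), h, D.S_left, map_smul, D.T_one]

/-- `x₍₂₎ T(x₍₁₎) = ε(x)`. -/
theorem T_right (x : H) :
    TensorProduct.lift (D.mul.flip ∘ₗ D.T) (comul (R := k) x) = counit (R := k) x • D.one := by
  have h : ∀ t : H ⊗[k] H, D.S (TensorProduct.lift (D.mul.flip ∘ₗ D.T) t) =
      TensorProduct.lift (D.mul.compl₂ D.S) t := fun t => by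
    induction t with
    | zero => simp
    | add x y hx hy => simp only [map_add, hx, hy]
    | tmul a b => simp [D.S_mul, D.S_T]
  rw [← D.T_S (TensorProduct.lift _ _), h, D.S_right, map_smul, D.T_one]

theorem lift_comul_counit (x : H) :
    TensorProduct.lid k H ((counit (R := k) (A := H)).rTensor H (comul x)) = x := by simp

/-- `π(h T(a)) = ε(a) π(h)`: the left ideal `H L⁺` contains the image of `L⁺` under the inverse of
the antipode, because `T(a₍₂₎) a₍₁₎ = ε(a)` and `π(h T(a₍₂₎) a₍₁₎) = π(h T(a))`. -/
theorem π_mul_T_i (h : H) (a : L) :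
    D.π (D.mul h (D.T (D.i a))) = counit (R := k) (D.i a) • D.π h := by
  have h1 : ∀ s : L ⊗[k] H, D.π (D.mul h (TensorProduct.lift (D.mul.flip.compl₂ D.T)
        (D.i.rTensor H s))) = D.π (D.mul h (D.T (TensorProduct.lid k H
          ((counit (R := k) (A := H)).rTensor H (D.i.rTensor H s))))) := fun s => by
    induction s with
    | zero => simp
    | add x y hx hy => simp only [map_add, hx, hy]
    | tmul a b => simp [← D.mul_assoc, D.π_mul_i]
  have h2 := h1 (D.δ a)
  rw [← D.comul_i, D.T_left, lift_comul_counit, map_smul, D.mul_one, map_smul] at h2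
  exact h2.symm

/-- `S(L⁺) H ⊆ L⁺ H`: modulo `L⁺ H`, the element `S(a) h` is congruent to
`a₍₁₎ S(a₍₂₎) h = ε(a) h`. -/
theorem S_i_mul_mem (h : H) (a : L) (ha : counit (R := k) (D.i a) = 0) :
    D.mul (D.S (D.i a)) h ∈
      Submodule.span k {y | ∃ h a, counit (R := k) (D.i a) = 0 ∧ y = D.mul (D.i a) h} := by
  have h1 : ∀ s : L ⊗[k] H, D.mul (TensorProduct.lift (D.mul.compl₂ D.S) (D.i.rTensor H s)) h -
      D.mul (D.S (TensorProduct.lid k H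
          ((counit (R := k) (A := H)).rTensor H (D.i.rTensor H s)))) h ∈
      Submodule.span k {y | ∃ h a, counit (R := k) (D.i a) = 0 ∧ y = D.mul (D.i a) h} := fun s => by
    induction s with
    | zero => simp
    | add x y hx hy =>
      simp only [map_add, LinearMap.add_apply]
      rw [add_sub_add_comm]
      exact add_mem hx hy
    | tmul a b =>
      refine Submodule.subset_span ⟨D.mul (D.S b) h, a - counit (R := k) (D.i a) • D.oneL, ?_, ?_⟩
      · rw [map_sub, map_sub, map_smul, map_smul, D.i_one, D.counit_one]
        simp
      · simp [D.i_one, D.one_mul, D.mul_assoc]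
  have h2 := h1 (D.δ a)
  rw [← D.comul_i, D.S_right, lift_comul_counit, ha, zero_smul, map_zero, LinearMap.zero_apply,
    zero_sub] at h2
  exact neg_mem_iff.1 h2

/-- The datum with left and right interchanged: the products of `H` and `L` are reversed, `S` and its
inverse change places, and `C` is replaced by its co-opposite, with the projection `π T`. -/
def mirror : CoidealDatum k H L (Cop C) where
  mul := D.mul.flip
  one := D.one
  S := D.T
  T := D.S
  mulL := D.mulL.flip
  oneL := D.oneL
  i := D.i
  δ := D.δ
  π := (toCop k C).toLinearMap ∘ₗ D.π ∘ₗ D.T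
  act := ((toCop k C).conj.toLinearMap ∘ₗ D.act) ∘ₗ D.T
  mul_assoc x y z := (D.mul_assoc z y x).symm
  one_mul := D.mul_one
  mul_one := D.one_mul
  comul_mul x y := by
    rw [actMap_flip]
    exact D.comul_mul y x
  comul_one := D.comul_one
  counit_one := D.counit_one
  counit_S := D.counit_T
  counit_mul x y := (D.counit_mul y x).trans (mul_comm _ _)
  S_T := D.T_S
  T_S := D.S_T
  S_mul x y := D.T_mul y x
  S_one := D.T_one
  comul_S := D.comul_T
  S_left := D.T_right
  S_right := D.T_left
  i_injective := D.i_injective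
  i_mul a b := D.i_mul b a
  i_one := D.i_one
  mulL_assoc x y z := (D.mulL_assoc z y x).symm
  mulL_one := D.oneL_mul
  oneL_mul := D.mulL_one
  comul_i := D.comul_i
  π_surjective := (toCop k C).surjective.comp (D.π_surjective.comp fun x => ⟨D.S x, D.T_S x⟩)
  comul_π x := by
    simp only [LinearMap.comp_apply, LinearEquiv.coe_coe]
    rw [comul_toCop, D.comul_π, D.comul_T]
    generalize comul (R := k) x = t
    induction t with
    | zero => simp
    | add x y hx hy => simp only [map_add, hx, hy]
    | tmul a b => simp [toCop₂]
  counit_π x := by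
    simp only [LinearMap.comp_apply, LinearEquiv.coe_coe]
    rw [counit_toCop, D.counit_π, D.counit_T]
  act_π h x := by
    simp only [LinearMap.comp_apply, LinearEquiv.coe_coe, LinearMap.flip_apply, D.T_mul, ← D.act_π]
    rfl
  π_mul_i h a := by
    simp only [LinearMap.comp_apply, LinearEquiv.coe_coe, LinearMap.flip_apply, D.T_mul,
      D.π_mul_T_i, map_smul]
  mem_span_of_π x hx := by
    have h1 : D.π (D.T x) = 0 := (toCop k C).injective (hx.trans (map_zero _).symm)
    have h2 := D.mem_span_of_π _ h1
    rw [← D.S_T x]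
    refine Submodule.span_induction (p := fun y _ => D.S y ∈ Submodule.span k
      {y | ∃ h a, counit (R := k) (D.i a) = 0 ∧ y = D.mul (D.i a) h}) ?_ ?_ ?_ ?_ h2
    · rintro _ ⟨h, a, ha, rfl⟩
      rw [D.S_mul]
      exact D.S_i_mul_mem _ a ha
    · rw [map_zero]
      exact zero_mem _
    · intro x y _ _ hx hy
      rw [map_add]
      exact add_mem hx hy
    · intro c x _ hx
      rw [map_smul]
      exact Submodule.smul_mem _ c hx
  left_flat := D.right_flat
  left_faithful := D.right_faithful
  right_flat := D.left_flat
  right_faithful := D.left_faithful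

end CoidealDatum

/-! ### The canonical isomorphism `H ⊗_L H ≃ C ⊗ H` and coinvariants -/

theorem intertwines_assoc_rTensor {k L C V N : Type u} [Field k] [AddCommGroup L] [Module k L]
    [AddCommGroup C] [Module k C] [AddCommGroup V] [Module k V] [AddCommGroup N] [Module k N]
    (f : V →ₗ[k] V ⊗[k] C) (α : L →ₗ[k] Module.End k N) :
    Intertwines (ampAct V α) (ampAct V (ampAct C α))
      ((TensorProduct.assoc k V C N).toLinearMap ∘ₗ f.rTensor N) := by
  intro r t
  induction t with
  | zero => simp
  | add x y hx hy => simp only [map_add, hx, hy]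
  | tmul v n =>
    simp only [ampAct_tmul, LinearMap.comp_apply, LinearMap.rTensor_tmul, LinearEquiv.coe_coe]
    generalize f v = s
    induction s with
    | zero => simp
    | add x y hx hy => simp only [map_add, TensorProduct.add_tmul, hx, hy]
    | tmul v n => simp

theorem RightComodule.coact_rTensor_injective {k C V N : Type u} [Field k] [AddCommGroup C]
    [Module k C] [Coalgebra k C] [AddCommGroup V] [Module k V] [AddCommGroup N] [Module k N]
    (ρ : RightComodule k C V) : Function.Injective (ρ.coact.rTensor N) :=
  Module.Flat.rTensor_preserves_injective_linearMap _ ρ.coact_injective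

theorem RightComodule.assoc_coact_rTensor {k C V N : Type u} [Field k] [AddCommGroup C]
    [Module k C] [Coalgebra k C] [AddCommGroup V] [Module k V] [AddCommGroup N] [Module k N]
    (ρ : RightComodule k C V) (w : V ⊗[k] N) :
    TensorProduct.assoc k V C (C ⊗[k] N) (ρ.coact.rTensor (C ⊗[k] N)
      (TensorProduct.assoc k V C N (ρ.coact.rTensor N w))) =
    ((TensorProduct.assoc k C C N).toLinearMap ∘ₗ
      (comul (R := k) (A := C)).rTensor N).lTensor V
        (TensorProduct.assoc k V C N (ρ.coact.rTensor N w)) := by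
  induction w with
  | zero => simp
  | add x y hx hy => simp only [map_add, hx, hy]
  | tmul v n =>
    have h1 : ∀ s : V ⊗[k] C, TensorProduct.assoc k V C (C ⊗[k] N) (ρ.coact.rTensor (C ⊗[k] N)
        (TensorProduct.assoc k V C N (s ⊗ₜ n))) =
        (TensorProduct.assoc k C C N).toLinearMap.lTensor V (TensorProduct.assoc k V (C ⊗[k] C) N
          (TensorProduct.assoc k V C C (ρ.coact.rTensor C s) ⊗ₜ n)) := fun s => by
      induction s with
      | zero => simp
      | add x y hx hy => simp only [map_add, TensorProduct.add_tmul, hx, hy]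
      | tmul v c =>
        simp only [LinearMap.rTensor_tmul, TensorProduct.assoc_tmul]
        generalize ρ.coact v = s
        induction s with
        | zero => simp
        | add x y hx hy => simp only [map_add, TensorProduct.add_tmul, hx, hy]
        | tmul v d => simp
    rw [LinearMap.rTensor_tmul, h1, ρ.coassoc_apply]
    generalize ρ.coact v = s
    induction s with
    | zero => simp
    | add x y hx hy => simp only [map_add, TensorProduct.add_tmul, hx, hy]
    | tmul v c => simp

namespace CoidealDatum

variable {k H L C : Type u} [Field k] [AddCommGroup H] [Module k H] [Coalgebra k H]
    [AddCommGroup L] [Module k L] [AddCommGroup C] [Module k C] [Coalgebra k C]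
variable (D : CoidealDatum k H L C)
variable {V W N : Type u} [AddCommGroup V] [Module k V] [AddCommGroup W] [Module k W]
  [AddCommGroup N] [Module k N]

/-- Multiplication by elements of `L` on the left of `H`. -/
abbrev lmul : L →ₗ[k] Module.End k H := D.mul ∘ₗ D.i

/-- Multiplication by elements of `L` on the right of `H`. -/
abbrev rmul : L →ₗ[k] Module.End k H := D.mul.flip ∘ₗ D.i

theorem isRightAct_rmul : IsRightAct D.mulL D.oneL D.rmul where
  one_act n := by simp [D.i_one, D.mul_one]
  mul_act a b n := by simp [D.i_mul, D.mul_assoc]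

/-- The left coaction `h ↦ π(h₍₁₎) ⊗ h₍₂₎` of `C` on `H`. -/
def coactLeft : H →ₗ[k] C ⊗[k] H := D.π.rTensor H ∘ₗ comul (R := k) (A := H)

theorem coactLeft_coassoc (h : H) :
    TensorProduct.assoc k C C H ((comul (R := k) (A := C)).rTensor H (D.coactLeft h)) =
      D.coactLeft.lTensor C (D.coactLeft h) := by
  have h1 : ∀ t : H ⊗[k] H, TensorProduct.assoc k C C H ((comul (R := k) (A := C)).rTensor H
      (D.π.rTensor H t)) = TensorProduct.map D.π (D.π.rTensor H)
        (TensorProduct.assoc k H H H ((comul (R := k) (A := H)).rTensor H t)) := fun t => by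
    induction t with
    | zero => simp
    | add x y hx hy => simp only [map_add, hx, hy]
    | tmul a b =>
      simp only [LinearMap.rTensor_tmul, D.comul_π]
      generalize comul (R := k) a = s
      induction s with
      | zero => simp
      | add x y hx hy => simp only [map_add, TensorProduct.add_tmul, hx, hy]
      | tmul a b => simp
  have h2 : ∀ t : H ⊗[k] H, D.coactLeft.lTensor C (D.π.rTensor H t) =
      TensorProduct.map D.π (D.π.rTensor H) ((comul (R := k) (A := H)).lTensor H t) := fun t => by
    induction t with
    | zero => simp
    | add x y hx hy => simp only [map_add, hx, hy]
    | tmul a b => simp [coactLeft]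
  rw [coactLeft, LinearMap.comp_apply, h1, ← coactLeft, h2, Coalgebra.coassoc_apply]

theorem coactLeft_counit (h : H) :
    (counit (R := k) (A := C)).rTensor H (D.coactLeft h) = 1 ⊗ₜ h := by
  rw [← Coalgebra.rTensor_counit_comul, coactLeft, LinearMap.comp_apply]
  generalize comul (R := k) h = t
  induction t with
  | zero => simp
  | add x y hx hy => simp only [map_add, hx, hy]
  | tmul a b => simp [D.counit_π]

theorem coactLeft_mul (x y : H) :
    D.coactLeft (D.mul x y) = actMap D.act D.mul (comul (R := k) x) (D.coactLeft y) := by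
  rw [coactLeft, LinearMap.comp_apply, LinearMap.comp_apply, D.comul_mul]
  generalize comul (R := k) x = s
  generalize comul (R := k) y = t
  induction s with
  | zero => simp
  | add x y hx hy => simp only [map_add, LinearMap.add_apply, hx, hy]
  | tmul a b =>
    induction t with
    | zero => simp
    | add x y hx hy => simp only [map_add, hx, hy]
    | tmul c d => simp [D.act_π]

theorem coactLeft_one : D.coactLeft D.one = D.π D.one ⊗ₜ D.one := by
  simp [coactLeft, D.comul_one]

theorem intertwines_coactLeft : Intertwines D.rmul (ampAct C D.rmul) D.coactLeft := by
  intro a x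
  have h : ∀ s : L ⊗[k] H, ∀ t : H ⊗[k] H, D.π.rTensor H (actMap D.mul D.mul t (D.i.rTensor H s)) =
      ampAct C D.mul.flip (TensorProduct.lid k H ((counit (R := k) (A := H)).rTensor H
        (D.i.rTensor H s))) (D.π.rTensor H t) := fun s t => by
    induction s with
    | zero => simp
    | add x y hx hy => simp only [map_add, LinearMap.add_apply, hx, hy]
    | tmul a b =>
      induction t with
      | zero => simp
      | add x y hx hy => simp only [map_add, LinearMap.add_apply, hx, hy]
      | tmul c d => simp [D.π_mul_i, TensorProduct.smul_tmul']
  have h1 := h (D.δ a) (comul x)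
  rw [← D.comul_i, lift_comul_counit, ← D.comul_mul] at h1
  exact h1

variable (V) in
/-- The map `(v ⊗ x) ⊗ h ↦ v ⊗ x h`. -/
def mulAmp : (V ⊗[k] H) ⊗[k] H →ₗ[k] V ⊗[k] H :=
  TensorProduct.lift (ampAct V D.mul.flip).flip

theorem mulAmp_tmul (t : V ⊗[k] H) (h : H) :
    D.mulAmp V (t ⊗ₜ h) = ampAct V D.mul.flip h t := rfl

@[simp] theorem mulAmp_tmul_tmul (v : V) (x h : H) :
    D.mulAmp V ((v ⊗ₜ x) ⊗ₜ h) = v ⊗ₜ D.mul x h := rfl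

theorem mulAmp_balanced (t : V ⊗[k] H) (a : L) (h : H) :
    D.mulAmp V (ampAct V D.rmul a t ⊗ₜ h) = D.mulAmp V (t ⊗ₜ D.lmul a h) := by
  induction t with
  | zero => simp
  | add x y hx hy => simp only [map_add, TensorProduct.add_tmul, hx, hy]
  | tmul v x => simp [D.mul_assoc]

theorem mulAmp_natural (f : V →ₗ[k] W) (t : (V ⊗[k] H) ⊗[k] H) :
    D.mulAmp W ((f.rTensor H).rTensor H t) = f.rTensor H (D.mulAmp V t) := by
  induction t with
  | zero => simp
  | add x y hx hy => simp only [map_add, hx, hy]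
  | tmul s h =>
    induction s with
    | zero => simp
    | add x y hx hy => simp only [map_add, TensorProduct.add_tmul, hx, hy]
    | tmul v x => simp

/-- The canonical map `H ⊗_L H → C ⊗ H`, `x ⊗ h ↦ π(x₍₁₎) ⊗ x₍₂₎ h`. -/
def can : Bal D.rmul D.lmul →ₗ[k] C ⊗[k] H :=
  Bal.lift (D.mulAmp C ∘ₗ D.coactLeft.rTensor H) fun x a h => by
    rw [LinearMap.comp_apply, LinearMap.rTensor_tmul, D.intertwines_coactLeft, mulAmp_balanced]
    rfl

theorem can_mk (x h : H) :
    D.can (Bal.mk _ _ (x ⊗ₜ h)) = D.mulAmp C (D.coactLeft x ⊗ₜ h) := rfl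

/-- The map `x ⊗ h ↦ x₍₁₎ ⊗ S(x₍₂₎) h`, which induces the inverse of the canonical map. -/
def canInvAux : H ⊗[k] H →ₗ[k] Bal D.rmul D.lmul :=
  Bal.mk _ _ ∘ₗ (TensorProduct.lift (D.mul ∘ₗ D.S)).lTensor H ∘ₗ
    (TensorProduct.assoc k H H H).toLinearMap ∘ₗ (comul (R := k) (A := H)).rTensor H

theorem canInvAux_tmul (x h : H) : D.canInvAux (x ⊗ₜ h) =
    Bal.mk _ _ ((D.mul.flip h ∘ₗ D.S).lTensor H (comul (R := k) x)) := by
  simp only [canInvAux, LinearMap.comp_apply, LinearMap.rTensor_tmul, LinearEquiv.coe_coe]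
  generalize comul (R := k) x = t
  induction t with
  | zero => simp
  | add x y hx hy => simp only [map_add, TensorProduct.add_tmul, hx, hy]
  | tmul v x => simp

/-- `canInvAux` is compatible with the projection to `C`: in `H ⊗_L H`,
`x₍₁₎ a₍₁₎ ⊗ S(x₍₂₎ a₍₂₎) h = x₍₁₎ ⊗ a₍₁₎ S(a₍₂₎) S(x₍₂₎) h`. -/
theorem canInvAux_mul_i (x h : H) (a : L) :
    D.canInvAux (D.mul x (D.i a) ⊗ₜ h) = counit (R := k) (D.i a) • D.canInvAux (x ⊗ₜ h) := by
  have key : ∀ s : L ⊗[k] H, ∀ t : H ⊗[k] H,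
      Bal.mk D.rmul D.lmul ((D.mul.flip h ∘ₗ D.S).lTensor H
        (actMap D.mul D.mul t (D.i.rTensor H s))) =
      Bal.mk D.rmul D.lmul ((D.mul (TensorProduct.lift (D.mul.compl₂ D.S) (D.i.rTensor H s)) ∘ₗ
        D.mul.flip h ∘ₗ D.S).lTensor H t) := fun s t => by
    induction t with
    | zero => simp
    | add x y hx hy => simp only [map_add, LinearMap.add_apply, hx, hy]
    | tmul p q =>
      induction s with
      | zero => simp
      | add x y hx hy => simp only [map_add, LinearMap.add_apply, LinearMap.add_comp,
          LinearMap.lTensor_add, hx, hy]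
      | tmul a b =>
        have := Bal.mk_act (α := D.rmul) (β := D.lmul) p a
          (D.mul (D.mul (D.S b) (D.S q)) h)
        simpa [D.S_mul, D.mul_assoc] using this
  have h1 := key (D.δ a) (comul x)
  rw [← D.comul_i, ← D.comul_mul, D.S_right] at h1
  rw [canInvAux_tmul, h1, canInvAux_tmul, ← map_smul]
  congr 1
  generalize comul (R := k) x = t
  induction t with
  | zero => simp
  | add x y hx hy => simp only [map_add, smul_add, hx, hy]
  | tmul v x => simp [D.one_mul]

theorem canInvAux_eq_zero (x h : H) (hx : D.π x = 0) : D.canInvAux (x ⊗ₜ h) = 0 := by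
  refine Submodule.span_induction (p := fun x _ => D.canInvAux (x ⊗ₜ h) = 0) ?_ ?_ ?_ ?_
    (D.mem_span_of_π x hx)
  · rintro _ ⟨y, a, ha, rfl⟩
    rw [canInvAux_mul_i, ha, zero_smul]
  · simp
  · intro x y _ _ hx hy
    rw [TensorProduct.add_tmul, map_add, hx, hy, add_zero]
  · intro c x _ hx
    rw [← TensorProduct.smul_tmul', map_smul, hx, smul_zero]

/-- `x₍₁₎ ⊗ S(x₍₂₎) x₍₃₎ = x ⊗ 1`. -/
theorem lTensor_S_mul_comul (x : H) :
    (TensorProduct.lift (D.mul ∘ₗ D.S)).lTensor H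
      (TensorProduct.assoc k H H H ((comul (R := k) (A := H)).rTensor H (comul (R := k) x))) =
      x ⊗ₜ D.one := by
  rw [Coalgebra.coassoc_apply, ← LinearMap.lTensor_comp_apply]
  have : TensorProduct.lift (D.mul ∘ₗ D.S) ∘ₗ comul (R := k) (A := H) =
      LinearMap.toSpanSingleton k H D.one ∘ₗ counit (R := k) (A := H) := LinearMap.ext D.S_left
  rw [this, LinearMap.lTensor_comp_apply, Coalgebra.lTensor_counit_comul]
  simp

/-- `x₍₁₎ ⊗ x₍₂₎ S(x₍₃₎) = x ⊗ 1`. -/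
theorem lTensor_mul_S_comul (x : H) :
    (TensorProduct.lift (D.mul.compl₂ D.S)).lTensor H
      (TensorProduct.assoc k H H H ((comul (R := k) (A := H)).rTensor H (comul (R := k) x))) =
      x ⊗ₜ D.one := by
  rw [Coalgebra.coassoc_apply, ← LinearMap.lTensor_comp_apply]
  have : TensorProduct.lift (D.mul.compl₂ D.S) ∘ₗ comul (R := k) (A := H) =
      LinearMap.toSpanSingleton k H D.one ∘ₗ counit (R := k) (A := H) := LinearMap.ext D.S_right
  rw [this, LinearMap.lTensor_comp_apply, Coalgebra.lTensor_counit_comul]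
  simp

theorem can_injective : Function.Injective D.can := by
  obtain ⟨u, hu⟩ := D.π.exists_rightInverse_of_surjective (LinearMap.range_eq_top.2 D.π_surjective)
  have h1 : ∀ t : H ⊗[k] H, D.canInvAux (u.rTensor H (D.π.rTensor H t)) = D.canInvAux t := fun t => by
    induction t with
    | zero => simp
    | add x y hx hy => simp only [map_add, hx, hy]
    | tmul x h =>
      rw [← sub_eq_zero, ← map_sub, LinearMap.rTensor_tmul, LinearMap.rTensor_tmul,
        ← TensorProduct.sub_tmul]
      refine D.canInvAux_eq_zero _ _ ?_
      rw [map_sub, sub_eq_zero]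
      exact LinearMap.congr_fun hu (D.π x)
  have h2 : (D.canInvAux ∘ₗ u.rTensor H) ∘ₗ D.can = LinearMap.id := by
    refine Bal.hom_ext fun x h => ?_
    have h3 : D.mulAmp C (D.coactLeft x ⊗ₜ h) =
        D.π.rTensor H ((D.mul.flip h).lTensor H (comul (R := k) x)) := by
      rw [coactLeft, LinearMap.comp_apply]
      generalize comul (R := k) x = t
      induction t with
      | zero => simp
      | add x y hx hy => simp only [map_add, TensorProduct.add_tmul, hx, hy]
      | tmul v x => simp
    rw [LinearMap.comp_apply, LinearMap.comp_apply, can_mk, h3, h1]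
    have h4 : ∀ t : H ⊗[k] H, D.canInvAux ((D.mul.flip h).lTensor H t) =
        Bal.mk _ _ ((D.mul.flip h).lTensor H ((TensorProduct.lift (D.mul ∘ₗ D.S)).lTensor H
          (TensorProduct.assoc k H H H ((comul (R := k) (A := H)).rTensor H t)))) := fun t => by
      induction t with
      | zero => simp
      | add x y hx hy => simp only [map_add, hx, hy]
      | tmul p q =>
        rw [LinearMap.lTensor_tmul, canInvAux_tmul, LinearMap.rTensor_tmul]
        generalize comul (R := k) p = t
        induction t with
        | zero => simp
        | add x y hx hy => simp only [map_add, TensorProduct.add_tmul, hx, hy]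
        | tmul v x => simp [D.mul_assoc]
    rw [h4, lTensor_S_mul_comul]
    simp [D.one_mul]
  exact Function.LeftInverse.injective (g := D.canInvAux ∘ₗ u.rTensor H) (LinearMap.congr_fun h2)

theorem can_canInvAux (x h : H) : D.can (D.canInvAux (x ⊗ₜ h)) = D.π x ⊗ₜ h := by
  rw [canInvAux_tmul]
  have h1 : ∀ t : H ⊗[k] H, D.can (Bal.mk _ _ ((D.mul.flip h ∘ₗ D.S).lTensor H t)) =
      TensorProduct.map D.π (D.mul.flip h) ((TensorProduct.lift (D.mul.compl₂ D.S)).lTensor H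
        (TensorProduct.assoc k H H H ((comul (R := k) (A := H)).rTensor H t))) := fun t => by
    induction t with
    | zero => simp
    | add x y hx hy => simp only [map_add, hx, hy]
    | tmul p q =>
      rw [LinearMap.lTensor_tmul, can_mk, coactLeft, LinearMap.rTensor_tmul, LinearMap.comp_apply]
      generalize comul (R := k) p = t
      induction t with
      | zero => simp
      | add x y hx hy => simp only [map_add, TensorProduct.add_tmul, hx, hy]
      | tmul v x => simp [D.mul_assoc]
  rw [h1, lTensor_mul_S_comul]
  simp [D.one_mul]

theorem can_bijective : Function.Bijective D.can := by
  refine ⟨D.can_injective, fun t => ?_⟩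
  induction t with
  | zero => exact ⟨0, map_zero _⟩
  | add x y hx hy =>
    obtain ⟨a, rfl⟩ := hx
    obtain ⟨b, rfl⟩ := hy
    exact ⟨a + b, map_add _ _ _⟩
  | tmul c h =>
    obtain ⟨x, rfl⟩ := D.π_surjective c
    exact ⟨_, D.can_canInvAux x h⟩

theorem intertwines_mul_right (h : H) : Intertwines D.lmul D.lmul (D.mul.flip h) :=
  fun a x => by simp [D.mul_assoc]

/-- For a right `L`-module `N`, the map `N → N ⊗_L H`, `n ↦ n ⊗ 1`, is injective: tensoring its
kernel with `H` gives zero. -/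
theorem mk_one_injective {α : L →ₗ[k] Module.End k N} (hα : IsRightAct D.mulL D.oneL α) :
    Function.Injective (Bal.mk α D.lmul ∘ₗ (TensorProduct.mk k N H).flip D.one) := by
  set f := Bal.mk α D.lmul ∘ₗ (TensorProduct.mk k N H).flip D.one with hf
  have h0 : ∀ n ∈ LinearMap.ker f, ∀ x, Bal.mk α D.lmul (n ⊗ₜ x) = 0 := by
    intro n hn x
    have h1 := congrArg (Bal.map LinearMap.id (D.mul.flip x) (Intertwines.id α)
      (D.intertwines_mul_right x)) (LinearMap.mem_ker.1 hn)
    simpa [hf, D.one_mul] using h1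
  have hK : ∀ r, ∀ x ∈ LinearMap.ker f, α r x ∈ LinearMap.ker f := by
    intro r n hn
    rw [LinearMap.mem_ker]
    exact (Bal.mk_act n r D.one).trans (h0 n hn _)
  have h2 := D.left_flat (hα.restrict _ hK) hα (LinearMap.ker f).subtype
    (Intertwines.subtype _ _) (LinearMap.ker f).injective_subtype
  have h3 : Subsingleton (Bal (restrictAct α _ hK) D.lmul) := by
    refine subsingleton_of_forall_eq 0 fun z => h2 ?_
    rw [map_zero]
    have : Bal.map (LinearMap.ker f).subtype LinearMap.id (Intertwines.subtype _ hK)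
        (Intertwines.id D.lmul) = 0 := Bal.hom_ext fun n x => h0 n n.2 x
    exact LinearMap.congr_fun this z
  have h4 := D.left_faithful (hα.restrict _ hK) h3
  rw [← LinearMap.ker_eq_bot, Submodule.eq_bot_iff]
  intro n hn
  exact congrArg Subtype.val (Subsingleton.elim (⟨n, hn⟩ : LinearMap.ker f) 0)

/-- The coinvariants of `C` in `H` are the elements of `L`: if `h` is coinvariant, then
`h ⊗ 1 = 1 ⊗ h` in `H ⊗_L H`, so that the class of `h` vanishes in `(H / L) ⊗_L H`, and by faithful
flatness in `H / L`. -/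
theorem mem_range_i_of_coactLeft (h : H) (hh : D.coactLeft h = D.π D.one ⊗ₜ h) :
    h ∈ LinearMap.range D.i := by
  have hE : ∀ r, ∀ x ∈ LinearMap.range D.i, D.rmul r x ∈ LinearMap.range D.i := by
    rintro r _ ⟨a, rfl⟩
    exact ⟨D.mulL a r, by simp [D.i_mul]⟩
  have h1 : Bal.mk D.rmul D.lmul (h ⊗ₜ D.one) = Bal.mk D.rmul D.lmul (D.one ⊗ₜ h) := by
    apply D.can_injective
    rw [can_mk, can_mk, hh, coactLeft_one]
    simp [D.mul_one, D.one_mul]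
  have h2 := congrArg (Bal.map (LinearMap.range D.i).mkQ LinearMap.id
    (Intertwines.mkQ _ hE) (Intertwines.id _)) h1
  have h3 : (LinearMap.range D.i).mkQ h = 0 := by
    apply D.mk_one_injective (D.isRightAct_rmul.quot _ hE)
    rw [map_zero]
    refine h2.trans ?_
    have : (LinearMap.range D.i).mkQ D.one = 0 :=
      (Submodule.Quotient.mk_eq_zero _).2 ⟨D.oneL, D.i_one⟩
    rw [Bal.map_mk, TensorProduct.map_tmul, this, TensorProduct.zero_tmul, map_zero]
  exact (Submodule.Quotient.mk_eq_zero _).1 h3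

theorem mem_range_lTensor_i (t : V ⊗[k] H)
    (ht : D.coactLeft.lTensor V t = (TensorProduct.mk k C H (D.π D.one)).lTensor V t) :
    t ∈ LinearMap.range (D.i.lTensor V) := by
  have h1 := mem_range_lTensor_subtype_ker (C := V)
    (D.coactLeft - TensorProduct.mk k C H (D.π D.one)) t (by
      rw [LinearMap.lTensor_sub, LinearMap.sub_apply, ht, sub_self])
  obtain ⟨s, rfl⟩ := h1
  clear ht
  induction s with
  | zero => simp
  | add x y hx hy =>
    rw [map_add]
    exact add_mem hx hy
  | tmul v x =>
    obtain ⟨a, ha⟩ := D.mem_range_i_of_coactLeft x (sub_eq_zero.1 x.2)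
    exact ⟨v ⊗ₜ a, by simp [ha]⟩

/-! ### The cotensor product with `H` -/

variable (ρ : RightComodule k C V)

theorem intertwines_cotensorDiff : Intertwines (ampAct V D.rmul) (ampAct V (ampAct C D.rmul))
    (cotensorDiff ρ D.coactLeft) :=
  (intertwines_assoc_rTensor ρ.coact D.rmul).sub (D.intertwines_coactLeft.lTensor V)

/-- The cotensor product `V □_C H`, a right `L`-module. -/
abbrev cot : Submodule k (V ⊗[k] H) := LinearMap.ker (cotensorDiff ρ D.coactLeft)

/-- The right action of `L` on `V □_C H`. -/
abbrev cotAct : L →ₗ[k] Module.End k (D.cot ρ) :=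
  restrictAct (ampAct V D.rmul) _ (D.intertwines_cotensorDiff ρ).mem_ker

theorem isRightAct_cotAct : IsRightAct D.mulL D.oneL (D.cotAct ρ) :=
  (D.isRightAct_rmul.amp V).restrict _ _

/-- The map `(V □_C H) ⊗_L H → V ⊗ H`, `(v ⊗ x) ⊗ h ↦ v ⊗ x h`. -/
def cotMul : Bal (D.cotAct ρ) D.lmul →ₗ[k] V ⊗[k] H :=
  Bal.lift (D.mulAmp V ∘ₗ (D.cot ρ).subtype.rTensor H) fun t a h => by
    simp only [LinearMap.comp_apply, LinearMap.rTensor_tmul]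
    exact D.mulAmp_balanced _ _ _

theorem cotMul_mk (t : D.cot ρ) (h : H) :
    D.cotMul ρ (Bal.mk _ _ (t ⊗ₜ h)) = D.mulAmp V ((t : V ⊗[k] H) ⊗ₜ h) := rfl

variable (V) in
/-- The isomorphism `(V ⊗ H) ⊗_L H ≃ V ⊗ (C ⊗ H)` obtained from the canonical one. -/
def canAmp : Bal (ampAct V D.rmul) D.lmul ≃ₗ[k] V ⊗[k] (C ⊗[k] H) :=
  (Bal.ampEquiv V D.rmul D.lmul).symm ≪≫ₗ (LinearEquiv.ofBijective D.can D.can_bijective).lTensor V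

theorem canAmp_mk (t : V ⊗[k] H) (h : H) : D.canAmp V (Bal.mk _ _ (t ⊗ₜ h)) =
    ampAct V (ampAct C D.mul.flip) h (D.coactLeft.lTensor V t) := by
  induction t with
  | zero => simp
  | add x y hx hy => simp only [map_add, TensorProduct.add_tmul, hx, hy]
  | tmul v x =>
    simp [canAmp, can_mk]
    rfl

theorem canAmp_map_subtype (z : Bal (D.cotAct ρ) D.lmul) :
    D.canAmp V (Bal.map (D.cot ρ).subtype LinearMap.id (Intertwines.subtype _ _)
      (Intertwines.id _) z) = TensorProduct.assoc k V C H (ρ.coact.rTensor H (D.cotMul ρ z)) := by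
  obtain ⟨t, rfl⟩ := Bal.mk_surjective z
  induction t with
  | zero => simp
  | add x y hx hy => simp only [map_add, hx, hy]
  | tmul t h =>
    rw [Bal.map_mk, TensorProduct.map_tmul, canAmp_mk, cotMul_mk, LinearMap.id_apply,
      Submodule.subtype_apply, ← mem_ker_cotensorDiff.1 t.2]
    exact ((intertwines_assoc_rTensor ρ.coact D.mul.flip) h t).symm

theorem cotMul_injective : Function.Injective (D.cotMul ρ) := by
  intro x y hxy
  apply D.left_flat (D.isRightAct_cotAct ρ) (D.isRightAct_rmul.amp V) (D.cot ρ).subtype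
    (Intertwines.subtype _ _) (D.cot ρ).injective_subtype
  apply (D.canAmp V).injective
  rw [canAmp_map_subtype, canAmp_map_subtype, hxy]

theorem lTensor_canAmp_ampEquiv_symm (t : V ⊗[k] (C ⊗[k] H)) (h : H) :
    (D.canAmp C).toLinearMap.lTensor V
      ((Bal.ampEquiv V (ampAct C D.rmul) D.lmul).symm (Bal.mk _ _ (t ⊗ₜ h))) =
    ampAct V (ampAct C (ampAct C D.mul.flip)) h ((D.coactLeft.lTensor C).lTensor V t) := by
  induction t with
  | zero => simp
  | add x y hx hy => simp only [map_add, TensorProduct.add_tmul, hx, hy]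
  | tmul v t => simp [canAmp_mk]

/-- Since `H` is flat over `L`, the functor `? ⊗_L H` preserves the kernel `V □_C H`; by the canonical
isomorphism this kernel becomes `V □_C (C ⊗ H)`, which is the image of `V ⊗ H` under the coaction. -/
theorem cotMul_surjective : Function.Surjective (D.cotMul ρ) := by
  intro w
  obtain ⟨z, hz⟩ := (D.canAmp V).surjective (TensorProduct.assoc k V C H (ρ.coact.rTensor H w))
  -- After the identification `canAmp`, the two coactions compared by `cotensorDiff` become
  -- the coaction of `V` and the comultiplication of `C`.
  have h1 : ∀ z : Bal (ampAct V D.rmul) D.lmul,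
      (D.canAmp C).toLinearMap.lTensor V ((Bal.ampEquiv V (ampAct C D.rmul) D.lmul).symm
        (Bal.map (cotensorDiff ρ D.coactLeft) LinearMap.id (D.intertwines_cotensorDiff ρ)
          (Intertwines.id _) z)) =
      TensorProduct.assoc k V C (C ⊗[k] H) (ρ.coact.rTensor (C ⊗[k] H) (D.canAmp V z)) -
        ((TensorProduct.assoc k C C H).toLinearMap ∘ₗ
          (comul (R := k) (A := C)).rTensor H).lTensor V (D.canAmp V z) := fun z => by
    obtain ⟨t, rfl⟩ := Bal.mk_surjective z
    induction t with
    | zero => simp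
    | add x y hx hy =>
      simp only [map_add, hx, hy]
      abel
    | tmul t h =>
      rw [Bal.map_mk, TensorProduct.map_tmul, lTensor_canAmp_ampEquiv_symm, canAmp_mk]
      induction t with
      | zero => simp
      | add x y hx hy =>
        simp only [map_add, hx, hy]
        abel
      | tmul v x =>
        simp only [cotensorDiff, LinearMap.sub_apply, LinearMap.comp_apply, map_sub,
          LinearMap.rTensor_tmul, LinearMap.lTensor_tmul, LinearEquiv.coe_coe, ampAct_tmul,
          LinearMap.id_apply]
        congr 1
        · generalize ρ.coact v = s
          induction s with
          | zero => simp
          | add x y hx hy => simp only [map_add, TensorProduct.add_tmul, hx, hy]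
          | tmul v c => simp
        · rw [← D.coactLeft_coassoc]
          congr 1
          exact ((intertwines_assoc_rTensor (comul (R := k) (A := C)) D.mul.flip) h _).symm
  obtain ⟨z₀, rfl⟩ := Bal.exists_ker_of_map_eq_zero (D.intertwines_cotensorDiff ρ)
    (D.left_flat ((((D.isRightAct_rmul.amp C).amp V)).restrict _ _)
      ((D.isRightAct_rmul.amp C).amp V) _ _ (Submodule.injective_subtype _)) z (by
      apply (Bal.ampEquiv V (ampAct C D.rmul) D.lmul).symm.injective
      apply ((D.canAmp C).lTensor V).injective
      refine (h1 z).trans ?_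
      rw [hz, map_zero, map_zero, sub_eq_zero]
      exact ρ.assoc_coact_rTensor w)
  refine ⟨z₀, ρ.coact_rTensor_injective ((TensorProduct.assoc k V C H).injective ?_)⟩
  rw [canAmp_map_subtype] at hz
  exact hz

end CoidealDatum

/-! ### Passing between left and right comodules -/

section LeftRight

variable {k C E V N : Type u} [Field k] [AddCommGroup C] [Module k C] [Coalgebra k C]
  [AddCommGroup E] [Module k E] [Coalgebra k E] [AddCommGroup V] [Module k V]
  [AddCommGroup N] [Module k N]

/-- A left comodule as a right comodule over a coalgebra `E` which is anti-isomorphic to `C`. -/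
def LeftComodule.toRight (f : C ≃ₗ[k] E) (hf : ∀ c, comul (R := k) (f c) =
      TensorProduct.map f.toLinearMap f.toLinearMap (TensorProduct.comm k C C (comul (R := k) c)))
    (hf' : ∀ c, counit (R := k) (f c) = counit (R := k) c) (ν : LeftComodule k C V) :
    RightComodule k E V where
  coact := f.toLinearMap.lTensor V ∘ₗ (TensorProduct.comm k C V).toLinearMap ∘ₗ ν.coact
  coassoc := by
    ext v
    have h1 : ∀ t : C ⊗[k] V, TensorProduct.assoc k V E E
        ((f.toLinearMap.lTensor V ∘ₗ (TensorProduct.comm k C V).toLinearMap ∘ₗ ν.coact).rTensor E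
          (f.toLinearMap.lTensor V (TensorProduct.comm k C V t))) =
        (TensorProduct.map f.toLinearMap f.toLinearMap ∘ₗ
          (TensorProduct.comm k C C).toLinearMap).lTensor V (TensorProduct.comm k (C ⊗[k] C) V
            ((TensorProduct.assoc k C C V).symm (ν.coact.lTensor C t))) := fun t => by
      induction t with
      | zero => simp
      | add x y hx hy => simp only [map_add, hx, hy]
      | tmul c x =>
        simp only [LinearMap.lTensor_tmul, LinearMap.rTensor_tmul, TensorProduct.comm_tmul,
          LinearMap.comp_apply, LinearEquiv.coe_coe]
        generalize ν.coact x = s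
        induction s with
        | zero => simp
        | add x y hx hy => simp only [map_add, TensorProduct.add_tmul, TensorProduct.tmul_add,
            hx, hy]
        | tmul d y => simp
    have h2 : ∀ t : C ⊗[k] V, (comul (R := k) (A := E)).lTensor V
          (f.toLinearMap.lTensor V (TensorProduct.comm k C V t)) =
        (TensorProduct.map f.toLinearMap f.toLinearMap ∘ₗ
          (TensorProduct.comm k C C).toLinearMap).lTensor V (TensorProduct.comm k (C ⊗[k] C) V
            ((comul (R := k) (A := C)).rTensor V t)) := fun t => by
      induction t with
      | zero => simp
      | add x y hx hy => simp only [map_add, hx, hy]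
      | tmul c x => simp [hf]
    have h3 : TensorProduct.assoc k C C V ((comul (R := k) (A := C)).rTensor V (ν.coact v)) =
      ν.coact.lTensor C (ν.coact v) := LinearMap.congr_fun ν.coassoc v
    have h4 := h1 (ν.coact v)
    rw [← h3, LinearEquiv.symm_apply_apply, ← h2] at h4
    exact h4
  counit_coact := by
    ext v
    have h1 : ∀ t : C ⊗[k] V, (counit (R := k) (A := E)).lTensor V
          (f.toLinearMap.lTensor V (TensorProduct.comm k C V t)) =
        TensorProduct.comm k k V ((counit (R := k) (A := C)).rTensor V t) := fun t => by
      induction t with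
      | zero => simp
      | add x y hx hy => simp only [map_add, hx, hy]
      | tmul c x => simp [hf']
    have h3 : (counit (R := k) (A := C)).rTensor V (ν.coact v) = 1 ⊗ₜ v :=
      LinearMap.congr_fun ν.counit_coact v
    exact (h1 _).trans (by rw [h3]; rfl)

namespace RightComodule

variable (V) in
/-- The comodule `V ⊗ N`, for a vector space `V` and a comodule `N`. -/
def amp (ρ : RightComodule k C N) : RightComodule k C (V ⊗[k] N) where
  coact := (TensorProduct.assoc k V N C).symm.toLinearMap ∘ₗ ρ.coact.lTensor V
  coassoc := by
    refine TensorProduct.ext' fun v n => ?_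
    have h1 : ∀ t : N ⊗[k] C, TensorProduct.assoc k (V ⊗[k] N) C C
        (((TensorProduct.assoc k V N C).symm.toLinearMap ∘ₗ ρ.coact.lTensor V).rTensor C
          ((TensorProduct.assoc k V N C).symm (v ⊗ₜ t))) =
        (TensorProduct.assoc k V N (C ⊗[k] C)).symm
          (v ⊗ₜ TensorProduct.assoc k N C C (ρ.coact.rTensor C t)) := fun t => by
      induction t with
      | zero => simp
      | add x y hx hy => simp only [map_add, TensorProduct.tmul_add, hx, hy]
      | tmul n c =>
        simp only [LinearMap.lTensor_tmul, LinearMap.rTensor_tmul, TensorProduct.assoc_symm_tmul,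
          LinearMap.comp_apply, LinearEquiv.coe_coe]
        generalize ρ.coact n = s
        induction s with
        | zero => simp
        | add x y hx hy => simp only [map_add, TensorProduct.add_tmul, TensorProduct.tmul_add,
            hx, hy]
        | tmul d y => simp
    refine (h1 (ρ.coact n)).trans ?_
    rw [ρ.coassoc_apply]
    simp only [LinearMap.comp_apply, LinearMap.lTensor_tmul, LinearEquiv.coe_coe]
    generalize ρ.coact n = s
    induction s with
    | zero => simp
    | add x y hx hy => simp only [map_add, TensorProduct.tmul_add, hx, hy]
    | tmul d y =>
      simp only [LinearMap.lTensor_tmul, TensorProduct.assoc_symm_tmul]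
  counit_coact := by
    refine TensorProduct.ext' fun v n => ?_
    have h1 : ∀ t : N ⊗[k] C, (counit (R := k) (A := C)).lTensor (V ⊗[k] N)
          ((TensorProduct.assoc k V N C).symm (v ⊗ₜ t)) =
        (TensorProduct.assoc k V N k).symm
          (v ⊗ₜ (counit (R := k) (A := C)).lTensor N t) := fun t => by
      induction t with
      | zero => simp
      | add x y hx hy => simp only [map_add, TensorProduct.tmul_add, hx, hy]
      | tmul n c => simp
    refine (h1 (ρ.coact n)).trans ?_
    rw [ρ.counit_apply]
    simp

theorem amp_coact_tmul (ρ : RightComodule k C N) (v : V) (n : N) :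
    (ρ.amp V).coact (v ⊗ₜ n) = (TensorProduct.assoc k V N C).symm (v ⊗ₜ ρ.coact n) := rfl

theorem IsCoflat.amp {ρ : RightComodule k C N} (hρ : ρ.IsCoflat) : (ρ.amp V).IsCoflat := by
  intro X Y _ _ _ _ σ τ f hf hs t ht
  -- Interchanging factors, the cotensor product with `V ⊗ N` is `V` tensored with the one with `N`.
  have key : ∀ {Z : Type u} [AddCommGroup Z] [Module k Z] (τ : RightComodule k (Cop C) Z)
      (t : Z ⊗[k] (V ⊗[k] N)), (TensorProduct.leftComm k (Cop C) V N).toLinearMap.lTensor Z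
        (cotensorDiff τ (ρ.amp V).leftCoact t) = TensorProduct.leftComm k V Z (Cop C ⊗[k] N)
          ((cotensorDiff τ ρ.leftCoact).lTensor V (TensorProduct.leftComm k Z V N t)) := by
    intro Z _ _ τ t
    have h1 : ∀ t : Z ⊗[k] (V ⊗[k] N),
        (TensorProduct.leftComm k (Cop C) V N).toLinearMap.lTensor Z
          ((ρ.amp V).leftCoact.lTensor Z t) = TensorProduct.leftComm k V Z (Cop C ⊗[k] N)
            ((ρ.leftCoact.lTensor Z).lTensor V (TensorProduct.leftComm k Z V N t)) := fun t => by
      induction t with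
      | zero => simp
      | add x y hx hy => simp only [map_add, hx, hy]
      | tmul z t =>
        induction t with
        | zero => simp
        | add x y hx hy => simp only [map_add, TensorProduct.tmul_add, hx, hy]
        | tmul v n =>
          simp only [LinearMap.lTensor_tmul, TensorProduct.leftComm_tmul, leftCoact,
            LinearMap.comp_apply, amp_coact_tmul, LinearEquiv.coe_coe]
          generalize ρ.coact n = s
          induction s with
          | zero => simp
          | add x y hx hy => simp only [map_add, TensorProduct.tmul_add, hx, hy]
          | tmul m c => simp
    have h2 : ∀ t : Z ⊗[k] (V ⊗[k] N),
        (TensorProduct.leftComm k (Cop C) V N).toLinearMap.lTensor Z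
          (TensorProduct.assoc k Z (Cop C) (V ⊗[k] N) (τ.coact.rTensor (V ⊗[k] N) t)) =
          TensorProduct.leftComm k V Z (Cop C ⊗[k] N)
            (((TensorProduct.assoc k Z (Cop C) N).toLinearMap ∘ₗ τ.coact.rTensor N).lTensor V
              (TensorProduct.leftComm k Z V N t)) := fun t => by
      induction t with
      | zero => simp
      | add x y hx hy => simp only [map_add, hx, hy]
      | tmul z t =>
        induction t with
        | zero => simp
        | add x y hx hy => simp only [map_add, TensorProduct.tmul_add, hx, hy]
        | tmul v n =>
          simp only [LinearMap.rTensor_tmul, LinearMap.lTensor_tmul, TensorProduct.leftComm_tmul,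
            LinearMap.comp_apply, LinearEquiv.coe_coe]
          generalize τ.coact z = s
          induction s with
          | zero => simp
          | add x y hx hy => simp only [map_add, TensorProduct.add_tmul, TensorProduct.tmul_add,
              hx, hy]
          | tmul m c => simp
    simp only [cotensorDiff, LinearMap.sub_apply, LinearMap.lTensor_sub, map_sub,
      LinearMap.comp_apply, LinearEquiv.coe_coe] at h1 h2 ⊢
    rw [h1, h2]
  have hk : (cotensorDiff τ ρ.leftCoact).lTensor V (TensorProduct.leftComm k Y V N t) = 0 := by
    rw [← (TensorProduct.leftComm k V Y (Cop C ⊗[k] N)).map_eq_zero_iff, ← key,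
      LinearMap.mem_ker.1 ht, map_zero]
  obtain ⟨s, hs'⟩ := mem_range_lTensor_subtype_ker _ _ hk
  have h3 : ∃ w ∈ LinearMap.range
      ((LinearMap.ker (cotensorDiff σ ρ.leftCoact)).subtype.lTensor V),
      (f.rTensor N).lTensor V w = TensorProduct.leftComm k Y V N t := by
    rw [← hs']
    clear hs'
    induction s with
    | zero => exact ⟨0, zero_mem _, by simp⟩
    | add x y hx hy =>
      obtain ⟨a, ha, ha'⟩ := hx
      obtain ⟨b, hb, hb'⟩ := hy
      exact ⟨a + b, add_mem ha hb, by rw [map_add, map_add, ha', hb']⟩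
    | tmul v y =>
      obtain ⟨x, hx, hxy⟩ := hρ _ _ σ τ f hf hs y y.2
      exact ⟨v ⊗ₜ x, ⟨v ⊗ₜ ⟨x, hx⟩, rfl⟩, by simp [hxy]⟩
  obtain ⟨_, ⟨w, rfl⟩, hw⟩ := h3
  refine ⟨(TensorProduct.leftComm k X V N).symm
    ((LinearMap.ker (cotensorDiff σ ρ.leftCoact)).subtype.lTensor V w), ?_, ?_⟩
  · rw [LinearMap.mem_ker]
    apply ((TensorProduct.leftComm k (Cop C) V N).lTensor X).injective
    refine (key σ _).trans ?_
    rw [LinearEquiv.apply_symm_apply, ← LinearMap.lTensor_comp_apply, LinearMap.comp_ker_subtype]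
    simp
  · apply (TensorProduct.leftComm k Y V N).injective
    rw [← hw]
    generalize (LinearMap.ker (cotensorDiff σ ρ.leftCoact)).subtype.lTensor V w = u
    obtain ⟨u, rfl⟩ := (TensorProduct.leftComm k X V N).surjective u
    rw [LinearEquiv.symm_apply_apply]
    induction u with
    | zero => simp
    | add x y hx hy => simp only [map_add, hx, hy]
    | tmul z t =>
      induction t with
      | zero => simp
      | add x y hx hy => simp only [map_add, TensorProduct.tmul_add, hx, hy]
      | tmul v n => simp

end RightComodule

end LeftRight

namespace CoidealDatum

variable {k H L C : Type u} [Field k] [AddCommGroup H] [Module k H] [Coalgebra k H]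
    [AddCommGroup L] [Module k L] [AddCommGroup C] [Module k C] [Coalgebra k C]
variable (D : CoidealDatum k H L C)
variable {V W N Y : Type u} [AddCommGroup V] [Module k V] [AddCommGroup W] [Module k W]
  [AddCommGroup N] [Module k N] [AddCommGroup Y] [Module k Y]

/-- Faithful flatness of `H` implies that the functor `V ↦ V □_C H` is right exact. -/
theorem cot_surjective {ρ : RightComodule k C V} {σ : RightComodule k C W} {f : V →ₗ[k] W}
    (hf : ρ.IsHom σ f) (hs : Function.Surjective f) (t : W ⊗[k] H) (ht : t ∈ D.cot σ) :
    ∃ s ∈ D.cot ρ, f.rTensor H s = t := by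
  have hg : ∀ x ∈ D.cot ρ, f.rTensor H x ∈ D.cot σ := fun x hx => by
    rw [LinearMap.mem_ker] at hx ⊢
    rw [cotensorDiff_natural hf, hx, map_zero]
  set g : D.cot ρ →ₗ[k] D.cot σ := (f.rTensor H).restrict hg
  have hgi : Intertwines (D.cotAct ρ) (D.cotAct σ) g := fun r x =>
    Subtype.ext (Intertwines.rTensor D.rmul f r x)
  have h1 : Subsingleton (Bal (quotAct (D.cotAct σ) _ hgi.mem_range) D.lmul) := by
    refine subsingleton_of_forall_eq 0 fun z => ?_
    have hq : Function.Surjective (Bal.map (LinearMap.range g).mkQ LinearMap.id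
        (Intertwines.mkQ _ hgi.mem_range) (Intertwines.id D.lmul)) := by
      intro z
      obtain ⟨t, rfl⟩ := Bal.mk_surjective z
      obtain ⟨t, rfl⟩ := LinearMap.rTensor_surjective H (Submodule.mkQ_surjective _) t
      exact ⟨Bal.mk _ _ t, rfl⟩
    obtain ⟨z, rfl⟩ := hq z
    obtain ⟨w, hw⟩ := LinearMap.rTensor_surjective H hs (D.cotMul σ z)
    obtain ⟨z', rfl⟩ := D.cotMul_surjective ρ w
    have h2 : Bal.map g LinearMap.id hgi (Intertwines.id D.lmul) z' = z := by
      apply D.cotMul_injective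
      rw [← hw]
      obtain ⟨t, rfl⟩ := Bal.mk_surjective z'
      clear hw
      induction t with
      | zero => simp
      | add x y hx hy => simp only [map_add, hx, hy]
      | tmul x h => exact D.mulAmp_natural f ((x : V ⊗[k] H) ⊗ₜ h)
    rw [← h2]
    obtain ⟨t, rfl⟩ := Bal.mk_surjective z'
    have h3 : TensorProduct.map (LinearMap.range g).mkQ LinearMap.id
        (TensorProduct.map g LinearMap.id t) =
        TensorProduct.map ((LinearMap.range g).mkQ ∘ₗ g) (LinearMap.id ∘ₗ LinearMap.id) t := by
      rw [TensorProduct.map_comp]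
      rfl
    rw [Bal.map_mk, Bal.map_mk, h3, LinearMap.range_mkQ_comp, TensorProduct.map_zero_left]
    simp
  have h2 := D.left_faithful ((D.isRightAct_cotAct σ).quot _ _) h1
  have h3 : (LinearMap.range g).mkQ ⟨t, ht⟩ = 0 := Subsingleton.elim _ _
  obtain ⟨s, hs⟩ := (Submodule.Quotient.mk_eq_zero _).1 h3
  exact ⟨s, s.2, congrArg Subtype.val hs⟩

/-- The left `C`-comodule `H` over the factor coalgebra. -/
def leftComodule : LeftComodule k C H where
  coact := D.coactLeft
  coassoc := LinearMap.ext D.coactLeft_coassoc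
  counit_coact := LinearMap.ext D.coactLeft_counit

/-- The right `C`-comodule `H` with the coaction `h ↦ h₍₂₎ ⊗ π(T(h₍₁₎))`. -/
def rightComodule : RightComodule k C H :=
  D.mirror.leftComodule.toRight (toCop k C).symm (hf := fun c => by
    obtain ⟨c, rfl⟩ := (toCop k C).surjective c
    rw [comul_toCop, LinearEquiv.symm_apply_apply]
    generalize comul (R := k) c = t
    induction t with
    | zero => simp
    | add x y hx hy => simp only [map_add, ← hx, ← hy]
    | tmul a b => simp [toCop₂]) (hf' := by exact fun c => rfl)

theorem rightComodule_coact (h : H) : D.rightComodule.coact h =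
    (D.π ∘ₗ D.T).lTensor H (TensorProduct.comm k H H (comul (R := k) h)) := by
  change (toCop k C).symm.toLinearMap.lTensor H (TensorProduct.comm k (Cop C) H
    (((toCop k C).toLinearMap ∘ₗ D.π ∘ₗ D.T).rTensor H (comul (R := k) h))) = _
  generalize comul (R := k) h = t
  induction t with
  | zero => simp
  | add x y hx hy => simp only [map_add, hx, hy]
  | tmul a b => simp

theorem rightComodule_leftCoact : D.rightComodule.leftCoact = D.mirror.coactLeft := by
  ext h
  change (toCop k C).toLinearMap.rTensor H (TensorProduct.comm k H C
    ((toCop k C).symm.toLinearMap.lTensor H (TensorProduct.comm k (Cop C) H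
      (D.mirror.coactLeft h)))) = _
  generalize D.mirror.coactLeft h = t
  induction t with
  | zero => simp
  | add x y hx hy => simp only [map_add, hx, hy]
  | tmul a b => simp

/-- The left coaction belonging to `rightComodule` is the one of the mirrored datum, for which
cotensor products with `H` are right exact. -/
theorem rightComodule_isCoflat : D.rightComodule.IsCoflat := by
  intro X Y _ _ _ _ σ τ f hf hs t ht
  rw [rightComodule_leftCoact] at ht ⊢
  exact D.mirror.cot_surjective hf hs t ht

theorem rightComodule_coact_lmul (a : L) (h : H) : D.rightComodule.coact (D.lmul a h) =
    (D.lmul a).rTensor C (D.rightComodule.coact h) := by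
  change (toCop k C).symm.toLinearMap.lTensor H (TensorProduct.comm k (Cop C) H
      (D.mirror.coactLeft (D.mirror.rmul a h))) = _
  rw [D.mirror.intertwines_coactLeft]
  change _ = (D.lmul a).rTensor C ((toCop k C).symm.toLinearMap.lTensor H
    (TensorProduct.comm k (Cop C) H (D.mirror.coactLeft h)))
  generalize D.mirror.coactLeft h = t
  induction t with
  | zero => simp
  | add x y hx hy => simp only [map_add, hx, hy]
  | tmul a b => rfl

/-- The right `C`-comodule `Y ⊗_L H`, for a right `L`-module `Y`. -/
def balComodule (α : L →ₗ[k] Module.End k Y) : RightComodule k C (Bal α D.lmul) :=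
  RightComodule.ofSurjective (D.rightComodule.amp Y) (Bal.mk α D.lmul) Bal.mk_surjective
    (Bal.lift ((Bal.mk α D.lmul).rTensor C ∘ₗ (D.rightComodule.amp Y).coact) fun y a h => by
      rw [LinearMap.comp_apply, LinearMap.comp_apply, RightComodule.amp_coact_tmul,
        RightComodule.amp_coact_tmul, rightComodule_coact_lmul]
      generalize D.rightComodule.coact h = t
      induction t with
      | zero => simp
      | add x y hx hy => simp only [map_add, TensorProduct.tmul_add, hx, hy]
      | tmul x c => simp [Bal.mk_act]) (fun _ => rfl)

theorem balComodule_coact_mk (α : L →ₗ[k] Module.End k Y) (t : Y ⊗[k] H) :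
    (D.balComodule α).coact (Bal.mk _ _ t) =
      (Bal.mk α D.lmul).rTensor C ((D.rightComodule.amp Y).coact t) := rfl

theorem isHom_mk (α : L →ₗ[k] Module.End k Y) :
    (D.rightComodule.amp Y).IsHom (D.balComodule α) (Bal.mk α D.lmul) := rfl

end CoidealDatum

/-! ### Coflatness of `Y ⊗_L H` -/

section General

variable {k L C X Y W V : Type u} [Field k] [AddCommGroup L] [Module k L] [AddCommGroup C]
  [Module k C] [Coalgebra k C] [AddCommGroup X] [Module k X] [AddCommGroup Y] [Module k Y]
  [AddCommGroup W] [Module k W] [AddCommGroup V] [Module k V]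

variable (W) in
/-- The isomorphism between `W ⊗ (Y ⊗_L X)` and `(W ⊗ X) ⊗_L Y`. -/
def balSwap (α : L →ₗ[k] Module.End k Y) (β : L →ₗ[k] Module.End k X) :
    W ⊗[k] Bal α β ≃ₗ[k] Bal (ampAct W β) α :=
  (Bal.comm α β).lTensor W ≪≫ₗ Bal.ampEquiv W β α

theorem balSwap_tmul (α : L →ₗ[k] Module.End k Y) (β : L →ₗ[k] Module.End k X) (w : W) (y : Y)
    (x : X) : balSwap W α β (w ⊗ₜ Bal.mk _ _ (y ⊗ₜ x)) = Bal.mk _ _ ((w ⊗ₜ x) ⊗ₜ y) := by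
  simp [balSwap]

variable (W V) in
/-- The isomorphism between `W ⊗ (V ⊗ (Y ⊗_L X))` and `(W ⊗ (V ⊗ X)) ⊗_L Y`. -/
def balSwap₂ (α : L →ₗ[k] Module.End k Y) (β : L →ₗ[k] Module.End k X) :
    W ⊗[k] (V ⊗[k] Bal α β) ≃ₗ[k] Bal (ampAct W (ampAct V β)) α :=
  (balSwap V α β).lTensor W ≪≫ₗ Bal.ampEquiv W (ampAct V β) α

theorem balSwap₂_tmul (α : L →ₗ[k] Module.End k Y) (β : L →ₗ[k] Module.End k X) (w : W) (v : V)
    (y : Y) (x : X) : balSwap₂ W V α β (w ⊗ₜ (v ⊗ₜ Bal.mk _ _ (y ⊗ₜ x))) =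
      Bal.mk _ _ ((w ⊗ₜ (v ⊗ₜ x)) ⊗ₜ y) := by
  simp [balSwap₂, balSwap_tmul]

theorem intertwines_cotensorDiff_of {β : L →ₗ[k] Module.End k X} {μ : X →ₗ[k] C ⊗[k] X}
    (hμ : Intertwines β (ampAct C β) μ) (ω : RightComodule k C W) :
    Intertwines (ampAct W β) (ampAct W (ampAct C β)) (cotensorDiff ω μ) :=
  (intertwines_assoc_rTensor ω.coact β).sub (hμ.lTensor W)

/-- A criterion for coflatness of `Y ⊗_L X`, where `X` is a comodule such that cotensor products
with `X` are right exact: it suffices that cotensor products with `X` commute with the functor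
`Y ⊗_L ?`. -/
theorem RightComodule.isCoflat_bal {α : L →ₗ[k] Module.End k Y} {β : L →ₗ[k] Module.End k X}
    (ρ : RightComodule k C (Bal α β)) {μ : X →ₗ[k] Cop C ⊗[k] X}
    (hμ : Intertwines β (ampAct (Cop C) β) μ)
    (hρ : ∀ y x, ρ.leftCoact (Bal.mk α β (y ⊗ₜ x)) =
      (Bal.mk α β ∘ₗ TensorProduct.mk k Y X y).lTensor (Cop C) (μ x))
    (hcot : ∀ {V W : Type u} [AddCommGroup V] [Module k V] [AddCommGroup W] [Module k W]
      {σ : RightComodule k (Cop C) V} {τ : RightComodule k (Cop C) W} {f : V →ₗ[k] W}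
      (_ : σ.IsHom τ f) (_ : Function.Surjective f), ∀ t ∈ LinearMap.ker (cotensorDiff τ μ),
        ∃ s ∈ LinearMap.ker (cotensorDiff σ μ), f.rTensor X s = t)
    (hinj : ∀ (W : Type u) [AddCommGroup W] [Module k W] (ω : RightComodule k (Cop C) W),
      Function.Injective (Bal.map (α := restrictAct (ampAct W (ampAct (Cop C) β)) _
        (intertwines_cotensorDiff_of hμ ω).mem_range) (β := α)
        (LinearMap.range (cotensorDiff ω μ)).subtype LinearMap.id
        (Intertwines.subtype _ _) (Intertwines.id α))) :
    ρ.IsCoflat := by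
  intro U Z _ _ _ _ σ τ f hf hs t ht
  -- The two descriptions of the difference of coactions agree.
  have key : ∀ {W : Type u} [AddCommGroup W] [Module k W] (ω : RightComodule k (Cop C) W)
      (t : W ⊗[k] Bal α β),
      balSwap₂ W (Cop C) α β (cotensorDiff ω ρ.leftCoact t) =
      Bal.map (cotensorDiff ω μ) LinearMap.id
        (intertwines_cotensorDiff_of hμ ω) (Intertwines.id α) (balSwap W α β t) := by
    intro W _ _ ω t
    induction t with
    | zero => simp
    | add x y hx hy => simp only [map_add, hx, hy]
    | tmul w z =>
      obtain ⟨z, rfl⟩ := Bal.mk_surjective z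
      induction z with
      | zero => simp
      | add x y hx hy => simp only [map_add, TensorProduct.tmul_add, hx, hy]
      | tmul y h =>
        rw [balSwap_tmul, Bal.map_mk, TensorProduct.map_tmul]
        simp only [cotensorDiff, LinearMap.sub_apply, LinearMap.comp_apply, map_sub,
          LinearMap.rTensor_tmul, LinearMap.lTensor_tmul, LinearEquiv.coe_coe,
          TensorProduct.sub_tmul, hρ]
        congr 1
        · generalize ω.coact w = s
          induction s with
          | zero => simp
          | add x y hx hy => simp only [map_add, TensorProduct.add_tmul, hx, hy]
          | tmul w c => simp [balSwap₂_tmul]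
        · generalize μ h = s
          induction s with
          | zero => simp
          | add x y hx hy => simp only [map_add, TensorProduct.tmul_add, TensorProduct.add_tmul,
              hx, hy]
          | tmul c h => simp [balSwap₂_tmul]
  have nat : ∀ u : U ⊗[k] Bal α β, balSwap Z α β (f.rTensor (Bal α β) u) =
      Bal.map (f.rTensor X) LinearMap.id (Intertwines.rTensor _ f) (Intertwines.id α)
        (balSwap U α β u) := by
    intro u
    induction u with
    | zero => simp
    | add x y hx hy => simp only [map_add, hx, hy]
    | tmul x z =>
      obtain ⟨z, rfl⟩ := Bal.mk_surjective z
      induction z with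
      | zero => simp
      | add x y hx hy => simp only [map_add, TensorProduct.tmul_add, hx, hy]
      | tmul y h => simp [balSwap_tmul]
  obtain ⟨z₀, hz₀⟩ := Bal.exists_ker_of_map_eq_zero (intertwines_cotensorDiff_of hμ τ)
    (hinj Z τ) (balSwap Z α β t) (by
      rw [← key, LinearMap.mem_ker.1 ht, map_zero])
  obtain ⟨z₀, rfl⟩ := Bal.mk_surjective z₀
  have hex : ∃ u : LinearMap.ker (cotensorDiff σ μ) ⊗[k] Y,
      ((f.rTensor X) ∘ₗ (LinearMap.ker (cotensorDiff σ μ)).subtype).rTensor Y u =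
        (LinearMap.ker (cotensorDiff τ μ)).subtype.rTensor Y z₀ := by
    clear hz₀
    induction z₀ with
    | zero => exact ⟨0, by simp⟩
    | add x y hx hy =>
      obtain ⟨a, ha⟩ := hx
      obtain ⟨b, hb⟩ := hy
      exact ⟨a + b, by rw [map_add, map_add, ha, hb]⟩
    | tmul x y =>
      obtain ⟨w, hw, hwx⟩ := hcot hf hs x x.2
      exact ⟨⟨w, hw⟩ ⊗ₜ y, by simp [hwx]⟩
  obtain ⟨u, hu⟩ := hex
  set v : Bal (ampAct U β) α :=
    Bal.mk _ α ((LinearMap.ker (cotensorDiff σ μ)).subtype.rTensor Y u) with hv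
  have hu0 : Bal.map (cotensorDiff σ μ) LinearMap.id
      (intertwines_cotensorDiff_of hμ σ) (Intertwines.id α) v = 0 := by
    rw [hv, Bal.map_mk]
    have : TensorProduct.map (cotensorDiff σ μ) LinearMap.id
        ((LinearMap.ker (cotensorDiff σ μ)).subtype.rTensor Y u) = 0 := by
      change (cotensorDiff σ μ).rTensor Y _ = 0
      rw [← LinearMap.rTensor_comp_apply, LinearMap.comp_ker_subtype, LinearMap.rTensor_zero]
      rfl
    rw [this, map_zero]
  refine ⟨(balSwap U α β).symm v, ?_, ?_⟩
  · rw [LinearMap.mem_ker]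
    apply (balSwap₂ U (Cop C) α β).injective
    rw [key, LinearEquiv.apply_symm_apply, hu0, map_zero]
  · apply (balSwap Z α β).injective
    rw [nat, LinearEquiv.apply_symm_apply, ← hz₀, hv, Bal.map_mk, Bal.map_mk]
    congr 1
    refine Eq.trans ?_ hu
    rw [LinearMap.rTensor_comp_apply]
    rfl

end General

namespace CoidealDatum

variable {k H L C : Type u} [Field k] [AddCommGroup H] [Module k H] [Coalgebra k H]
    [AddCommGroup L] [Module k L] [AddCommGroup C] [Module k C] [Coalgebra k C]
variable (D : CoidealDatum k H L C)
variable {V W N Y : Type u} [AddCommGroup V] [Module k V] [AddCommGroup W] [Module k W]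
  [AddCommGroup N] [Module k N] [AddCommGroup Y] [Module k Y]

theorem balComodule_leftCoact_mk (α : L →ₗ[k] Module.End k Y) (y : Y) (h : H) :
    (D.balComodule α).leftCoact (Bal.mk _ _ (y ⊗ₜ h)) =
      (Bal.mk α D.lmul ∘ₗ TensorProduct.mk k Y H y).lTensor (Cop C) (D.mirror.coactLeft h) := by
  rw [← rightComodule_leftCoact]
  simp only [RightComodule.leftCoact, LinearMap.comp_apply, balComodule_coact_mk,
    RightComodule.amp_coact_tmul, LinearEquiv.coe_coe]
  generalize D.rightComodule.coact h = s
  induction s with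
  | zero => simp
  | add x y hx hy => simp only [map_add, TensorProduct.tmul_add, hx, hy]
  | tmul x c => simp

/-- If the functor `Y ⊗_L ?` preserves injectivity of the inclusions of the ranges of the maps
defining the cotensor products `W □ H`, then `Y ⊗_L H` is coflat. -/
theorem balComodule_isCoflat (α : L →ₗ[k] Module.End k Y)
    (hinj : ∀ (W : Type u) [AddCommGroup W] [Module k W] (ω : RightComodule k (Cop C) W),
      Function.Injective (Bal.map (α := restrictAct (ampAct W (ampAct (Cop C) D.mirror.rmul)) _
        (D.mirror.intertwines_cotensorDiff ω).mem_range) (β := α)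
        (LinearMap.range (cotensorDiff ω D.mirror.coactLeft)).subtype LinearMap.id
        (Intertwines.subtype _ _) (Intertwines.id α))) :
    (D.balComodule α).IsCoflat :=
  RightComodule.isCoflat_bal (D.balComodule α) D.mirror.intertwines_coactLeft
    (D.balComodule_leftCoact_mk α) D.mirror.cot_surjective hinj

/-! ### Hopf modules as retracts -/

/-- The left `H`-module and right `C`-comodule `N` is a Hopf module, an object of `_H𝓜^C`:
`ρ(h n) = h₍₁₎ n₍₀₎ ⊗ h₍₂₎ n₍₁₎`. -/
structure IsHopf (ν : H →ₗ[k] Module.End k N) (ρ : RightComodule k C N) : Prop where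
  isAct : IsRightAct D.mul.flip D.one ν
  coact_act : ∀ h n, ρ.coact (ν h n) = actMap ν D.act (comul (R := k) h) (ρ.coact n)

/-- Each Hopf module is injective as a comodule. -/
def AllInjective : Prop :=
  ∀ (N : Type u) [AddCommGroup N] [Module k N] (ν : H →ₗ[k] Module.End k N)
    (ρ : RightComodule k C N), D.IsHopf ν ρ → ρ.IsInjective

theorem isRightAct_act : IsRightAct D.mul.flip D.one D.act where
  one_act c := by
    obtain ⟨x, rfl⟩ := D.π_surjective c
    rw [D.act_π, D.one_mul]
  mul_act a b c := by
    obtain ⟨x, rfl⟩ := D.π_surjective c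
    rw [LinearMap.flip_apply, D.act_π, D.act_π, D.act_π, D.mul_assoc]

/-- The map `c ⊗ h ↦ h₍₂₎ ⊗ T(h₍₁₎) c`. -/
def twist : C ⊗[k] H →ₗ[k] H ⊗[k] C :=
  (TensorProduct.lift (D.act ∘ₗ D.T).flip).lTensor H ∘ₗ
    (TensorProduct.comm k (C ⊗[k] H) H).toLinearMap ∘ₗ
      (TensorProduct.assoc k C H H).symm.toLinearMap ∘ₗ (comul (R := k) (A := H)).lTensor C

theorem twist_one (c : C) : D.twist (c ⊗ₜ D.one) = D.one ⊗ₜ c := by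
  simp [twist, D.comul_one, D.T_one, D.isRightAct_act.one_act]

theorem twist_mul (h : H) (t : C ⊗[k] H) : D.twist (ampAct C D.mul.flip h t) =
    actMap D.mul.flip (D.act ∘ₗ D.T) (TensorProduct.comm k H H (comul (R := k) h)) (D.twist t) := by
  induction t with
  | zero => simp
  | add x y hx hy => simp only [map_add, hx, hy]
  | tmul c x =>
    simp only [twist, ampAct_tmul, LinearMap.comp_apply, LinearMap.lTensor_tmul,
      LinearMap.flip_apply, D.comul_mul]
    generalize comul (R := k) x = s
    generalize comul (R := k) h = t
    induction s with
    | zero => simp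
    | add x y hx hy => simp only [map_add, TensorProduct.tmul_add, LinearMap.add_apply, hx, hy]
    | tmul a b =>
      induction t with
      | zero => simp
      | add x y hx hy => simp only [map_add, TensorProduct.tmul_add, LinearMap.add_apply, hx, hy]
      | tmul p q =>
        have := D.isRightAct_act.mul_act (D.T a) (D.T p) c
        simp only [LinearMap.flip_apply] at this
        simp [D.T_mul, this]

/-- `x₍₃₎ ⊗ T(x₍₂₎) π(x₍₁₎) = x ⊗ π(1)`. -/
theorem twist_coactLeft (x : H) : D.twist (D.coactLeft x) = x ⊗ₜ D.π D.one := by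
  have h1 : ∀ t : H ⊗[k] H, D.twist (D.π.rTensor H t) =
      (D.π ∘ₗ TensorProduct.lift (D.mul.flip.compl₂ D.T)).lTensor H
        (TensorProduct.comm k (H ⊗[k] H) H ((TensorProduct.assoc k H H H).symm
          ((comul (R := k) (A := H)).lTensor H t))) := fun t => by
    induction t with
    | zero => simp
    | add x y hx hy => simp only [map_add, hx, hy]
    | tmul a b =>
      simp only [twist, LinearMap.comp_apply, LinearMap.lTensor_tmul, LinearMap.rTensor_tmul]
      generalize comul (R := k) b = s
      induction s with
      | zero => simp
      | add x y hx hy => simp only [map_add, TensorProduct.tmul_add, hx, hy]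
      | tmul a b => simp [D.act_π]
  rw [coactLeft, LinearMap.comp_apply, h1, ← Coalgebra.coassoc_apply, LinearEquiv.symm_apply_apply]
  have h2 : ∀ t : H ⊗[k] H, (D.π ∘ₗ TensorProduct.lift (D.mul.flip.compl₂ D.T)).lTensor H
      (TensorProduct.comm k (H ⊗[k] H) H ((comul (R := k) (A := H)).rTensor H t)) =
      TensorProduct.lid k H ((counit (R := k) (A := H)).rTensor H t) ⊗ₜ D.π D.one := fun t => by
    induction t with
    | zero => simp
    | add x y hx hy => simp only [map_add, TensorProduct.add_tmul, hx, hy]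
    | tmul a b => simp [D.T_left, TensorProduct.smul_tmul']
  rw [h2, lift_comul_counit]

variable (ρ : RightComodule k C N)

/-- The map `n ⊗ x ↦ n₍₀₎ ⊗ x₍₂₎ ⊗ T(x₍₁₎) n₍₁₎`, which corresponds to the coaction of
`(N □ H) ⊗_L H` under the isomorphism `cotMul`. -/
def twistCoact : N ⊗[k] H →ₗ[k] (N ⊗[k] H) ⊗[k] C :=
  (TensorProduct.assoc k N H C).symm.toLinearMap ∘ₗ D.twist.lTensor N ∘ₗ
    (TensorProduct.assoc k N C H).toLinearMap ∘ₗ ρ.coact.rTensor H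

theorem twistCoact_one (n : N) : D.twistCoact ρ (n ⊗ₜ D.one) =
    ((TensorProduct.mk k N H).flip D.one).rTensor C (ρ.coact n) := by
  simp only [twistCoact, LinearMap.comp_apply, LinearMap.rTensor_tmul]
  generalize ρ.coact n = s
  induction s with
  | zero => simp
  | add x y hx hy => simp only [map_add, TensorProduct.add_tmul, hx, hy]
  | tmul m c => simp [twist_one]

theorem lTensor_twist_mul (t : N ⊗[k] H) (h : H) : (TensorProduct.assoc k N H C).symm
      (D.twist.lTensor N (ampAct N (ampAct C D.mul.flip) h (D.coactLeft.lTensor N t))) =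
    (D.mulAmp N).rTensor C ((D.rightComodule.amp (N ⊗[k] H)).coact (t ⊗ₜ h)) := by
  induction t with
  | zero => simp
  | add x y hx hy => simp only [map_add, TensorProduct.add_tmul, hx, hy]
  | tmul n x =>
    rw [RightComodule.amp_coact_tmul, rightComodule_coact]
    simp only [LinearMap.lTensor_tmul, ampAct_tmul, twist_mul, twist_coactLeft]
    generalize comul (R := k) h = s
    induction s with
    | zero => simp
    | add x y hx hy => simp only [map_add, LinearMap.add_apply, TensorProduct.tmul_add, hx, hy]
    | tmul a b => simp [D.act_π, D.mul_one]

theorem twistCoact_cotMul (z : Bal (D.cotAct ρ) D.lmul) : D.twistCoact ρ (D.cotMul ρ z) =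
    (D.cotMul ρ).rTensor C ((D.balComodule (D.cotAct ρ)).coact z) := by
  obtain ⟨t, rfl⟩ := Bal.mk_surjective z
  induction t with
  | zero => simp
  | add x y hx hy => simp only [map_add, hx, hy]
  | tmul t h =>
    have h1 := intertwines_assoc_rTensor ρ.coact D.mul.flip h (t : N ⊗[k] H)
    simp only [LinearMap.comp_apply, LinearEquiv.coe_coe, mem_ker_cotensorDiff.1 t.2] at h1
    rw [cotMul_mk, mulAmp_tmul, twistCoact]
    simp only [LinearMap.comp_apply, LinearEquiv.coe_coe]
    rw [h1, lTensor_twist_mul, balComodule_coact_mk, RightComodule.amp_coact_tmul,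
      RightComodule.amp_coact_tmul]
    generalize D.rightComodule.coact h = s
    induction s with
    | zero => simp
    | add x y hx hy => simp only [map_add, TensorProduct.tmul_add, hx, hy]
    | tmul x c =>
      simp only [TensorProduct.assoc_symm_tmul, LinearMap.rTensor_tmul, cotMul_mk]

/-- The map `n ⊗ x ↦ T(x) n`. -/
def actT (ν : H →ₗ[k] Module.End k N) : N ⊗[k] H →ₗ[k] N := TensorProduct.lift (ν ∘ₗ D.T).flip

@[simp] theorem actT_tmul (ν : H →ₗ[k] Module.End k N) (n : N) (x : H) :
    D.actT ν (n ⊗ₜ x) = ν (D.T x) n := rfl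

variable {ρ}

theorem IsHopf.coact_actT {ν : H →ₗ[k] Module.End k N} (hN : D.IsHopf ν ρ) (w : N ⊗[k] H) :
    (D.actT ν).rTensor C (D.twistCoact ρ w) = ρ.coact (D.actT ν w) := by
  induction w with
  | zero => simp
  | add x y hx hy => simp only [map_add, hx, hy]
  | tmul n x =>
    simp only [actT_tmul, hN.coact_act, D.comul_T, twistCoact, LinearMap.comp_apply,
      LinearMap.rTensor_tmul]
    generalize ρ.coact n = s
    induction s with
    | zero => simp
    | add x y hx hy => simp only [map_add, TensorProduct.add_tmul, hx, hy]
    | tmul m c =>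
      simp only [LinearEquiv.coe_coe, TensorProduct.assoc_tmul, LinearMap.lTensor_tmul, twist,
        LinearMap.comp_apply]
      generalize comul (R := k) x = s
      induction s with
      | zero => simp
      | add x y hx hy => simp only [map_add, TensorProduct.tmul_add, LinearMap.add_apply, hx, hy]
      | tmul a b => simp

theorem IsHopf.isHom_actT_cotMul {ν : H →ₗ[k] Module.End k N} (hN : D.IsHopf ν ρ) :
    (D.balComodule (D.cotAct ρ)).IsHom ρ (D.actT ν ∘ₗ D.cotMul ρ) := by
  refine LinearMap.ext fun z => ?_
  rw [LinearMap.comp_apply, LinearMap.comp_apply, LinearMap.comp_apply, LinearMap.rTensor_comp_apply,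
    ← twistCoact_cotMul, hN.coact_actT]

/-- A Hopf module `N` is a retract of the comodule `(N □ H) ⊗_L H ≅ N ⊗ H`, with the retraction
`n ⊗ x ↦ T(x) n` of the embedding `n ↦ n ⊗ 1`. -/
theorem IsHopf.isInjective {ν : H →ₗ[k] Module.End k N} (hN : D.IsHopf ν ρ)
    (h : (D.balComodule (D.cotAct ρ)).IsInjective) : ρ.IsInjective := by
  let e := LinearEquiv.ofBijective (D.cotMul ρ) ⟨D.cotMul_injective ρ, D.cotMul_surjective ρ⟩
  have he : ∀ w, D.cotMul ρ (e.symm w) = w := e.apply_symm_apply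
  refine h.of_retract (e.symm.toLinearMap ∘ₗ (TensorProduct.mk k N H).flip D.one)
    (D.actT ν ∘ₗ D.cotMul ρ) ?_ (hN.isHom_actT_cotMul D) ?_
  · refine LinearMap.ext fun n => ?_
    have hinj : Function.Injective ((D.cotMul ρ).rTensor C) :=
      Module.Flat.rTensor_preserves_injective_linearMap _ (D.cotMul_injective ρ)
    apply hinj
    simp only [LinearMap.comp_apply, LinearEquiv.coe_coe]
    rw [← twistCoact_cotMul, he, LinearMap.flip_apply, TensorProduct.mk_apply, twistCoact_one,
      ← LinearMap.rTensor_comp_apply]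
    congr 2
    ext n
    exact he _
  · ext n
    simp only [LinearMap.comp_apply, LinearEquiv.coe_coe, he, LinearMap.flip_apply,
      TensorProduct.mk_apply, actT_tmul, D.T_one, hN.isAct.one_act, LinearMap.id_apply]

end CoidealDatum

/-! ### From injectivity of Hopf modules to projectivity -/

theorem actMap_rTensor {k X Z V W C : Type u} [Field k] [AddCommGroup X] [Module k X]
    [AddCommGroup Z] [Module k Z] [AddCommGroup V] [Module k V] [AddCommGroup W] [Module k W]
    [AddCommGroup C] [Module k C] {ν : X →ₗ[k] Module.End k V} {ν' : X →ₗ[k] Module.End k W}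
    {f : V →ₗ[k] W} (hf : Intertwines ν ν' f) (g : Z →ₗ[k] Module.End k C) (s : X ⊗[k] Z)
    (t : V ⊗[k] C) : f.rTensor C (actMap ν g s t) = actMap ν' g s (f.rTensor C t) := by
  induction s with
  | zero => simp
  | add x y hx hy => simp only [map_add, LinearMap.add_apply, hx, hy]
  | tmul a b =>
    induction t with
    | zero => simp
    | add x y hx hy => simp only [map_add, hx, hy]
    | tmul v c => simp [hf a v]

theorem actMap_ampAct_assoc_symm {k X Z V W C : Type u} [Field k] [AddCommGroup X] [Module k X]
    [AddCommGroup Z] [Module k Z] [AddCommGroup V] [Module k V] [AddCommGroup W] [Module k W]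
    [AddCommGroup C] [Module k C] (α : X →ₗ[k] Module.End k W) (g : Z →ₗ[k] Module.End k C)
    (s : X ⊗[k] Z) (v : V) (t : W ⊗[k] C) :
    actMap (ampAct V α) g s ((TensorProduct.assoc k V W C).symm (v ⊗ₜ t)) =
      (TensorProduct.assoc k V W C).symm (v ⊗ₜ actMap α g s t) := by
  induction s with
  | zero => simp
  | add x y hx hy => simp only [map_add, LinearMap.add_apply, TensorProduct.tmul_add, hx, hy]
  | tmul a b =>
    induction t with
    | zero => simp
    | add x y hx hy => simp only [map_add, TensorProduct.tmul_add, hx, hy]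
    | tmul n c => simp

theorem RightComodule.cotensorDiff_amp {k C V N X : Type u} [Field k] [AddCommGroup C]
    [Module k C] [Coalgebra k C] [AddCommGroup V] [Module k V] [AddCommGroup N] [Module k N]
    [AddCommGroup X] [Module k X] (ρ : RightComodule k C N) (μ : X →ₗ[k] C ⊗[k] X) (v : V)
    (t : N ⊗[k] X) : cotensorDiff (ρ.amp V) μ ((TensorProduct.assoc k V N X).symm (v ⊗ₜ t)) =
      (TensorProduct.assoc k V N (C ⊗[k] X)).symm (v ⊗ₜ cotensorDiff ρ μ t) := by
  induction t with
  | zero => simp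
  | add x y hx hy => simp only [map_add, TensorProduct.tmul_add, hx, hy]
  | tmul n x =>
    simp only [cotensorDiff, LinearMap.sub_apply, LinearMap.comp_apply, LinearMap.rTensor_tmul,
      LinearMap.lTensor_tmul, TensorProduct.assoc_symm_tmul, amp_coact_tmul, TensorProduct.tmul_sub,
      map_sub, LinearEquiv.coe_coe]
    congr 1
    generalize ρ.coact n = s
    induction s with
    | zero => simp
    | add x y hx hy => simp only [map_add, TensorProduct.tmul_add, TensorProduct.add_tmul, hx, hy]
    | tmul m c => simp

namespace CoidealDatum

variable {k H L C : Type u} [Field k] [AddCommGroup H] [Module k H] [Coalgebra k H]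
    [AddCommGroup L] [Module k L] [AddCommGroup C] [Module k C] [Coalgebra k C]
variable (D : CoidealDatum k H L C)
variable {V W N M : Type u} [AddCommGroup V] [Module k V] [AddCommGroup W] [Module k W]
  [AddCommGroup N] [Module k N] [AddCommGroup M] [Module k M]

/-- The right `L`-module and right `H`-comodule `M` is an object of `𝓜_L^H`:
`ρ(m a) = m₍₀₎ a₍₁₎ ⊗ m₍₁₎ a₍₂₎`. -/
structure IsModule (α : L →ₗ[k] Module.End k M) (ρ : RightComodule k H M) : Prop where
  isAct : IsRightAct D.mulL D.oneL α
  coact_act : ∀ a m, ρ.coact (α a m) = actMap α D.mul.flip (D.δ a) (ρ.coact m)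

/-- Each object of `𝓜_L^H` is projective as an `L`-module, in the form that the action
`M ⊗ L → M` splits `L`-linearly. -/
def AllProjective : Prop :=
  ∀ (M : Type u) [AddCommGroup M] [Module k M] (α : L →ₗ[k] Module.End k M)
    (ρ : RightComodule k H M), D.IsModule α ρ → ∃ σ : M →ₗ[k] M ⊗[k] L,
      Intertwines α (ampAct M D.mulL.flip) σ ∧ TensorProduct.lift α.flip ∘ₗ σ = LinearMap.id

variable {D} in
theorem IsHopf.amp {ν : H →ₗ[k] Module.End k N} {ρ : RightComodule k C N} (h : D.IsHopf ν ρ) :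
    D.IsHopf (ampAct V ν) (ρ.amp V) where
  isAct := h.isAct.amp V
  coact_act g t := by
    induction t with
    | zero => simp
    | add x y hx hy => simp only [map_add, hx, hy]
    | tmul v n =>
      rw [ampAct_tmul, RightComodule.amp_coact_tmul, RightComodule.amp_coact_tmul, h.coact_act,
        actMap_ampAct_assoc_symm]

variable {D} in
theorem IsHopf.restrict {ν : H →ₗ[k] Module.End k N} {ρ : RightComodule k C N} (h : D.IsHopf ν ρ)
    (K : Submodule k N) (hK : ∀ r, ∀ x ∈ K, ν r x ∈ K) (hK' : ρ.IsSub K) :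
    D.IsHopf (restrictAct ν K hK) (ρ.restrict K hK') where
  isAct := h.isAct.restrict K hK
  coact_act g n := by
    apply rTensor_subtype_injective K C
    rw [(ρ.restrict_isHom K hK').apply, actMap_rTensor (Intertwines.subtype K hK),
      (ρ.restrict_isHom K hK').apply]
    exact h.coact_act g n

/-- The Hopf module `H` with the action `g · x = x S(g)` and the coaction
`x ↦ x₍₂₎ ⊗ π(T(x₍₁₎))`. -/
theorem isHopf_rightComodule : D.IsHopf (D.mul.flip ∘ₗ D.S) D.rightComodule where
  isAct :=
    { one_act := fun x => by simp [D.S_one, D.mul_one]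
      mul_act := fun a b x => by simp [D.S_mul, D.mul_assoc] }
  coact_act g x := by
    simp only [LinearMap.comp_apply, LinearMap.flip_apply, rightComodule_coact, D.comul_mul,
      D.comul_S]
    generalize comul (R := k) g = s
    generalize comul (R := k) x = t
    induction s with
    | zero => simp
    | add x y hx hy => simp only [map_add, LinearMap.add_apply, hx, hy]
    | tmul a b =>
      induction t with
      | zero => simp
      | add x y hx hy => simp only [map_add, LinearMap.add_apply, hx, hy]
      | tmul n c => simp [D.T_mul, D.T_S, D.act_π]

/-- The kernel of `M ⊗ H → M ⊗_L H` is a Hopf module; if all of these are injective, there is a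
colinear section. -/
theorem exists_section_mk (hD : D.AllInjective) (α : L →ₗ[k] Module.End k M) :
    ∃ s : Bal α D.lmul →ₗ[k] M ⊗[k] H,
      (D.balComodule α).IsHom (D.rightComodule.amp M) s ∧ Bal.mk α D.lmul ∘ₗ s = LinearMap.id := by
  refine RightComodule.exists_section_of_isInjective_ker (D.isHom_mk α) Bal.mk_surjective
    (hD _ _ _ (D.isHopf_rightComodule.amp.restrict _ ?_ _))
  intro g t ht
  have h1 : ∀ t, Bal.mk α D.lmul (ampAct M (D.mul.flip ∘ₗ D.S) g t) = Bal.map LinearMap.id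
      (D.mul.flip (D.S g)) (Intertwines.id α) (D.intertwines_mul_right _) (Bal.mk α D.lmul t) :=
    fun t => rfl
  rw [LinearMap.mem_ker] at ht ⊢
  rw [h1, ht, map_zero]

variable (M) in
/-- The map `m ⊗ x ↦ m ⊗ S(x₍₁₎) ⊗ x₍₂₎`. -/
def antipodeComul : M ⊗[k] H →ₗ[k] (M ⊗[k] H) ⊗[k] H :=
  (TensorProduct.assoc k M H H).symm.toLinearMap ∘ₗ
    (D.S.rTensor H ∘ₗ comul (R := k) (A := H)).lTensor M

theorem antipodeComul_tmul (m : M) (x : H) : D.antipodeComul M (m ⊗ₜ x) =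
    (TensorProduct.assoc k M H H).symm (m ⊗ₜ D.S.rTensor H (comul (R := k) x)) := rfl

theorem S_comul_mem_cot (x : H) :
    D.S.rTensor H (comul (R := k) x) ∈ D.cot D.rightComodule := by
  rw [mem_ker_cotensorDiff]
  have h1 : ∀ t : H ⊗[k] H, TensorProduct.assoc k H C H (D.rightComodule.coact.rTensor H
      (D.S.rTensor H t)) = TensorProduct.map D.S (D.π.rTensor H)
        (TensorProduct.assoc k H H H ((comul (R := k) (A := H)).rTensor H t)) := fun t => by
    induction t with
    | zero => simp
    | add x y hx hy => simp only [map_add, hx, hy]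
    | tmul a b =>
      simp only [LinearMap.rTensor_tmul, rightComodule_coact, D.comul_S]
      generalize comul (R := k) a = s
      induction s with
      | zero => simp
      | add x y hx hy => simp only [map_add, TensorProduct.add_tmul, hx, hy]
      | tmul a b => simp [D.T_S]
  have h2 : ∀ t : H ⊗[k] H, D.coactLeft.lTensor H (D.S.rTensor H t) =
      TensorProduct.map D.S (D.π.rTensor H) ((comul (R := k) (A := H)).lTensor H t) := fun t => by
    induction t with
    | zero => simp
    | add x y hx hy => simp only [map_add, hx, hy]
    | tmul a b => simp [coactLeft]
  rw [h1, h2, Coalgebra.coassoc_apply]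

theorem antipodeComul_mem_cot (t : M ⊗[k] H) :
    D.antipodeComul M t ∈ D.cot (D.rightComodule.amp M) := by
  induction t with
  | zero => rw [map_zero]; exact zero_mem _
  | add x y hx hy => rw [map_add]; exact add_mem hx hy
  | tmul m x =>
    rw [LinearMap.mem_ker, antipodeComul_tmul, RightComodule.cotensorDiff_amp,
      LinearMap.mem_ker.1 (D.S_comul_mem_cot x), TensorProduct.tmul_zero, map_zero]

/-- `x₍₂₎ π(T(x₍₁₎)) ⊗ x₍₃₎ h = π(1) ⊗ x h`. -/
theorem lift_actMap_coact (x h : H) :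
    TensorProduct.lift (actMap D.act D.mul ∘ₗ comul (R := k) (A := H))
      (TensorProduct.assoc k H C H (D.rightComodule.coact x ⊗ₜ h)) = D.π D.one ⊗ₜ D.mul x h := by
  rw [rightComodule_coact]
  have h1 : ∀ t : H ⊗[k] H, TensorProduct.lift (actMap D.act D.mul ∘ₗ comul (R := k) (A := H))
      (TensorProduct.assoc k H C H ((D.π ∘ₗ D.T).lTensor H (TensorProduct.comm k H H t) ⊗ₜ h)) =
      TensorProduct.map (D.π ∘ₗ TensorProduct.lift (D.mul.flip ∘ₗ D.T)) (D.mul.flip h)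
        ((TensorProduct.assoc k H H H).symm ((comul (R := k) (A := H)).lTensor H t)) := fun t => by
    induction t with
    | zero => simp
    | add x y hx hy => simp only [map_add, TensorProduct.add_tmul, hx, hy]
    | tmul a b =>
      simp only [TensorProduct.comm_tmul, LinearMap.lTensor_tmul, TensorProduct.assoc_tmul,
        TensorProduct.lift.tmul, LinearMap.comp_apply]
      generalize comul (R := k) b = s
      induction s with
      | zero => simp
      | add x y hx hy => simp only [map_add, LinearMap.add_apply, TensorProduct.tmul_add, hx, hy]
      | tmul a b => simp [D.act_π]
  have h2 : ∀ t : H ⊗[k] H, TensorProduct.map (D.π ∘ₗ TensorProduct.lift (D.mul.flip ∘ₗ D.T))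
      (D.mul.flip h) ((comul (R := k) (A := H)).rTensor H t) =
      D.π D.one ⊗ₜ D.mul (TensorProduct.lid k H ((counit (R := k) (A := H)).rTensor H t)) h :=
    fun t => by
    induction t with
    | zero => simp
    | add x y hx hy => simp only [map_add, LinearMap.add_apply, TensorProduct.tmul_add, hx, hy]
    | tmul a b => simp [D.T_right, TensorProduct.smul_tmul']
  rw [h1, ← Coalgebra.coassoc_apply, LinearEquiv.symm_apply_apply, h2, lift_comul_counit]

/-- Multiplication sends elements of the cotensor product of `M ⊗ H` with `H` to `M ⊗ L`. -/
theorem mulAmp_mem_range (u : (M ⊗[k] H) ⊗[k] H) (hu : u ∈ D.cot (D.rightComodule.amp M)) :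
    D.mulAmp M u ∈ LinearMap.range (D.i.lTensor M) := by
  apply mem_range_lTensor_i
  set P : (M ⊗[k] H) ⊗[k] (C ⊗[k] H) →ₗ[k] M ⊗[k] (C ⊗[k] H) :=
    (TensorProduct.lift (actMap D.act D.mul ∘ₗ comul (R := k) (A := H))).lTensor M ∘ₗ
      (TensorProduct.assoc k M H (C ⊗[k] H)).toLinearMap with hP
  have h1 : ∀ u : (M ⊗[k] H) ⊗[k] H, D.coactLeft.lTensor M (D.mulAmp M u) =
      P (D.coactLeft.lTensor (M ⊗[k] H) u) := fun u => by
    induction u with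
    | zero => simp
    | add x y hx hy => simp only [map_add, hx, hy]
    | tmul t h =>
      induction t with
      | zero => simp
      | add x y hx hy => simp only [map_add, TensorProduct.add_tmul, hx, hy]
      | tmul m x => simp [hP, D.coactLeft_mul]
  have h2 : ∀ u : (M ⊗[k] H) ⊗[k] H, (TensorProduct.mk k C H (D.π D.one)).lTensor M (D.mulAmp M u) =
      P (TensorProduct.assoc k (M ⊗[k] H) C H ((D.rightComodule.amp M).coact.rTensor H u)) :=
    fun u => by
    induction u with
    | zero => simp
    | add x y hx hy => simp only [map_add, hx, hy]
    | tmul t h =>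
      induction t with
      | zero => simp
      | add x y hx hy => simp only [map_add, TensorProduct.add_tmul, hx, hy]
      | tmul m x =>
        rw [mulAmp_tmul_tmul, LinearMap.lTensor_tmul, TensorProduct.mk_apply,
          ← lift_actMap_coact, LinearMap.rTensor_tmul, RightComodule.amp_coact_tmul]
        generalize D.rightComodule.coact x = s
        induction s with
        | zero => simp
        | add x y hx hy => simp only [map_add, TensorProduct.tmul_add, TensorProduct.add_tmul,
            hx, hy]
        | tmul a b => simp [hP]
  rw [h1, h2, mem_ker_cotensorDiff.1 hu]

/-- `y₍₁₎ S(y₍₂₎) ⊗ y₍₃₎ = 1 ⊗ y`. -/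
theorem rTensor_mul_S_comul (y : H) :
    (TensorProduct.lift (D.mul.compl₂ D.S)).rTensor H ((TensorProduct.assoc k H H H).symm
      ((comul (R := k) (A := H)).lTensor H (comul (R := k) y))) = D.one ⊗ₜ y := by
  rw [← Coalgebra.coassoc_apply, LinearEquiv.symm_apply_apply, ← LinearMap.rTensor_comp_apply]
  have : TensorProduct.lift (D.mul.compl₂ D.S) ∘ₗ comul (R := k) (A := H) =
      LinearMap.toSpanSingleton k H D.one ∘ₗ counit (R := k) (A := H) := LinearMap.ext D.S_right
  rw [this, LinearMap.rTensor_comp_apply, Coalgebra.rTensor_counit_comul]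
  simp

variable {D} in
/-- The map `m ↦ (m₍₀₎ ⊗ S(m₍₁₎)) ⊗ m₍₂₎` from `M` to `(M ⊗_L H) ⊗ H` is `L`-linear. -/
theorem IsModule.mk_antipodeComul {α : L →ₗ[k] Module.End k M} {ρ : RightComodule k H M}
    (hM : D.IsModule α ρ) (a : L) (m : M) :
    (Bal.mk α D.lmul).rTensor H (D.antipodeComul M (ρ.coact (α a m))) =
      ampAct _ D.rmul a ((Bal.mk α D.lmul).rTensor H (D.antipodeComul M (ρ.coact m))) := by
  have h1 : ∀ s : L ⊗[k] H, ∀ (m : M) (x : H), (Bal.mk α D.lmul).rTensor H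
      (D.antipodeComul M (actMap α D.mul.flip s (m ⊗ₜ x))) =
      (Bal.mk α D.lmul ∘ₗ TensorProduct.mk k M H m).rTensor H (actMap D.mul D.mul.flip
        ((TensorProduct.lift (D.mul.compl₂ D.S)).rTensor H ((TensorProduct.assoc k H H H).symm
          ((comul (R := k) (A := H)).lTensor H (D.i.rTensor H s))))
            (D.S.rTensor H (comul (R := k) x))) := fun s m x => by
    induction s with
    | zero => simp
    | add x y hx hy => simp only [map_add, LinearMap.add_apply, hx, hy]
    | tmul b g =>
      simp only [actMap_tmul, antipodeComul_tmul, LinearMap.flip_apply, D.comul_mul,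
        LinearMap.rTensor_tmul, LinearMap.lTensor_tmul]
      generalize comul (R := k) x = s
      generalize comul (R := k) g = t
      induction s with
      | zero => simp
      | add x y hx hy => simp only [map_add, LinearMap.add_apply, TensorProduct.tmul_add, hx, hy]
      | tmul c d =>
        induction t with
        | zero => simp
        | add x y hx hy => simp only [map_add, LinearMap.add_apply, TensorProduct.tmul_add, hx, hy]
        | tmul p q =>
          have := Bal.mk_act (α := α) (β := D.lmul) m b (D.mul (D.S p) (D.S c))
          simpa [D.S_mul, D.mul_assoc] using congrArg (· ⊗ₜ D.mul d q) this
  rw [hM.coact_act]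
  generalize ρ.coact m = t
  induction t with
  | zero => simp
  | add x y hx hy => simp only [map_add, hx, hy]
  | tmul m x =>
    rw [h1, ← D.comul_i, rTensor_mul_S_comul, antipodeComul_tmul]
    generalize comul (R := k) x = s
    induction s with
    | zero => simp
    | add x y hx hy => simp only [map_add, TensorProduct.tmul_add, hx, hy]
    | tmul c d => simp [D.one_mul]

/-- `m₍₀₎ ⊗ S(m₍₁₎) m₍₂₎ = m ⊗ 1`. -/
theorem mulAmp_antipodeComul (ρ : RightComodule k H M) (m : M) :
    D.mulAmp M (D.antipodeComul M (ρ.coact m)) = m ⊗ₜ D.one := by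
  have h1 : ∀ t : M ⊗[k] H, D.mulAmp M (D.antipodeComul M t) =
      (LinearMap.toSpanSingleton k H D.one).lTensor M
        ((counit (R := k) (A := H)).lTensor M t) := fun t => by
    induction t with
    | zero => simp
    | add x y hx hy => simp only [map_add, hx, hy]
    | tmul m x =>
      rw [LinearMap.lTensor_tmul, LinearMap.lTensor_tmul, LinearMap.toSpanSingleton_apply,
        ← D.S_left, antipodeComul_tmul]
      generalize comul (R := k) x = s
      induction s with
      | zero => simp
      | add x y hx hy => simp only [map_add, TensorProduct.tmul_add, hx, hy]
      | tmul c d => simp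
  rw [h1, ρ.counit_apply]
  simp

theorem mk_mulAmp_congr {α : L →ₗ[k] Module.End k M} {u v : (M ⊗[k] H) ⊗[k] H}
    (h : (Bal.mk α D.lmul).rTensor H u = (Bal.mk α D.lmul).rTensor H v) :
    Bal.mk α D.lmul (D.mulAmp M u) = Bal.mk α D.lmul (D.mulAmp M v) := by
  rw [← sub_eq_zero, ← map_sub] at h
  rw [← sub_eq_zero, ← map_sub, ← map_sub]
  obtain ⟨w, hw⟩ := mem_range_rTensor_subtype_ker _ _ h
  rw [← hw]
  clear hw
  induction w with
  | zero => simp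
  | add x y hx hy => simp only [map_add, hx, hy, add_zero]
  | tmul t h =>
    have h1 : ∀ t, Bal.mk α D.lmul (D.mulAmp M (t ⊗ₜ h)) = Bal.map LinearMap.id (D.mul.flip h)
      (Intertwines.id α) (D.intertwines_mul_right _) (Bal.mk α D.lmul t) := fun t => rfl
    rw [LinearMap.rTensor_tmul, h1, Submodule.subtype_apply, LinearMap.mem_ker.1 t.2, map_zero]

theorem intertwines_mulAmp : Intertwines (ampAct (M ⊗[k] H) D.rmul) (ampAct M D.rmul)
    (D.mulAmp M) := fun a u => by
  induction u with
  | zero => simp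
  | add x y hx hy => simp only [map_add, hx, hy]
  | tmul t h =>
    induction t with
    | zero => simp
    | add x y hx hy => simp only [map_add, TensorProduct.add_tmul, hx, hy]
    | tmul m x => simp [D.mul_assoc]

/-- If all Hopf modules in `_H𝓜^C` are injective comodules, then the objects of `𝓜_L^H` are
projective. The splitting is built from a colinear section `s` of `M ⊗ H → M ⊗_L H`: it sends `m`
to the product of the last two factors of `s(m₍₀₎ ⊗ S(m₍₁₎)) ⊗ m₍₂₎`. -/
theorem AllInjective.allProjective (hD : D.AllInjective) : D.AllProjective := by
  intro M _ _ α ρ hM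
  obtain ⟨s, hs, hs'⟩ := D.exists_section_mk hD α
  set j : M →ₗ[k] (M ⊗[k] H) ⊗[k] H :=
    s.rTensor H ∘ₗ (Bal.mk α D.lmul).rTensor H ∘ₗ D.antipodeComul M ∘ₗ ρ.coact with hj
  have hmem : ∀ m, (D.mulAmp M ∘ₗ j) m ∈ LinearMap.range (D.i.lTensor M) := fun m => by
    refine D.mulAmp_mem_range _ ?_
    rw [LinearMap.mem_ker, hj]
    simp only [LinearMap.comp_apply]
    rw [cotensorDiff_natural hs, cotensorDiff_natural (D.isHom_mk α),
      LinearMap.mem_ker.1 (D.antipodeComul_mem_cot _), map_zero, map_zero]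
  have hinj : Function.Injective (D.i.lTensor M) :=
    Module.Flat.lTensor_preserves_injective_linearMap _ D.i_injective
  let σ : M →ₗ[k] M ⊗[k] L := (LinearEquiv.ofInjective _ hinj).symm.toLinearMap ∘ₗ
    LinearMap.codRestrict _ (D.mulAmp M ∘ₗ j) hmem
  have hσ : ∀ m, D.i.lTensor M (σ m) = D.mulAmp M (j m) := fun m =>
    congrArg Subtype.val ((LinearEquiv.ofInjective _ hinj).apply_symm_apply _)
  have hi : Intertwines D.mulL.flip D.rmul D.i := fun a b => by simp [D.i_mul]
  refine ⟨σ, fun a m => hinj ?_, LinearMap.ext fun m => D.mk_one_injective hM.isAct ?_⟩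
  · rw [hσ, hi.lTensor M a (σ m), hσ, ← D.intertwines_mulAmp]
    congr 1
    simp only [hj, LinearMap.comp_apply, hM.mk_antipodeComul]
    exact Intertwines.rTensor D.rmul s a _
  · have h1 : ∀ t : M ⊗[k] L, Bal.mk α D.lmul (TensorProduct.lift α.flip t ⊗ₜ D.one) =
        Bal.mk α D.lmul (D.i.lTensor M t) := fun t => by
      induction t with
      | zero => simp
      | add x y hx hy => simp only [map_add, TensorProduct.add_tmul, hx, hy]
      | tmul m a =>
        have := Bal.mk_act (α := α) (β := D.lmul) m a D.one
        simpa [D.mul_one] using this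
    refine (h1 (σ m)).trans ?_
    rw [hσ, D.mk_mulAmp_congr (v := D.antipodeComul M (ρ.coact m)), mulAmp_antipodeComul]
    · rfl
    · simp only [hj, LinearMap.comp_apply]
      rw [← LinearMap.rTensor_comp_apply, hs', LinearMap.rTensor_id, LinearMap.id_apply]

end CoidealDatum

/-! ### Resolutions -/

theorem RightComodule.IsHom.amp {k C V N X : Type u} [Field k] [AddCommGroup C] [Module k C]
    [Coalgebra k C] [AddCommGroup V] [Module k V] [AddCommGroup N] [Module k N] [AddCommGroup X]
    [Module k X] {ρ : RightComodule k C N} {σ : RightComodule k C X} {f : N →ₗ[k] X}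
    (hf : ρ.IsHom σ f) : (ρ.amp V).IsHom (σ.amp V) (f.lTensor V) := by
  refine TensorProduct.ext' fun v n => ?_
  simp only [LinearMap.comp_apply, LinearMap.lTensor_tmul, amp_coact_tmul, ← hf.apply]
  generalize ρ.coact n = s
  induction s with
  | zero => simp
  | add x y hx hy => simp only [map_add, TensorProduct.tmul_add, hx, hy]
  | tmul m c => simp

/-- The comodule `V ⊗ N` maps to `V ⊗ (X ⊗ N)` for each linear map `V → V ⊗ X`. -/
theorem RightComodule.isHom_assoc_rTensor {k C V N X : Type u} [Field k] [AddCommGroup C]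
    [Module k C] [Coalgebra k C] [AddCommGroup V] [Module k V] [AddCommGroup N] [Module k N]
    [AddCommGroup X] [Module k X] (ρ : RightComodule k C N) (f : V →ₗ[k] V ⊗[k] X) :
    (ρ.amp V).IsHom ((ρ.amp X).amp V)
      ((TensorProduct.assoc k V X N).toLinearMap ∘ₗ f.rTensor N) := by
  refine TensorProduct.ext' fun v n => ?_
  simp only [LinearMap.comp_apply, LinearMap.rTensor_tmul, amp_coact_tmul, LinearEquiv.coe_coe]
  have h1 : ∀ t : N ⊗[k] C, ((TensorProduct.assoc k V X N).toLinearMap ∘ₗ f.rTensor N).rTensor C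
      ((TensorProduct.assoc k V N C).symm (v ⊗ₜ t)) =
      (TensorProduct.assoc k V (X ⊗[k] N) C).symm
        ((TensorProduct.assoc k X N C).symm.toLinearMap.lTensor V
          (TensorProduct.assoc k V X (N ⊗[k] C) (f v ⊗ₜ t))) := fun t => by
    induction t with
    | zero => simp
    | add x y hx hy => simp only [map_add, TensorProduct.tmul_add, hx, hy]
    | tmul n c =>
      simp only [TensorProduct.assoc_symm_tmul, LinearMap.rTensor_tmul, LinearMap.comp_apply]
      generalize f v = s
      induction s with
      | zero => simp
      | add x y hx hy => simp only [map_add, TensorProduct.add_tmul, hx, hy]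
      | tmul m x => simp
  rw [h1]
  generalize f v = s
  induction s with
  | zero => simp
  | add x y hx hy => simp only [map_add, TensorProduct.add_tmul, hx, hy]
  | tmul m c =>
    simp only [TensorProduct.assoc_tmul, LinearMap.lTensor_tmul, amp_coact_tmul]
    rfl

namespace CoidealDatum

variable {k H L C : Type u} [Field k] [AddCommGroup H] [Module k H] [Coalgebra k H]
    [AddCommGroup L] [Module k L] [AddCommGroup C] [Module k C] [Coalgebra k C]
variable (D : CoidealDatum k H L C)
variable {V W N M K F Y : Type u} [AddCommGroup V] [Module k V] [AddCommGroup W] [Module k W]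
  [AddCommGroup N] [Module k N] [AddCommGroup M] [Module k M] [AddCommGroup K] [Module k K]
  [AddCommGroup F] [Module k F] [AddCommGroup Y] [Module k Y]

variable {D} in
/-- A Hopf module `N` is a quotient of the injective comodule `(N □ H) ⊗ H`, with a Hopf module as
kernel. -/
theorem IsHopf.exists_presentation {ν : H →ₗ[k] Module.End k N} {ρ : RightComodule k C N}
    (h : D.IsHopf ν ρ) : ∃ (J : Type u) (_ : AddCommGroup J) (_ : Module k J)
      (κ : RightComodule k C J) (f : J →ₗ[k] N) (hf : κ.IsHom ρ f), κ.IsInjective ∧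
        Function.Surjective f ∧ ∃ ν' : H →ₗ[k] Module.End k (LinearMap.ker f),
          D.IsHopf ν' (κ.restrict (LinearMap.ker f) hf.isSub_ker) := by
  have hf := (h.isHom_actT_cotMul D).comp (D.isHom_mk (D.cotAct ρ))
  refine ⟨_, _, _, _, _, hf, D.rightComodule_isCoflat.amp.isInjective, ?_, _,
    D.isHopf_rightComodule.amp.restrict _ (Intertwines.mem_ker (α' := ν) ?_) _⟩
  · have h1 : Function.Surjective (D.actT ν) := fun n => ⟨n ⊗ₜ D.one, by
      rw [actT_tmul, D.T_one, h.isAct.one_act]⟩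
    exact (h1.comp (D.cotMul_surjective ρ)).comp Bal.mk_surjective
  · intro g t
    induction t with
    | zero => simp
    | add x y hx hy => simp only [map_add, hx, hy]
    | tmul t x =>
      simp only [LinearMap.comp_apply, ampAct_tmul, cotMul_mk, LinearMap.flip_apply]
      generalize (t : N ⊗[k] H) = s
      induction s with
      | zero => simp
      | add x y hx hy => simp only [map_add, TensorProduct.add_tmul, hx, hy]
      | tmul n y =>
        have := h.isAct.mul_act (D.mul (D.T x) (D.T y)) g n
        simp only [LinearMap.flip_apply] at this
        simp [D.T_mul, D.T_S, D.mul_assoc, this]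

/-- If `C` has finite global dimension, then Hopf modules are injective: by the presentations of
Hopf modules, their injective dimensions can be lowered step by step. -/
theorem allInjective_of_hasInjectiveResolution (n : ℕ)
    (hn : ∀ (N : Type u) [AddCommGroup N] [Module k N] (ν : H →ₗ[k] Module.End k N)
      (ρ : RightComodule k C N), D.IsHopf ν ρ → ρ.HasInjectiveResolution n) : D.AllInjective := by
  induction n with
  | zero => exact hn
  | succ n ih =>
    refine ih fun N _ _ ν ρ h => ?_
    obtain ⟨J, _, _, κ, f, hf, hκ, hs, ν', hν'⟩ := h.exists_presentation
    exact RightComodule.HasInjectiveResolution.cokernel n (hn _ _ _ hν') hκ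
      (RightComodule.restrict_isHom _ _ _) hf
      (Submodule.injective_subtype _) (fun x => by simp) hs

theorem isHom_balComodule_map {α : L →ₗ[k] Module.End k Y} {β : L →ₗ[k] Module.End k F}
    {f : Y →ₗ[k] F} (hf : Intertwines α β f) : (D.balComodule α).IsHom (D.balComodule β)
      (Bal.map f LinearMap.id hf (Intertwines.id D.lmul)) := by
  refine Bal.hom_ext fun y x => ?_
  simp only [LinearMap.comp_apply, Bal.map_mk, balComodule_coact_mk, TensorProduct.map_tmul,
    RightComodule.amp_coact_tmul, LinearMap.id_apply]
  generalize D.rightComodule.coact x = s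
  induction s with
  | zero => simp
  | add x y hx hy => simp only [map_add, TensorProduct.tmul_add, hx, hy]
  | tmul m c => simp

/-- If `0 → K → F → Y → 0` is exact and the comodules `K ⊗_L H` and `F ⊗_L H` are injective, then so
is `Y ⊗_L H`. -/
theorem balComodule_isInjective_of_exact {κ : L →ₗ[k] Module.End k K} {φ : L →ₗ[k] Module.End k F}
    {α : L →ₗ[k] Module.End k Y} (hκ : IsRightAct D.mulL D.oneL κ)
    (hφ : IsRightAct D.mulL D.oneL φ) {i : K →ₗ[k] F} {p : F →ₗ[k] Y} (hi : Intertwines κ φ i)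
    (hp : Intertwines φ α p) (hinj : Function.Injective i) (hex : Function.Exact i p)
    (hs : Function.Surjective p) (hK : (D.balComodule κ).IsInjective)
    (hF : (D.balComodule φ).IsInjective) : (D.balComodule α).IsInjective := by
  set I := Bal.map i LinearMap.id hi (Intertwines.id D.lmul) with hI
  set P := Bal.map p LinearMap.id hp (Intertwines.id D.lmul) with hP
  have hIhom : (D.balComodule κ).IsHom (D.balComodule φ) I := D.isHom_balComodule_map hi
  have hPhom : (D.balComodule φ).IsHom (D.balComodule α) P := D.isHom_balComodule_map hp
  have hPs : Function.Surjective P := by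
    intro z
    obtain ⟨t, rfl⟩ := Bal.mk_surjective z
    obtain ⟨t, rfl⟩ := LinearMap.rTensor_surjective H hs t
    exact ⟨Bal.mk _ _ t, rfl⟩
  have hPI : ∀ z, I z ∈ LinearMap.ker P := by
    intro z
    obtain ⟨t, rfl⟩ := Bal.mk_surjective z
    rw [LinearMap.mem_ker, hI, hP]
    induction t with
    | zero => simp
    | add x y hx hy => simp only [map_add, hx, hy, add_zero]
    | tmul m c => simp [hex.apply_apply_eq_zero]
  have hker : ∀ z ∈ LinearMap.ker P, ∃ w, I w = z := by
    intro z hz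
    obtain ⟨z₀, rfl⟩ := Bal.exists_ker_of_map_eq_zero_of_surjective hp hs z hz
    obtain ⟨t, rfl⟩ := Bal.mk_surjective z₀
    clear hz
    induction t with
    | zero => exact ⟨0, by simp⟩
    | add x y hx hy =>
      obtain ⟨a, ha⟩ := hx
      obtain ⟨b, hb⟩ := hy
      exact ⟨a + b, by rw [map_add, map_add, map_add, ha, hb]⟩
    | tmul x h =>
      obtain ⟨y, hy⟩ := (hex _).1 x.2
      exact ⟨Bal.mk _ _ (y ⊗ₜ h), by simp [hI, hy]⟩
  let e : Bal κ D.lmul ≃ₗ[k] LinearMap.ker P := LinearEquiv.ofBijective (I.codRestrict _ hPI)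
    ⟨fun x y hxy => D.left_flat hκ hφ i hi hinj (congrArg Subtype.val hxy), fun z => by
      obtain ⟨w, hw⟩ := hker z z.2
      exact ⟨w, Subtype.ext hw⟩⟩
  have he : (D.balComodule κ).IsHom ((D.balComodule φ).restrict _ hPhom.isSub_ker) e.toLinearMap :=
    RightComodule.isHom_restrict_of_comp _ hIhom
  obtain ⟨s, hs1, hs2⟩ := RightComodule.exists_section_of_isInjective_ker hPhom hPs
    (hK.of_retract e.symm.toLinearMap e.toLinearMap he.symm he (by ext; simp))
  exact hF.of_retract s P hs1 hPhom hs2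

/-! ### From projectivity to injectivity on the other side -/

/-- The comodule `H` over itself. -/
def regular : RightComodule k H H where
  coact := comul
  coassoc := Coalgebra.coassoc
  counit_coact := Coalgebra.lTensor_counit_comp_comul

theorem isModule_regular : D.IsModule D.rmul (regular (k := k) (H := H)) where
  isAct := D.isRightAct_rmul
  coact_act a x := by
    have h1 : ∀ (s : L ⊗[k] H) (t : H ⊗[k] H), actMap D.mul D.mul t (D.i.rTensor H s) =
        actMap D.rmul D.mul.flip s t := fun s t => by
      induction s with
      | zero => simp
      | add x y hx hy => simp only [map_add, LinearMap.add_apply, hx, hy]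
      | tmul a b =>
        induction t with
        | zero => simp
        | add x y hx hy => simp only [map_add, LinearMap.add_apply, hx, hy]
        | tmul c d => simp
    change comul (R := k) (D.mul x (D.i a)) = _
    rw [D.comul_mul, D.comul_i, h1]
    rfl

variable {D} in
theorem IsModule.amp {α : L →ₗ[k] Module.End k N} {ρ : RightComodule k H N} (h : D.IsModule α ρ) :
    D.IsModule (ampAct V α) (ρ.amp V) where
  isAct := h.isAct.amp V
  coact_act g t := by
    induction t with
    | zero => simp
    | add x y hx hy => simp only [map_add, hx, hy]
    | tmul v n =>
      rw [ampAct_tmul, RightComodule.amp_coact_tmul, RightComodule.amp_coact_tmul, h.coact_act,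
        actMap_ampAct_assoc_symm]

variable {D} in
theorem IsModule.quot {α : L →ₗ[k] Module.End k N} {ρ : RightComodule k H N} (h : D.IsModule α ρ)
    (K : Submodule k N) (hK : ∀ r, ∀ x ∈ K, α r x ∈ K) (hK' : ρ.IsSub K) :
    D.IsModule (quotAct α K hK) (ρ.quot K hK') where
  isAct := h.isAct.quot K hK
  coact_act a n := by
    obtain ⟨n, rfl⟩ := K.mkQ_surjective n
    rw [← (ρ.quot_isHom K hK').apply, ← actMap_rTensor (Intertwines.mkQ K hK), ← h.coact_act,
      (ρ.quot_isHom K hK').apply]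
    rfl

theorem isHom_coactLeft : (regular (k := k) (H := H)).IsHom (regular.amp C) D.coactLeft := by
  refine LinearMap.ext fun x => ?_
  have h1 : ∀ t : H ⊗[k] H, D.coactLeft.rTensor H t = (TensorProduct.assoc k C H H).symm
      (D.π.rTensor (H ⊗[k] H) (TensorProduct.assoc k H H H
        ((comul (R := k) (A := H)).rTensor H t))) := fun t => by
    induction t with
    | zero => simp
    | add x y hx hy => simp only [map_add, hx, hy]
    | tmul a b =>
      simp only [LinearMap.rTensor_tmul, coactLeft, LinearMap.comp_apply]
      generalize comul (R := k) a = s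
      induction s with
      | zero => simp
      | add x y hx hy => simp only [map_add, TensorProduct.add_tmul, hx, hy]
      | tmul a b => simp
  have h2 : ∀ t : H ⊗[k] H, D.π.rTensor (H ⊗[k] H) ((comul (R := k) (A := H)).lTensor H t) =
      (comul (R := k) (A := H)).lTensor C (D.π.rTensor H t) := fun t => by
    induction t with
    | zero => simp
    | add x y hx hy => simp only [map_add, hx, hy]
    | tmul a b => simp
  change D.coactLeft.rTensor H (comul (R := k) x) = _
  rw [h1, Coalgebra.coassoc_apply, h2]
  rfl

theorem isHom_cotensorDiff (ρ : RightComodule k C V) : (regular.amp V).IsHom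
    ((regular.amp C).amp V) (cotensorDiff ρ D.coactLeft) :=
  (RightComodule.isHom_assoc_rTensor regular ρ.coact).sub D.isHom_coactLeft.amp

variable {D} in
/-- If the objects of `𝓜_L^H` are projective, then the range of the map defining the cotensor
product `V □ H` is an `L`-linear direct summand, its cokernel being an object of `𝓜_L^H`. -/
theorem AllProjective.exists_retraction (hD : D.AllProjective) (ρ : RightComodule k C V) :
    ∃ r : V ⊗[k] (C ⊗[k] H) →ₗ[k] LinearMap.range (cotensorDiff ρ D.coactLeft),
      Intertwines (ampAct V (ampAct C D.rmul))
        (restrictAct _ _ (D.intertwines_cotensorDiff ρ).mem_range) r ∧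
      r ∘ₗ Submodule.subtype _ = LinearMap.id := by
  set E := LinearMap.range (cotensorDiff ρ D.coactLeft) with hE
  set α := ampAct V (ampAct C D.rmul) with hα
  have hst := (D.intertwines_cotensorDiff ρ).mem_range
  have hZ : D.IsModule α ((regular.amp C).amp V) := D.isModule_regular.amp.amp
  have hQ := hZ.quot E hst (D.isHom_cotensorDiff ρ).isSub_range
  obtain ⟨σ, hσ, hσ'⟩ := hD _ _ _ hQ
  obtain ⟨u, hu⟩ := E.mkQ.exists_rightInverse_of_surjective
    (LinearMap.range_eq_top.2 E.mkQ_surjective)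
  set t := TensorProduct.lift α.flip ∘ₗ u.rTensor L ∘ₗ σ with ht
  have h1 : ∀ w, E.mkQ (TensorProduct.lift α.flip (u.rTensor L w)) =
      TensorProduct.lift (quotAct α E hst).flip w := fun w => by
    induction w with
    | zero => simp
    | add x y hx hy => simp only [map_add, hx, hy]
    | tmul q a =>
      simp only [LinearMap.rTensor_tmul, TensorProduct.lift.tmul, LinearMap.flip_apply]
      have : E.mkQ (u q) = q := LinearMap.congr_fun hu q
      rw [Intertwines.mkQ E hst a (u q), this]
  have h2 : Intertwines (quotAct α E hst) α t := fun a q => by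
    simp only [ht, LinearMap.comp_apply]
    rw [hσ]
    generalize σ q = w
    induction w with
    | zero => simp
    | add x y hx hy => simp only [map_add, hx, hy]
    | tmul q b => simp [hZ.isAct.mul_act]
  have h3 : ∀ z, (LinearMap.id - t ∘ₗ E.mkQ : Module.End k (V ⊗[k] (C ⊗[k] H))) z ∈ E := fun z => by
    rw [← Submodule.Quotient.mk_eq_zero, ← Submodule.mkQ_apply, LinearMap.sub_apply, map_sub,
      LinearMap.comp_apply, ht, LinearMap.comp_apply, LinearMap.comp_apply, h1]
    have := LinearMap.congr_fun hσ' (E.mkQ z)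
    rw [LinearMap.comp_apply] at this
    rw [this, LinearMap.id_apply, LinearMap.id_apply, sub_self]
  refine ⟨LinearMap.codRestrict E (LinearMap.id - t ∘ₗ E.mkQ) h3, fun a z => Subtype.ext ?_,
    LinearMap.ext fun x => Subtype.ext ?_⟩
  · exact ((Intertwines.id α).sub (h2.comp (Intertwines.mkQ E hst))) a z
  · have : E.mkQ (x : V ⊗[k] (C ⊗[k] H)) = 0 := (Submodule.Quotient.mk_eq_zero _).2 x.2
    simp only [LinearMap.comp_apply, LinearMap.codRestrict_apply, LinearMap.sub_apply,
      LinearMap.id_apply, Submodule.subtype_apply]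
    rw [this, map_zero, sub_zero]

variable {D} in
theorem AllProjective.map_range_injective (hD : D.AllProjective) (ρ : RightComodule k C V)
    (β : L →ₗ[k] Module.End k Y) :
    Function.Injective (Bal.map (α := restrictAct (ampAct V (ampAct C D.rmul)) _
      (D.intertwines_cotensorDiff ρ).mem_range) (β := β)
      (LinearMap.range (cotensorDiff ρ D.coactLeft)).subtype LinearMap.id
      (Intertwines.subtype _ _) (Intertwines.id β)) := by
  obtain ⟨r, hr, hr'⟩ := hD.exists_retraction ρ
  have h1 : Bal.map r LinearMap.id hr (Intertwines.id β) ∘ₗ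
      Bal.map (LinearMap.range (cotensorDiff ρ D.coactLeft)).subtype LinearMap.id
      (Intertwines.subtype _ _) (Intertwines.id β) = LinearMap.id := by
    refine Bal.hom_ext fun x y => ?_
    have hx : r x = x := LinearMap.congr_fun hr' x
    simp only [LinearMap.comp_apply, Bal.map_mk, TensorProduct.map_tmul, Submodule.subtype_apply,
      LinearMap.id_apply, hx]
  exact Function.LeftInverse.injective (g := Bal.map r LinearMap.id hr (Intertwines.id β))
    (LinearMap.congr_fun h1)

/-- If the objects of `_L𝓜^H` are projective, then the Hopf modules in `_H𝓜^C` are injective. -/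
theorem allInjective_of_mirror (hD : D.mirror.AllProjective) : D.AllInjective :=
  fun _ _ _ _ _ h => h.isInjective D (D.balComodule_isCoflat _
    fun _ _ _ ω => hD.map_range_injective ω _).isInjective

/-- If the right `L`-module `Y` is flat, then the comodule `Y ⊗_L H` is coflat, hence injective. -/
theorem balComodule_isInjective_of_flat (α : L →ₗ[k] Module.End k Y)
    (hflat : ∀ (N N' : Type u) [AddCommGroup N] [Module k N] [AddCommGroup N'] [Module k N']
      (β : L →ₗ[k] Module.End k N) (β' : L →ₗ[k] Module.End k N'),
      IsRightAct D.mulL.flip D.oneL β → IsRightAct D.mulL.flip D.oneL β' →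
      ∀ (f : N →ₗ[k] N') (hf : Intertwines β β' f), Function.Injective f →
        Function.Injective (Bal.map f LinearMap.id hf (Intertwines.id α))) :
    (D.balComodule α).IsInjective :=
  (D.balComodule_isCoflat α fun W _ _ _ => hflat _ _ _ _
    (((D.mirror.isRightAct_rmul.amp (Cop C)).amp W).restrict _ _)
    ((D.mirror.isRightAct_rmul.amp (Cop C)).amp W) _ _ (Submodule.injective_subtype _)).isInjective

theorem allProjective_mirror_mirror : D.mirror.mirror.AllProjective ↔ D.AllProjective := by
  constructor <;> intro h M _ _ α ρ hM <;> exact h M α ρ ⟨hM.1, hM.2⟩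

end CoidealDatum

/-! ### The antipode reverses the comultiplication -/

section Antipode

variable {k H : Type u} [Field k] [Ring H] [HopfAlgebra k H]

open HopfAlgebra in
/-- `y₍₁₎ S(y₍₂₎) ⊗ y₍₃₎ = 1 ⊗ y`. -/
theorem mul_antipode_comul_tmul (y : H) :
    (LinearMap.mul' k H ∘ₗ (antipode k).lTensor H).rTensor H ((TensorProduct.assoc k H H H).symm
      ((comul (R := k) (A := H)).lTensor H (comul (R := k) y))) = 1 ⊗ₜ y := by
  rw [← Coalgebra.coassoc_apply, LinearEquiv.symm_apply_apply, ← LinearMap.rTensor_comp_apply,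
    LinearMap.comp_assoc, mul_antipode_lTensor_comul, LinearMap.rTensor_comp_apply,
    Coalgebra.rTensor_counit_comul]
  simp

open HopfAlgebra in
theorem comul_antipode (x : H) : comul (R := k) (antipode k x) =
    TensorProduct.map (antipode k) (antipode k) (TensorProduct.comm k H H (comul (R := k) x)) := by
  -- Both sides are convolution inverses of the comultiplication.
  set f : H →ₗ[k] H ⊗[k] H := comul ∘ₗ antipode k with hf
  set g : H →ₗ[k] H ⊗[k] H := TensorProduct.map (antipode k) (antipode k) ∘ₗ
    (TensorProduct.comm k H H).toLinearMap ∘ₗ comul with hg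
  have h1 : WithConv.toConv f * WithConv.toConv (comul (R := k) (A := H)) = 1 := by
    rw [LinearMap.convMul_def, LinearMap.convOne_def]
    congr 1
    refine LinearMap.ext fun x => ?_
    have h2 : ∀ t : H ⊗[k] H, LinearMap.mul' k (H ⊗[k] H) (TensorProduct.map f comul t) =
        comul (LinearMap.mul' k H ((antipode k).rTensor H t)) := fun t => by
      induction t with
      | zero => simp
      | add x y hx hy => simp only [map_add, hx, hy]
      | tmul a b => simp [hf]
    refine (h2 _).trans ?_
    rw [mul_antipode_rTensor_comul_apply]
    simp [Algebra.algebraMap_eq_smul_one, Algebra.TensorProduct.one_def]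
  have h3 : WithConv.toConv (comul (R := k) (A := H)) * WithConv.toConv g = 1 := by
    rw [LinearMap.convMul_def, LinearMap.convOne_def]
    congr 1
    refine LinearMap.ext fun x => ?_
    have h4 : ∀ t : H ⊗[k] H, LinearMap.mul' k (H ⊗[k] H) (TensorProduct.map comul g t) =
        (LinearMap.mul' k H).rTensor H ((TensorProduct.assoc k H H H).symm
          (((TensorProduct.comm k H H).toLinearMap ∘ₗ (antipode k).lTensor H ∘ₗ
            (LinearMap.mul' k H ∘ₗ (antipode k).lTensor H).rTensor H ∘ₗ
              (TensorProduct.assoc k H H H).symm.toLinearMap ∘ₗ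
                (comul (R := k) (A := H)).lTensor H).lTensor H
            (TensorProduct.assoc k H H H ((comul (R := k) (A := H)).rTensor H t)))) := fun t => by
      induction t with
      | zero => simp
      | add x y hx hy => simp only [map_add, hx, hy]
      | tmul a b =>
        simp only [TensorProduct.map_tmul, LinearMap.rTensor_tmul, LinearMap.mul'_apply, hg,
          LinearMap.comp_apply]
        generalize comul (R := k) a = s
        induction s with
        | zero => simp
        | add x y hx hy => simp only [map_add, TensorProduct.add_tmul, add_mul, hx, hy]
        | tmul c d =>
          simp only [TensorProduct.assoc_tmul, LinearMap.lTensor_tmul, LinearMap.comp_apply]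
          generalize comul (R := k) b = s
          induction s with
          | zero => simp
          | add x y hx hy => simp only [map_add, TensorProduct.tmul_add, mul_add, hx, hy]
          | tmul a b => simp
    refine (h4 _).trans ?_
    rw [Coalgebra.coassoc_apply]
    have h5 : ∀ t : H ⊗[k] H, (LinearMap.mul' k H).rTensor H ((TensorProduct.assoc k H H H).symm
          (((TensorProduct.comm k H H).toLinearMap ∘ₗ (antipode k).lTensor H ∘ₗ
            (LinearMap.mul' k H ∘ₗ (antipode k).lTensor H).rTensor H ∘ₗ
              (TensorProduct.assoc k H H H).symm.toLinearMap ∘ₗ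
                (comul (R := k) (A := H)).lTensor H).lTensor H
            ((comul (R := k) (A := H)).lTensor H t))) =
        LinearMap.mul' k H ((antipode k).lTensor H t) ⊗ₜ 1 := fun t => by
      induction t with
      | zero => simp
      | add x y hx hy => simp only [map_add, TensorProduct.add_tmul, hx, hy]
      | tmul a b =>
        simp only [LinearMap.lTensor_tmul, LinearMap.comp_apply, LinearEquiv.coe_coe,
          mul_antipode_comul_tmul]
        simp
    rw [h5, mul_antipode_lTensor_comul_apply]
    simp [Algebra.algebraMap_eq_smul_one, Algebra.TensorProduct.one_def, TensorProduct.smul_tmul']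
  have h6 := left_inv_eq_right_inv h1 h3
  exact LinearMap.congr_fun (WithConv.toConv_injective h6) x

end Antipode

/-! ### Comparison with modules over a ring -/

section Modules

variable {k R : Type u} [Field k] [Ring R] [Algebra k R]

/-- A right action by operators as a module over the opposite ring. -/
abbrev IsRightAct.rightModule {N : Type u} [AddCommGroup N] [Module k N]
    {α : R →ₗ[k] Module.End k N} (h : IsRightAct (LinearMap.mul k R) 1 α) : Module Rᵐᵒᵖ N where
  smul r n := α r.unop n
  one_smul := h.one_act
  mul_smul r s n := h.mul_act s.unop r.unop n
  smul_zero r := map_zero _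
  smul_add r := map_add _
  add_smul r s n := by
    change α (r.unop + s.unop) n = _
    rw [map_add]
    rfl
  zero_smul n := by
    change α 0 n = _
    rw [map_zero]
    rfl

/-- A left action by operators as a module. -/
abbrev IsRightAct.leftModule {N : Type u} [AddCommGroup N] [Module k N]
    {α : R →ₗ[k] Module.End k N} (h : IsRightAct (LinearMap.mul k R).flip 1 α) : Module R N where
  smul r n := α r n
  one_smul := h.one_act
  mul_smul r s n := h.mul_act s r n
  smul_zero r := map_zero _
  smul_add r := map_add _
  add_smul r s n := by
    change α (r + s) n = _
    rw [map_add]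
    rfl
  zero_smul n := by
    change α 0 n = _
    rw [map_zero]
    rfl

/-- The tensor product over `R` formed from `N ⊗_ℤ M` agrees with the one formed
from `N ⊗_k M`. -/
theorem exists_balancedEquiv {N M : Type u} [AddCommGroup N] [Module k N] [AddCommGroup M]
    [Module k M] [Module Rᵐᵒᵖ N] [Module R M] {α : R →ₗ[k] Module.End k N}
    {β : R →ₗ[k] Module.End k M} (hα : ∀ r n, MulOpposite.op r • n = α r n)
    (hβ : ∀ r m, r • m = β r m) : ∃ e : BalancedTensor R N M ≃+ Bal α β,
    ∀ n m, e (QuotientAddGroup.mk (n ⊗ₜ m)) = Bal.mk α β (n ⊗ₜ m) := by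
  let F₀ : N ⊗[ℤ] M →+ Bal α β := TensorProduct.liftAddHom
    (AddMonoidHom.mk' (fun n => ((Bal.mk α β).toAddMonoidHom.comp
      (TensorProduct.mk k N M n).toAddMonoidHom)) fun a b => by
        ext m
        simp) fun r n m => by
      simp
  let F : BalancedTensor R N M →+ Bal α β := QuotientAddGroup.lift _ F₀ (by
    refine (AddSubgroup.closure_le _).mpr ?_
    rintro _ ⟨n, r, m, rfl⟩
    change F₀ _ = 0
    rw [map_sub, sub_eq_zero]
    change Bal.mk α β ((MulOpposite.op r • n) ⊗ₜ m) = Bal.mk α β (n ⊗ₜ (r • m))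
    rw [hα, hβ, Bal.mk_act])
  have hbal : ∀ (n : N) (r : R) (m : M), (QuotientAddGroup.mk ((MulOpposite.op r • n) ⊗ₜ[ℤ] m) :
      BalancedTensor R N M) = QuotientAddGroup.mk (n ⊗ₜ[ℤ] (r • m)) := fun n r m => by
    rw [← sub_eq_zero, ← QuotientAddGroup.mk_sub, QuotientAddGroup.eq_zero_iff]
    exact AddSubgroup.subset_closure ⟨n, r, m, rfl⟩
  have hk : ∀ (c : k) (n : N), MulOpposite.op (c • (1 : R)) • n = c • n := fun c n => by
    rw [hα, map_smul, LinearMap.smul_apply, ← hα, MulOpposite.op_one, one_smul]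
  have hk' : ∀ (c : k) (m : M), (c • (1 : R)) • m = c • m := fun c m => by
    rw [hβ, map_smul, LinearMap.smul_apply, ← hβ, one_smul]
  let G₀ : N ⊗[k] M →+ BalancedTensor R N M := TensorProduct.liftAddHom
    (AddMonoidHom.mk' (fun n => ((QuotientAddGroup.mk' (balancedRel R N M)).comp
      (TensorProduct.mk ℤ N M n).toAddMonoidHom)) fun a b => by
        ext m
        simp) fun c n m => by
      change (QuotientAddGroup.mk ((c • n) ⊗ₜ[ℤ] m) : BalancedTensor R N M) =
        QuotientAddGroup.mk (n ⊗ₜ[ℤ] (c • m))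
      rw [← hk, hbal, hk']
  let G : Bal α β →+ BalancedTensor R N M := QuotientAddGroup.lift
    (balSub α β).toAddSubgroup G₀ (by
      intro t ht
      have ht' : t ∈ balSub α β := ht
      refine Submodule.closure_induction (p := fun t _ => G₀ t = 0) ?_ ?_ ?_ ht'
      · simp
      · intro x y _ _ hx hy
        rw [map_add, hx, hy, add_zero]
      · rintro c _ ⟨n, r, m, rfl⟩
        rw [smul_sub, TensorProduct.smul_tmul', TensorProduct.smul_tmul', ← map_smul, map_sub,
          sub_eq_zero, ← hα, ← hβ]
        exact hbal (c • n) r m)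
  refine ⟨⟨⟨F, G, fun z => ?_, fun z => ?_⟩, map_add F⟩, fun n m => rfl⟩
  · obtain ⟨t, rfl⟩ := QuotientAddGroup.mk_surjective z
    induction t with
    | zero => exact (congrArg G (map_zero F)).trans (map_zero G)
    | add x y hx hy =>
      rw [QuotientAddGroup.mk_add, map_add, map_add, hx, hy]
    | tmul n m => rfl
  · obtain ⟨t, rfl⟩ := Bal.mk_surjective z
    induction t with
    | zero => exact (congrArg F (map_zero G)).trans (map_zero F)
    | add x y hx hy => rw [map_add, map_add, map_add, hx, hy]
    | tmul n m => rfl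

theorem LeftFlat.bal_map_injective {M : Type u} [AddCommGroup M] [Module k M] [Module R M]
    (hM : LeftFlat R M) {β : R →ₗ[k] Module.End k M} (hβ : ∀ r m, r • m = β r m)
    {N N' : Type u} [AddCommGroup N] [Module k N] [AddCommGroup N'] [Module k N']
    {α : R →ₗ[k] Module.End k N} {α' : R →ₗ[k] Module.End k N'}
    (hα : IsRightAct (LinearMap.mul k R) 1 α) (hα' : IsRightAct (LinearMap.mul k R) 1 α')
    (f : N →ₗ[k] N') (hf : Intertwines α α' f) (hinj : Function.Injective f) :
    Function.Injective (Bal.map f LinearMap.id hf (Intertwines.id β)) := by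
  let _ := hα.rightModule
  let _ := hα'.rightModule
  obtain ⟨e, he⟩ := exists_balancedEquiv (α := α) (β := β) (fun _ _ => rfl) hβ
  obtain ⟨e', he'⟩ := exists_balancedEquiv (α := α') (β := β) (fun _ _ => rfl) hβ
  let g : N →ₗ[Rᵐᵒᵖ] N' := { f with map_smul' := fun r n => hf r.unop n }
  have h1 : ∀ z, e' (BalancedTensor.mapLeft R M g z) =
      Bal.map f LinearMap.id hf (Intertwines.id β) (e z) := fun z => by
    obtain ⟨t, rfl⟩ := QuotientAddGroup.mk_surjective z
    induction t with
    | zero => simp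
    | add x y hx hy => simp only [QuotientAddGroup.mk_add, map_add, hx, hy]
    | tmul n m =>
      rw [he]
      exact he' _ _
  have h2 := hM N N' g hinj
  intro x y hxy
  obtain ⟨x, rfl⟩ := e.surjective x
  obtain ⟨y, rfl⟩ := e.surjective y
  rw [← h1, ← h1] at hxy
  rw [h2 (e'.injective hxy)]

theorem RightFlat.bal_map_injective {M : Type u} [AddCommGroup M] [Module k M] [Module Rᵐᵒᵖ M]
    (hM : RightFlat R M) {β : R →ₗ[k] Module.End k M}
    (hβ : ∀ r m, MulOpposite.op r • m = β r m)
    {N N' : Type u} [AddCommGroup N] [Module k N] [AddCommGroup N'] [Module k N']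
    {α : R →ₗ[k] Module.End k N} {α' : R →ₗ[k] Module.End k N'}
    (hα : IsRightAct (LinearMap.mul k R).flip 1 α) (hα' : IsRightAct (LinearMap.mul k R).flip 1 α')
    (f : N →ₗ[k] N') (hf : Intertwines α α' f) (hinj : Function.Injective f) :
    Function.Injective (Bal.map f LinearMap.id hf (Intertwines.id β)) := by
  let _ := hα.leftModule
  let _ := hα'.leftModule
  obtain ⟨e, he⟩ := exists_balancedEquiv (α := β) (β := α) hβ (fun _ _ => rfl)
  obtain ⟨e', he'⟩ := exists_balancedEquiv (α := β) (β := α') hβ (fun _ _ => rfl)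
  let g : N →ₗ[R] N' := { f with map_smul' := fun r n => hf r n }
  have h1 : ∀ z, Bal.comm β α' (e' (BalancedTensor.mapRight R M g z)) =
      Bal.map f LinearMap.id hf (Intertwines.id β) (Bal.comm β α (e z)) := fun z => by
    obtain ⟨t, rfl⟩ := QuotientAddGroup.mk_surjective z
    induction t with
    | zero => simp
    | add x y hx hy => simp only [QuotientAddGroup.mk_add, map_add, hx, hy]
    | tmul n m =>
      rw [he]
      exact congrArg _ (he' _ _)
  have h2 := hM N N' g hinj
  intro x y hxy
  obtain ⟨x, rfl⟩ := (Bal.comm β α).surjective x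
  obtain ⟨x, rfl⟩ := e.surjective x
  obtain ⟨y, rfl⟩ := (Bal.comm β α).surjective y
  obtain ⟨y, rfl⟩ := e.surjective y
  rw [← h1, ← h1] at hxy
  rw [h2 (e'.injective ((Bal.comm β α').injective hxy))]

theorem LeftFaithfullyFlat.subsingleton_of_bal {M : Type u} [AddCommGroup M] [Module k M]
    [Module R M] (hM : LeftFaithfullyFlat R M) {β : R →ₗ[k] Module.End k M}
    (hβ : ∀ r m, r • m = β r m) {N : Type u} [AddCommGroup N] [Module k N]
    {α : R →ₗ[k] Module.End k N} (hα : IsRightAct (LinearMap.mul k R) 1 α)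
    (h : Subsingleton (Bal α β)) : Subsingleton N := by
  let _ := hα.rightModule
  obtain ⟨e, -⟩ := exists_balancedEquiv (α := α) (β := β) (fun _ _ => rfl) hβ
  exact hM.2 N e.toEquiv.subsingleton

theorem RightFaithfullyFlat.subsingleton_of_bal {M : Type u} [AddCommGroup M] [Module k M]
    [Module Rᵐᵒᵖ M] (hM : RightFaithfullyFlat R M) {β : R →ₗ[k] Module.End k M}
    (hβ : ∀ r m, MulOpposite.op r • m = β r m) {N : Type u} [AddCommGroup N] [Module k N]
    {α : R →ₗ[k] Module.End k N} (hα : IsRightAct (LinearMap.mul k R).flip 1 α)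
    (h : Subsingleton (Bal α β)) : Subsingleton N := by
  let _ := hα.leftModule
  obtain ⟨e, -⟩ := exists_balancedEquiv (α := β) (β := α) hβ (fun _ _ => rfl)
  exact hM.2 N (e.toEquiv.trans (Bal.comm β α).toEquiv).subsingleton

/-- If the action of `B` splits off `M` linearly from `B ⊗ M`, then `M` is a projective
`B`-module. -/
theorem projective_of_leftAct_section {B M : Type u} [Ring B] [Algebra k B] [AddCommGroup M]
    [Module k M] [Module B M] [IsScalarTower k B M] (σ : M →ₗ[k] B ⊗[k] M)
    (hσ : ∀ (b : B) (m : M), σ (b • m) = b • σ m) (hσ' : ∀ m, leftAct k B M (σ m) = m) :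
    Module.Projective B M := by
  let s : M →ₗ[B] B ⊗[k] M := { σ with map_smul' := hσ }
  let p : B ⊗[k] M →ₗ[B] M :=
    { leftAct k B M with
      map_smul' := fun b t => by
        simp only [AddHom.toFun_eq_coe, LinearMap.coe_toAddHom, RingHom.id_apply]
        induction t with
        | zero => simp
        | add x y hx hy => simp only [smul_add, map_add, hx, hy]
        | tmul a m => simp [leftAct, TensorProduct.smul_tmul'] }
  exact Module.Projective.of_split s p (LinearMap.ext hσ')

end Modules

/-! ### The datum of a right coideal subalgebra -/

section Datum

variable {k H : Type u} [Field k] [Ring H] [HopfAlgebra k H]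

open HopfAlgebra in
/-- The structure maps of a right coideal subalgebra `A` of `H` and of the factor coalgebra
`H / H A⁺`. -/
def coidealDatum (hS : Function.Bijective (antipode k : H →ₗ[k] H)) (A : Subalgebra k H)
    [IsRightCoideal A] (hleft : LeftFaithfullyFlat A H) (hright : RightFaithfullyFlat A H) :
    CoidealDatum k H A (FactorCoalgebra A) where
  mul := LinearMap.mul k H
  one := 1
  S := antipode k
  T := (LinearEquiv.ofBijective (antipode k) hS).symm.toLinearMap
  mulL := LinearMap.mul k A
  oneL := 1
  i := A.val.toLinearMap
  δ := coidealCoact A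
  π := ((augmentationLeftIdeal A).restrictScalars k).mkQ
  act := (Algebra.lsmul k k (FactorCoalgebra A) : H →ₐ[k] _).toLinearMap
  mul_assoc := mul_assoc
  one_mul := one_mul
  mul_one := mul_one
  comul_mul x y := by
    rw [LinearMap.mul_apply', Bialgebra.comul_mul]
    generalize comul (R := k) x = s
    generalize comul (R := k) y = t
    induction s with
    | zero => simp
    | add a b ha hb => simp only [map_add, LinearMap.add_apply, add_mul, ha, hb]
    | tmul a b =>
      induction t with
      | zero => simp
      | add a b ha hb => simp only [map_add, mul_add, ha, hb]
      | tmul c d => simp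
  comul_one := Bialgebra.comul_one
  counit_one := Bialgebra.counit_one
  counit_mul := Bialgebra.counit_mul
  S_T := (LinearEquiv.ofBijective (antipode k) hS).apply_symm_apply
  T_S := (LinearEquiv.ofBijective (antipode k) hS).symm_apply_apply
  S_mul := antipode_mul_antidistrib
  S_one := antipode_one
  counit_S := counit_antipode
  comul_S := comul_antipode
  S_left x := by
    have h : TensorProduct.lift (LinearMap.mul k H ∘ₗ antipode k) =
        LinearMap.mul' k H ∘ₗ (antipode k).rTensor H := TensorProduct.ext' fun a b => by simp
    rw [h, LinearMap.comp_apply, mul_antipode_rTensor_comul_apply, Algebra.algebraMap_eq_smul_one]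
  S_right x := by
    have h : TensorProduct.lift ((LinearMap.mul k H).compl₂ (antipode k)) =
        LinearMap.mul' k H ∘ₗ (antipode k).lTensor H := TensorProduct.ext' fun a b => by simp
    rw [h, LinearMap.comp_apply, mul_antipode_lTensor_comul_apply, Algebra.algebraMap_eq_smul_one]
  i_injective := Subtype.val_injective
  i_mul _ _ := rfl
  i_one := rfl
  mulL_assoc := mul_assoc
  mulL_one := mul_one
  oneL_mul := one_mul
  comul_i a := (rTensor_coidealCoact A a).symm
  π_surjective := Submodule.mkQ_surjective _
  comul_π _ := rfl
  counit_π _ := rfl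
  act_π _ _ := rfl
  π_mul_i h a := by
    rw [← map_smul, ← sub_eq_zero, ← map_sub, Submodule.mkQ_apply, Submodule.Quotient.mk_eq_zero]
    have h1 : (LinearMap.mul k H) h (A.val.toLinearMap a) -
        counit (R := k) (A.val.toLinearMap a) • h =
        h * ((a : H) - counit (R := k) (a : H) • 1) := by simp [mul_sub]
    rw [h1]
    refine (augmentationLeftIdeal A).mul_mem_left h (Ideal.subset_span ⟨?_, ?_⟩)
    · exact A.sub_mem a.2 (A.smul_mem A.one_mem _)
    · simp
  mem_span_of_π x hx := by
    have hx' : x ∈ augmentationLeftIdeal A := (Submodule.Quotient.mk_eq_zero _).1 hx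
    refine Submodule.closure_induction (p := fun x _ => x ∈ Submodule.span k
      {y | ∃ (h : H) (a : A), counit (R := k) (a : H) = 0 ∧ y = h * a}) ?_ ?_ ?_ hx'
    · exact zero_mem _
    · intro x y _ _ hx hy
      exact add_mem hx hy
    · rintro h a ⟨ha, ha0⟩
      exact Submodule.subset_span ⟨h, ⟨a, ha⟩, ha0, rfl⟩
  left_flat hα hα' f hf hinj :=
    hleft.1.bal_map_injective (fun _ _ => rfl) hα hα' f hf hinj
  left_faithful hα h := hleft.subsingleton_of_bal (fun _ _ => rfl) hα h
  right_flat hα hα' f hf hinj :=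
    hright.1.bal_map_injective (fun _ _ => rfl) hα hα' f hf hinj
  right_faithful hα h := hright.subsingleton_of_bal (fun _ _ => rfl) hα h

end Datum

/-! ### Hopf modules and their structure maps -/

section HopfModules

variable {k R R' M N : Type u} [Field k] [Ring R] [Algebra k R] [Ring R'] [Algebra k R']
  [AddCommGroup M] [Module k M] [AddCommGroup N] [Module k N]

/-- The diagonal action on `M ⊗ N`, written in terms of the action maps. -/
theorem map_lift_tensorTensorTensorComm {X Y : Type u} [AddCommGroup X] [Module k X]
    [AddCommGroup Y] [Module k Y] (f : X →ₗ[k] Module.End k M) (g : Y →ₗ[k] Module.End k N)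
    (s : X ⊗[k] Y) (t : M ⊗[k] N) : TensorProduct.map (TensorProduct.lift f)
      (TensorProduct.lift g) (TensorProduct.tensorTensorTensorComm k X Y M N (s ⊗ₜ t)) =
        actMap f g s t := by
  induction s with
  | zero => simp
  | add a b ha hb => simp only [map_add, LinearMap.add_apply, TensorProduct.add_tmul, ha, hb]
  | tmul a b =>
    induction t with
    | zero => simp
    | add a b ha hb => simp only [map_add, TensorProduct.tmul_add, ha, hb]
    | tmul c d => simp

/-- The diagonal action on `M ⊗ N` for operators that are written on the right. -/
theorem map_lift_flip_tensorTensorTensorComm {X Y : Type u} [AddCommGroup X] [Module k X]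
    [AddCommGroup Y] [Module k Y] (f : X →ₗ[k] Module.End k M) (g : Y →ₗ[k] Module.End k N)
    (s : X ⊗[k] Y) (t : M ⊗[k] N) : TensorProduct.map (TensorProduct.lift f.flip)
      (TensorProduct.lift g.flip) (TensorProduct.tensorTensorTensorComm k M N X Y (t ⊗ₜ s)) =
        actMap f g s t := by
  induction s with
  | zero => simp
  | add a b ha hb => simp only [map_add, LinearMap.add_apply, TensorProduct.tmul_add, ha, hb]
  | tmul a b =>
    induction t with
    | zero => simp
    | add a b ha hb => simp only [map_add, TensorProduct.add_tmul, ha, hb]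
    | tmul c d => simp

variable (k R M) in
/-- The operators on a left `R`-module. -/
abbrev leftOps [Module R M] [IsScalarTower k R M] : R →ₗ[k] Module.End k M :=
  (Algebra.lsmul k k M : R →ₐ[k] Module.End k M).toLinearMap

variable (k R M) in
/-- The operators on a right `R`-module. -/
abbrev rightOps [Module Rᵐᵒᵖ M] [IsScalarTower k Rᵐᵒᵖ M] : R →ₗ[k] Module.End k M :=
  (Algebra.lsmul k k M : Rᵐᵒᵖ →ₐ[k] Module.End k M).toLinearMap ∘ₗ
    (MulOpposite.opLinearEquiv k : R ≃ₗ[k] Rᵐᵒᵖ).toLinearMap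

theorem isRightAct_leftOps [Module R M] [IsScalarTower k R M] :
    IsRightAct (LinearMap.mul k R).flip 1 (leftOps k R M) where
  one_act := one_smul R
  mul_act a b := mul_smul b a

theorem isRightAct_rightOps [Module Rᵐᵒᵖ M] [IsScalarTower k Rᵐᵒᵖ M] :
    IsRightAct (LinearMap.mul k R) 1 (rightOps k R M) where
  one_act := one_smul Rᵐᵒᵖ
  mul_act a b := mul_smul (MulOpposite.op b) (MulOpposite.op a)

end HopfModules

section Transfer

variable {k C E V W : Type u} [Field k] [AddCommGroup C] [Module k C] [Coalgebra k C]
  [AddCommGroup E] [Module k E] [Coalgebra k E] [AddCommGroup V] [Module k V]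
  [AddCommGroup W] [Module k W]

theorem LeftComodule.isHom_toRight (f : C ≃ₗ[k] E) (hf) (hf') {ν : LeftComodule k C V}
    {ν' : LeftComodule k C W} {g : V →ₗ[k] W} :
    (ν.toRight f hf hf').IsHom (ν'.toRight f hf hf') g ↔ ν.IsHom ν' g := by
  have h1 : ∀ t : C ⊗[k] V, g.rTensor E (f.toLinearMap.lTensor V (TensorProduct.comm k C V t)) =
      f.toLinearMap.lTensor W (TensorProduct.comm k C W (g.lTensor C t)) := fun t => by
    induction t with
    | zero => simp
    | add x y hx hy => simp only [map_add, hx, hy]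
    | tmul c v => simp
  have hinj : Function.Injective (f.toLinearMap.lTensor W) :=
    Module.Flat.lTensor_preserves_injective_linearMap _ f.injective
  constructor
  · intro h
    refine LinearMap.ext fun v => (TensorProduct.comm k C W).injective (hinj ?_)
    exact (h1 _).symm.trans (LinearMap.congr_fun h v)
  · intro h
    refine LinearMap.ext fun v => (h1 _).trans ?_
    exact congrArg (fun t => f.toLinearMap.lTensor W (TensorProduct.comm k C W t))
      (LinearMap.congr_fun h v)

theorem LeftComodule.isInjective_of_toRight (f : C ≃ₗ[k] E) (hf) (hf') {ν : LeftComodule k C V}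
    (h : (ν.toRight f hf hf').IsInjective) : ν.IsInjective := by
  intro X Y _ _ _ _ σ τ i g hi hinj hg
  obtain ⟨e, he, hei⟩ := h X Y (σ.toRight f hf hf') (τ.toRight f hf hf') i g
    ((isHom_toRight f hf hf').2 hi) hinj ((isHom_toRight f hf hf').2 hg)
  exact ⟨e, (isHom_toRight f hf hf').1 he, hei⟩

end Transfer

/-! ### The four classes of Hopf modules -/

section Comparison

variable {k H : Type u} [Field k] [Ring H] [HopfAlgebra k H]
  {hS : Function.Bijective (HopfAlgebra.antipode k : H →ₗ[k] H)} {A : Subalgebra k H}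
  [IsRightCoideal A] {hleft : LeftFaithfullyFlat A H} {hright : RightFaithfullyFlat A H}
  {M : Type u} [AddCommGroup M] [Module k M]

theorem projective_of_isHopfModuleRightRight [Module (A)ᵐᵒᵖ M] [IsScalarTower k (A)ᵐᵒᵖ M]
    (hD : (coidealDatum hS A hleft hright).AllProjective) (ρ : RightComodule k H M)
    (hρ : IsHopfModuleRightRight A ρ) : Module.Projective (A)ᵐᵒᵖ M := by
  obtain ⟨σ, hσ, hσ'⟩ := hD M (rightOps k A M) ρ ⟨isRightAct_rightOps, fun a m => by
    rw [← map_lift_flip_tensorTensorTensorComm]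
    exact hρ m a⟩
  let e : M ⊗[k] A ≃ₗ[k] (A)ᵐᵒᵖ ⊗[k] M := TensorProduct.comm k M A ≪≫ₗ
    TensorProduct.congr (MulOpposite.opLinearEquiv k) (LinearEquiv.refl k M)
  have h1 : ∀ (a : A) (t : M ⊗[k] A), e (ampAct M (LinearMap.mul k A).flip a t) =
      MulOpposite.op a • e t := fun a t => by
    induction t with
    | zero => simp
    | add x y hx hy => simp only [map_add, smul_add, hx, hy]
    | tmul m b => simp [e, TensorProduct.smul_tmul']
  have h2 : ∀ t : M ⊗[k] A, leftAct k (A)ᵐᵒᵖ M (e t) =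
      TensorProduct.lift (rightOps k A M).flip t := fun t => by
    induction t with
    | zero => simp
    | add x y hx hy => simp only [map_add, hx, hy]
    | tmul m b => simp [e, leftAct]
  refine projective_of_leftAct_section (e.toLinearMap ∘ₗ σ) (fun b m => ?_) fun m => ?_
  · refine Eq.trans ?_ (h1 b.unop (σ m))
    exact congrArg e (hσ b.unop m)
  · exact (h2 _).trans (LinearMap.congr_fun hσ' m)

theorem projective_of_isHopfModuleLeftRight [Module A M] [IsScalarTower k A M]
    (hD : (coidealDatum hS A hleft hright).mirror.AllProjective) (ρ : RightComodule k H M)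
    (hρ : IsHopfModuleLeftRight A ρ) : Module.Projective A M := by
  obtain ⟨σ, hσ, hσ'⟩ := hD M (leftOps k A M) ρ ⟨isRightAct_leftOps, fun a m => by
    refine Eq.trans ?_ (map_lift_tensorTensorTensorComm _ _ _ _)
    exact hρ a m⟩
  have h1 : ∀ (a : A) (t : M ⊗[k] A), TensorProduct.comm k M A
      (ampAct M (LinearMap.mul k A) a t) = a • TensorProduct.comm k M A t := fun a t => by
    induction t with
    | zero => simp
    | add x y hx hy => simp only [map_add, smul_add, hx, hy]
    | tmul m b => simp [TensorProduct.smul_tmul']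
  have h2 : ∀ t : M ⊗[k] A, leftAct k A M (TensorProduct.comm k M A t) =
      TensorProduct.lift (leftOps k A M).flip t := fun t => by
    induction t with
    | zero => simp
    | add x y hx hy => simp only [map_add, hx, hy]
    | tmul m b => simp [leftAct]
  refine projective_of_leftAct_section ((TensorProduct.comm k M A).toLinearMap ∘ₗ σ)
    (fun b m => ?_) fun m => ?_
  · refine Eq.trans ?_ (h1 b (σ m))
    exact congrArg (TensorProduct.comm k M A) (hσ b m)
  · exact (h2 _).trans (LinearMap.congr_fun hσ' m)

theorem isInjective_of_isHopfModuleLeftRightQuot [Module H M] [IsScalarTower k H M]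
    (hD : (coidealDatum hS A hleft hright).AllInjective) (ρ : RightComodule k (FactorCoalgebra A) M)
    (hρ : IsHopfModuleLeftRightQuot (H := H) (FactorCoalgebra A) ρ) : ρ.IsInjective := by
  refine hD M (leftOps k H M) ρ ⟨isRightAct_leftOps, fun h m => ?_⟩
  refine Eq.trans ?_ (map_lift_tensorTensorTensorComm _ _ _ _)
  exact hρ h m

theorem isInjective_of_isHopfModuleLeftLeft [Module H M] [IsScalarTower k H M]
    (hD : (coidealDatum hS A hleft hright).mirror.AllInjective)
    (ρ : LeftComodule k (FactorCoalgebra A) M)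
    (hρ : IsHopfModuleLeftLeft (H := H) (FactorCoalgebra A) ρ) : ρ.IsInjective := by
  set D := coidealDatum hS A hleft hright with hDdef
  have hf : ∀ c, comul (R := k) (toCop k (FactorCoalgebra A) c) =
      TensorProduct.map (toCop k (FactorCoalgebra A)).toLinearMap
        (toCop k (FactorCoalgebra A)).toLinearMap
        (TensorProduct.comm k _ _ (comul (R := k) c)) := fun c => rfl
  have hf' : ∀ c, counit (R := k) (toCop k (FactorCoalgebra A) c) = counit (R := k) c :=
    fun c => rfl
  refine LeftComodule.isInjective_of_toRight (toCop k (FactorCoalgebra A)) hf hf' ?_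
  -- The left action becomes a right one through the inverse of the antipode.
  refine hD M (leftOps k H M ∘ₗ D.T) _ ⟨⟨fun m => ?_, fun a b m => ?_⟩, fun h m => ?_⟩
  · change D.T D.one • m = m
    rw [D.T_one]
    exact one_smul H m
  · change D.T (D.mul a b) • m = D.T b • D.T a • m
    rw [D.T_mul]
    exact mul_smul _ _ m
  · have h1 : ρ.coact (D.T h • m) = actMap (leftOps k H (FactorCoalgebra A)) (leftOps k H M)
        (comul (R := k) (D.T h)) (ρ.coact m) :=
      (hρ _ m).trans (map_lift_tensorTensorTensorComm _ _ _ _)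
    rw [D.comul_T] at h1
    have h2 : ∀ (s : H ⊗[k] H) (t : FactorCoalgebra A ⊗[k] M),
        (toCop k (FactorCoalgebra A)).toLinearMap.lTensor M (TensorProduct.comm k _ M
          (actMap (leftOps k H (FactorCoalgebra A)) (leftOps k H M)
            (TensorProduct.map D.T D.T (TensorProduct.comm k H H s)) t)) =
        actMap (leftOps k H M ∘ₗ D.T) D.mirror.act s
          ((toCop k (FactorCoalgebra A)).toLinearMap.lTensor M (TensorProduct.comm k _ M t)) :=
      fun s t => by
        induction s with
        | zero => simp
        | add x y hx hy => simp only [map_add, LinearMap.add_apply, hx, hy]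
        | tmul a b =>
          induction t with
          | zero => simp
          | add x y hx hy => simp only [map_add, hx, hy]
          | tmul c n => rfl
    refine Eq.trans ?_ (h2 _ (ρ.coact m))
    exact congrArg (fun t => (toCop k (FactorCoalgebra A)).toLinearMap.lTensor M
      (TensorProduct.comm k _ M t)) h1

/-- For a left `A`-module `Y` of finite flat dimension, the comodule `H ⊗_A Y` is injective. -/
theorem balComodule_isInjective_of_hasFlatResolution (n : ℕ) :
    ∀ (Y : Type u) [AddCommGroup Y] [Module k Y] [Module A Y] [IsScalarTower k A Y],
      HasFlatResolution A n Y →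
        ((coidealDatum hS A hleft hright).mirror.balComodule (leftOps k A Y)).IsInjective := by
  induction n with
  | zero =>
    intro Y _ _ _ _ hY
    exact (coidealDatum hS A hleft hright).mirror.balComodule_isInjective_of_flat _
      fun N N' _ _ _ _ β β' hβ hβ' f hf hinj =>
        LeftFlat.bal_map_injective hY (fun _ _ => rfl) hβ hβ' f hf hinj
  | succ n ih =>
    rintro Y _ _ _ _ ⟨K, F, _, _, _, _, i, p, hi, hex, hp, hF, hK⟩
    let _ : Module k K := Module.compHom K (algebraMap k A)
    let _ : Module k F := Module.compHom F (algebraMap k A)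
    have : IsScalarTower k A K := IsScalarTower.of_algebraMap_smul fun _ _ => rfl
    have : IsScalarTower k A F := IsScalarTower.of_algebraMap_smul fun _ _ => rfl
    refine (coidealDatum hS A hleft hright).mirror.balComodule_isInjective_of_exact
      (κ := leftOps k A K) (φ := leftOps k A F) (i := i.restrictScalars k)
      (p := p.restrictScalars k) isRightAct_leftOps isRightAct_leftOps (fun a x => map_smul i a x)
      (fun a x => map_smul p a x) hi hex hp (ih K hK) ?_
    exact (coidealDatum hS A hleft hright).mirror.balComodule_isInjective_of_flat _
      fun N N' _ _ _ _ β β' hβ hβ' f hf hinj =>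
        LeftFlat.bal_map_injective hF (fun _ _ => rfl) hβ hβ' f hf hinj

/-- If `A` has finite weak global dimension, then the objects of `_H^C𝓜` are injective comodules, as
retracts of comodules `H ⊗_A Y`. -/
theorem allInjective_mirror_of_hasFiniteWeakGlobalDimension
    (h : HasFiniteWeakGlobalDimension A) :
    (coidealDatum hS A hleft hright).mirror.AllInjective := by
  obtain ⟨n, hn⟩ := h
  intro N _ _ ν ρ hN
  refine hN.isInjective _ ?_
  have hact := (coidealDatum hS A hleft hright).mirror.isRightAct_cotAct ρ
  let _ : Module A ((coidealDatum hS A hleft hright).mirror.cot ρ) :=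
    IsRightAct.leftModule (R := A) hact
  have : IsScalarTower k A ((coidealDatum hS A hleft hright).mirror.cot ρ) := ⟨fun c a y => by
    change (coidealDatum hS A hleft hright).mirror.cotAct ρ (c • a) y = _
    rw [map_smul]
    rfl⟩
  exact balComodule_isInjective_of_hasFlatResolution n _ (hn _)

end Comparison

end

theorem theorem8p6 {k H : Type u} [Field k] [Ring H] [HopfAlgebra k H]
    (hS : Function.Bijective (HopfAlgebra.antipode k : H →ₗ[k] H))
    (A : Subalgebra k H) [IsRightCoideal A]
    (hleft : LeftFaithfullyFlat A H) (hright : RightFaithfullyFlat A H)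
    (hdim : HasFiniteWeakGlobalDimension A ∨
      HasFiniteCoalgebraGlobalDimension k (FactorCoalgebra A)) :
    (∀ (M : Type u) [AddCommGroup M] [Module k M] [Module (A)ᵐᵒᵖ M] [IsScalarTower k (A)ᵐᵒᵖ M]
      (ρ : RightComodule k H M), IsHopfModuleRightRight A ρ → Module.Projective (A)ᵐᵒᵖ M) ∧
    (∀ (M : Type u) [AddCommGroup M] [Module k M] [Module H M] [IsScalarTower k H M]
      (ρ : LeftComodule k (FactorCoalgebra A) M),
      IsHopfModuleLeftLeft (H := H) (FactorCoalgebra A) ρ → ρ.IsInjective) ∧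
    (∀ (M : Type u) [AddCommGroup M] [Module k M] [Module A M] [IsScalarTower k A M]
      (ρ : RightComodule k H M), IsHopfModuleLeftRight A ρ → Module.Projective A M) ∧
    (∀ (M : Type u) [AddCommGroup M] [Module k M] [Module H M] [IsScalarTower k H M]
      (ρ : RightComodule k (FactorCoalgebra A) M),
      IsHopfModuleLeftRightQuot (H := H) (FactorCoalgebra A) ρ → ρ.IsInjective) := by
  set D := coidealDatum hS A hleft hright
  suffices h : D.AllInjective ∧ D.mirror.AllInjective from
    ⟨fun M _ _ _ _ ρ hρ => projective_of_isHopfModuleRightRight (h.1.allProjective D) ρ hρ,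
      fun M _ _ _ _ ρ hρ => isInjective_of_isHopfModuleLeftLeft h.2 ρ hρ,
      fun M _ _ _ _ ρ hρ => projective_of_isHopfModuleLeftRight (h.2.allProjective D.mirror) ρ hρ,
      fun M _ _ _ _ ρ hρ => isInjective_of_isHopfModuleLeftRightQuot h.1 ρ hρ⟩
  rcases hdim with h | ⟨n, hn⟩
  -- Finite weak global dimension of `A` gives the second property, hence the third, the fourth and
  -- the first, in this order; finite global dimension of `C` gives the fourth, the first, the second
  -- and the third.
  · have h' : D.mirror.AllInjective := allInjective_mirror_of_hasFiniteWeakGlobalDimension h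
    exact ⟨D.allInjective_of_mirror (h'.allProjective D.mirror), h'⟩
  · have h' : D.AllInjective := D.allInjective_of_hasInjectiveResolution n
      fun N _ _ ν ρ _ => hn N ρ
    exact ⟨h', D.mirror.allInjective_of_mirror
      (D.allProjective_mirror_mirror.2 (h'.allProjective D))⟩
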